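/- Let $\zeta>-1$ and $\theta>0$ (this includes all $\zeta,\theta>0$), and consider the Lorenz system $$\dot x=\zeta(y-x),\qquad \dot y=(\rho+1)x-y-xz,\qquad \dot z=xy-\theta z,\qquad \dot\rho=0,$$ in the coordinates $(u,v,w)$ given by $x=u+\zeta v$, $y=u-v$, $z=w$, in which the linearization at the origin for $\rho=0$ is $\mathrm{diag}(0,-(1+\zeta),-\theta)$. For an integer $r\ge 1$, a local center manifold of class $C^r$ is a $C^r$ map $h=(h_1,h_2)$ of $(u,\rho)$ on an open neighbourhood $U$ of $(0,0)$ in $\mathbb R^2$ with $h(0,0)=0$ and $Dh(0,0)=0$, whose graph $v=h_1(u,\rho)$, $w=h_2(u,\rho)$ is locally invariant: a trajectory that meets the graph lies on it as long as its $(u,\rho)$-part stays in $U$, forwards and backwards in time. Let $g(\rho,u)$ be the $u$-component of the vector field at the point of the graph over $(u,\rho)$, and let $X=\dfrac{\zeta}{\theta(1+\zeta)}$. For every integer $r\ge1$, a local center manifold of class $C^r$ exists, and for each such manifold: 1. As $(u,\rho)\to(0,0)$, with $\mathcal O(k)=\mathcal O(\|(u,\rho)\|^k)$, $$h_1(u,\rho)=-\frac{1}{(1+\zeta)^2}\rho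 u+\mathcal O(3),\qquad h_2(u,\rho)=\frac1\theta u^2+\mathcal O(3).$$ 2. The dynamics on the manifold are $\dot u=g(\rho,u)$: for every fixed $\rho$ and every curve $u(t)$ on a compact interval with $(u(t),\rho)\in U$, the curve over it on the graph solves the Lorenz system if and only if $\dot u=g(\rho,u)$. Moreover $$g(\rho,u)=\frac{\zeta}{1+\zeta}\rho u-\frac{\zeta}{\theta(1+\zeta)}u^3-\frac{\zeta^2}{(1+\zeta)^3}\rho^2u+\mathcal O(4).$$ 3. The family $\dot u=g(\rho,u)$ has a supercritical pitchfork bifurcation at $(\rho,u)=(0,0)$ if and only if $X>0$, and a subcritical one if and only if $X<0$. (In particular it is supercritical for all $\zeta,\theta>0$.) Here a pitchfork at $(0,0)$ means: for small $|\rho|$, in a fixed neighbourhood of $u=0$, the only equilibrium is $0$ for $\rho=0$ and for $\rho$ on one side of $0$, while for $\rho$ on the other side there are exactly three equilibria $m(\rho)<0<p(\rho)$ and $0$, with $m(\rho),p(\rho)\to0$ as $\rho\to0$. It is supercritical if $m(\rho)$, $p(\rho)$, and $0$ where it is the only equilibrium, are asymptotically stable and $0$ is unstable where the three equilibria coexist;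 it is subcritical if the same holds with "asymptotically stable" and "unstable" exchanged. -/

import Mathlib

open Set Filter Topology Asymptotics Matrix

noncomputable section

namespace LorenzCM

/-- The Lorenz vector field `(ζ (y - x), (ρ + 1) x - y - x z, x y - θ z)` at `X = (x, y, z)`. -/
def lorenzField (ζ θ ρ : ℝ) (X : Fin 3 → ℝ) : Fin 3 → ℝ :=
  ![ζ * (X 1 - X 0), (ρ + 1) * X 0 - X 1 - X 0 * X 2, X 0 * X 1 - θ * X 2]

/-- The linearization at the origin for `ρ = 0`. -/
def linPart (ζ θ : ℝ) : Matrix (Fin 3) (Fin 3) ℝ :=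
  !![-ζ, ζ, 0; 1, -1, 0; 0, 0, -θ]

/-- The matrix whose columns are the eigenvectors `(1, 1, 0)`, `(ζ, -1, 0)`, `(0, 0, 1)` of
`linPart ζ θ`, for the eigenvalues `0`, `-(1 + ζ)`, `-θ`; the change of coordinates is
`(x, y, z) = T (u, v, w)`. -/
def eigenBasis (ζ : ℝ) : Matrix (Fin 3) (Fin 3) ℝ :=
  !![1, ζ, 0; 1, -1, 0; 0, 0, 1]

/-- The Lorenz field is `A X + (0, x (ρ - z), x y)` with `A = linPart ζ θ`. -/
theorem lorenzField_eq (ζ θ ρ : ℝ) (X : Fin 3 → ℝ) :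
    lorenzField ζ θ ρ X = linPart ζ θ *ᵥ X + ![0, X 0 * (ρ - X 2), X 0 * X 1] := by
  funext i
  fin_cases i <;> simp [lorenzField, linPart, dotProduct, Fin.sum_univ_three] <;>
    ring

/-- The columns of `eigenBasis ζ` are eigenvectors of the linearization. -/
theorem linPart_mul_eigenBasis (ζ θ : ℝ) :
    linPart ζ θ * eigenBasis ζ = eigenBasis ζ * Matrix.diagonal ![0, -(1 + ζ), -θ] := by
  ext i j
  fin_cases i <;> fin_cases j <;>
    simp [linPart, eigenBasis, Matrix.mul_apply, Fin.sum_univ_three] <;> ring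

/-- The point `(x, y, z) = T (u, v, w)`. -/
def ofEigen (ζ u v w : ℝ) : Fin 3 → ℝ :=
  eigenBasis ζ *ᵥ ![u, v, w]

/-- `h = (h₁, h₂)`, as a function of `(u, ρ) ∈ U`, is a local center manifold of class `C^r` at the
origin of the Lorenz system extended by `ρ' = 0`: its graph `v = h₁(u, ρ)`, `w = h₂(u, ρ)` over a
neighbourhood `U` of `(0, 0)` passes through the origin, is tangent there to the center subspace
(the span of the `u`- and `ρ`-directions), and is locally invariant: a trajectory that meets the
graph lies on it as long as its `(u, ρ)`-part remains in `U`, forwards and backwards in time. -/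
structure IsLocalCenterManifold (ζ θ : ℝ) (r : ℕ) (U : Set (ℝ × ℝ)) (h : ℝ × ℝ → ℝ × ℝ) :
    Prop where
  isOpen : IsOpen U
  zero_mem : ((0 : ℝ), (0 : ℝ)) ∈ U
  contDiffOn : ContDiffOn ℝ r h U
  map_zero : h (0, 0) = (0, 0)
  tangent : HasFDerivAt h (0 : ℝ × ℝ →L[ℝ] ℝ × ℝ) (0, 0)
  invariant : ∀ (ρ a b : ℝ) (u v w : ℝ → ℝ),
    IsIntegralCurveOn (fun t => ofEigen ζ (u t) (v t) (w t)) (fun _ => lorenzField ζ θ ρ)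
      (Icc a b) →
    (∀ t ∈ Icc a b, (u t, ρ) ∈ U) →
    ∀ t₀ ∈ Icc a b, (v t₀, w t₀) = h (u t₀, ρ) →
      ∀ t ∈ Icc a b, (v t, w t) = h (u t, ρ)

/-- The right-hand side of the reduced equation `u' = g(ρ, u)` on the graph of `h`: the
`u`-component, in the coordinates `(u, v, w)`, of the Lorenz field at the point of the graph over
`(u, ρ)`. -/
def reducedField (ζ θ : ℝ) (h : ℝ × ℝ → ℝ × ℝ) (ρ u : ℝ) : ℝ :=
  ((eigenBasis ζ)⁻¹ *ᵥ lorenzField ζ θ ρ (ofEigen ζ u (h (u, ρ)).1 (h (u, ρ)).2)) 0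

/-- `p` is a Lyapunov stable equilibrium of the scalar equation `u' = f(u)`. -/
def IsStableEq (f : ℝ → ℝ) (p : ℝ) : Prop :=
  f p = 0 ∧ ∀ ε > 0, ∃ δ > 0, ∀ (T : ℝ) (γ : ℝ → ℝ),
    IsIntegralCurveOn γ (fun _ => f) (Icc 0 T) → |γ 0 - p| < δ →
      ∀ t ∈ Icc 0 T, |γ t - p| < ε

/-- `p` is an asymptotically stable equilibrium of `u' = f(u)`. -/
def IsAsympStableEq (f : ℝ → ℝ) (p : ℝ) : Prop :=
  IsStableEq f p ∧ ∃ δ > 0, ∀ γ : ℝ → ℝ,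
    IsIntegralCurveOn γ (fun _ => f) (Ici 0) → |γ 0 - p| < δ → Tendsto γ atTop (𝓝 p)

/-- `p` is an unstable equilibrium of `u' = f(u)`. -/
def IsUnstableEq (f : ℝ → ℝ) (p : ℝ) : Prop :=
  f p = 0 ∧ ¬ IsStableEq f p

/-- The family `u' = g ρ u` has, at `(ρ, u) = (0, 0)`, a pitchfork of equilibria: on one side of
`ρ = 0` (the side `0 < σ ρ`) exactly three equilibria `m ρ < 0 < p ρ` and `0` lie near `0`, and
`m`, `p` tend to `0` as `ρ → 0`; on the other side, and for `ρ = 0`, only the equilibrium `0`.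
The equilibria `m ρ`, `p ρ`, and `0` on the side where it is alone, are of stability type `A`;
between `m ρ` and `p ρ` the equilibrium `0` is of type `B`. -/
def IsPitchfork (A B : (ℝ → ℝ) → ℝ → Prop) (g : ℝ → ℝ → ℝ) : Prop :=
  ∃ σ : ℝ, (σ = 1 ∨ σ = -1) ∧ ∃ δ > 0, ∃ ε > 0,
    (∀ ρ, |ρ| < ε → σ * ρ ≤ 0 →
      {u ∈ Ioo (-δ) δ | g ρ u = 0} = {0} ∧ A (g ρ) 0) ∧
    ∃ m p : ℝ → ℝ,
      Tendsto m (𝓝[{ρ | 0 < σ * ρ}] 0) (𝓝 0) ∧ Tendsto p (𝓝[{ρ | 0 < σ * ρ}] 0) (𝓝 0) ∧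
      ∀ ρ, |ρ| < ε → 0 < σ * ρ →
        m ρ < 0 ∧ 0 < p ρ ∧ {u ∈ Ioo (-δ) δ | g ρ u = 0} = {m ρ, 0, p ρ} ∧
        A (g ρ) (m ρ) ∧ B (g ρ) 0 ∧ A (g ρ) (p ρ)

/-- Supercritical pitchfork: the bifurcating equilibria are asymptotically stable. -/
def IsSupercriticalPitchfork (g : ℝ → ℝ → ℝ) : Prop :=
  IsPitchfork IsAsympStableEq IsUnstableEq g

/-- Subcritical pitchfork: the bifurcating equilibria are unstable. -/
def IsSubcriticalPitchfork (g : ℝ → ℝ → ℝ) : Prop :=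
  IsPitchfork IsUnstableEq IsAsympStableEq g

/-- The normal form coefficient `X = ζ / (θ (1 + ζ))`. -/
def normalFormCoeff (ζ θ : ℝ) : ℝ := ζ / (θ * (1 + ζ))

end LorenzCM

end

/-!
The proof has three parts: existence of a center manifold of class `C^r`, the Taylor expansion of
an arbitrary one, and the bifurcation of the reduced equation.

*Existence.* In the coordinates `(u, v, w)` the Lorenz system, extended by `ρ' = 0`, has a diagonal
linear part and a quadratic nonlinearity (`fieldU`, `fieldV`, `fieldW`). Rescaling by a small `ε` and
cutting off outside a ball gives a slow-fast field whose nonlinearity has derivatives of size `ε` up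
to any prescribed order. Its trajectories of slow exponential growth are the solutions of the
Lyapunov–Perron equation `y(t) = L p + ∫ K(t, s) Ψ(y(s)) ds`, with `p` the slow components at time
`0`. The map on the right contracts in the weight `exp (-η |t|)`. Smoothness in `p` needs neither a
scale of Banach spaces nor a fiber contraction: by the Faà di Bruno formula all Picard iterates obey
the bound `‖D^j y(t)‖ ≤ (2 exp (η |t|)) ^ j` for `1 ≤ j ≤ r + 1`, with one and the same constant
(`LyapunovPerronData.contDiff_iterate`), and a uniform limit of functions with bounded derivatives
up to order `r + 1` is of class `C^r` (`contDiff_of_tendstoUniformly_of_bounded`). Uniqueness of the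
solutions makes the bundle of trajectories invariant under time translation
(`exists_trajectory_bundle`), which is the invariance of the graph; the field and its truncation
agree near the graph, so trajectories of the Lorenz system that meet the graph cannot leave it
(`eqOn_Icc_of_eqOn_isOpen`).

*Expansion.* Let `h` be any center manifold. Following a Lorenz trajectory that starts on the graph
for a short time gives the invariance equation (`IsLocalCenterManifold.fderiv_apply`), and with it
the equivalence between the reduced equation and the Lorenz system on the graph. As `h` may be only
`C¹`, its Taylor coefficients cannot be compared directly. Instead the error of the claimed
approximation is followed along the reduced flow backwards in time: at distance `n` from the origin
this flow has speed `O(n²)`, so it stays in the ball of radius `2 n` for a time of order `1 / n`,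
during which the error contracts by a factor that is exponentially small in `1 / n`; what remains is
the residual of the approximation in the invariance equation, of order `n³`
(`IsLocalCenterManifold.exists_error_bound`). Substitution gives the expansion of the reduced field.

*Bifurcation.* The expansion to fourth order does not locate the equilibria near the axis `u = 0`,
nor does it give their stability. However, an equilibrium on the graph is an equilibrium of the
Lorenz system, so that `u = 0` or `u² = θ ρ` (`IsLocalCenterManifold.eq_zero_or_sq_eq`). Hence `g`
keeps its sign along vertical segments that do not cross these curves, and the expansion is needed
only at `ρ = 0` and at `ρ = |u|`, where its leading terms dominate
(`IsLocalCenterManifold.exists_sign`). The signs show that the curves consist of equilibria and give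
their stability by elementary arguments in dimension one. The pitchfork opens towards `ρ > 0`; the
sign of `ζ`, which is that of `normalFormCoeff ζ θ`, decides between the two stability types, and for
`ζ = 0` the reduced field vanishes identically.
-/

open MeasureTheory
open scoped Nat NNReal ContDiff

/-! ### Differentiation of parametric integrals and of uniform limits -/

/-- If `F` is measurable in the parameter `a` for each point of the plane and differentiable in the
point, then its Fréchet derivative is measurable in `a`: it is a limit of difference quotients. -/
theorem aestronglyMeasurable_fderiv_of_plane {α E : Type*} [MeasurableSpace α] {μ : Measure α}
    [NormedAddCommGroup E] [NormedSpace ℝ E] {F : α → ℝ × ℝ → E}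
    (hm : ∀ p, AEStronglyMeasurable (fun a => F a p) μ)
    (hd : ∀ a, Differentiable ℝ (F a)) (p : ℝ × ℝ) :
    AEStronglyMeasurable (fun a => fderiv ℝ (F a) p) μ := by
  have key : ∀ v : ℝ × ℝ, AEStronglyMeasurable (fun a => fderiv ℝ (F a) p v) μ := by
    intro v
    refine aestronglyMeasurable_of_tendsto_ae (u := atTop)
      (f := fun (n : ℕ) a => (n : ℝ) • (F a (p + (n : ℝ)⁻¹ • v) - F a p)) ?_ ?_
    · intro n
      exact ((hm _).sub (hm _)).const_smul _
    · refine Eventually.of_forall fun a => ?_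
      exact ((hd a) p).hasFDerivAt.lim_real v |>.comp tendsto_natCast_atTop_atTop
  have e : (fun a => fderiv ℝ (F a) p) = fun a =>
      (ContinuousLinearMap.fst ℝ ℝ ℝ).smulRight (fderiv ℝ (F a) p (1, 0)) +
      (ContinuousLinearMap.snd ℝ ℝ ℝ).smulRight (fderiv ℝ (F a) p (0, 1)) := by
    funext a
    ext <;> simp
  rw [e]
  have h1 : ∀ c : ℝ × ℝ →L[ℝ] ℝ, Continuous fun x : E => c.smulRight x := fun c =>
    (ContinuousLinearMap.smulRightL ℝ (ℝ × ℝ) E c).continuous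
  exact ((h1 _).comp_aestronglyMeasurable (key _)).add ((h1 _).comp_aestronglyMeasurable (key _))

/-- A parametric integral over a plane of parameters inherits `C^m` regularity, and bounds on the
derivatives up to order `m`, from integrable bounds on the derivatives of the integrand. -/
theorem contDiff_integral_and_norm_iteratedFDeriv_le {α : Type*} [MeasurableSpace α] {μ : Measure α}
    (m : ℕ) :
    ∀ {E : Type*} [NormedAddCommGroup E] [NormedSpace ℝ E] [CompleteSpace E]
    {F : α → ℝ × ℝ → E} {b : ℕ → α → ℝ},
    (∀ p, AEStronglyMeasurable (fun a => F a p) μ) →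
    (∀ a, ContDiff ℝ m (F a)) →
    (∀ k ≤ m, Integrable (b k) μ) →
    (∀ k ≤ m, ∀ a p, ‖iteratedFDeriv ℝ k (F a) p‖ ≤ b k a) →
    ContDiff ℝ m (fun p => ∫ a, F a p ∂μ) ∧
    ∀ k ≤ m, ∀ p, ‖iteratedFDeriv ℝ k (fun p => ∫ a, F a p ∂μ) p‖ ≤ ∫ a, b k a ∂μ := by
  induction m with
  | zero =>
    intro E _ _ _ F b hm hF hb hle
    have h0 : ∀ a p, ‖F a p‖ ≤ b 0 a := fun a p => by simpa using hle 0 le_rfl a p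
    refine ⟨?_, ?_⟩
    · simp only [Nat.cast_zero, contDiff_zero] at hF ⊢
      exact continuous_of_dominated hm (fun p => Eventually.of_forall fun a => h0 a p) (hb 0 le_rfl)
        (Eventually.of_forall fun a => hF a)
    · intro k hk p
      obtain rfl : k = 0 := by omega
      simpa using norm_integral_le_of_norm_le (hb 0 le_rfl) (Eventually.of_forall fun a => h0 a p)
  | succ m ih =>
    intro E _ _ _ F b hm hF hb hle
    have h0 : ∀ a p, ‖F a p‖ ≤ b 0 a := fun a p => by simpa using hle 0 (by omega) a p
    have hdiff : ∀ a, Differentiable ℝ (F a) := fun a => (hF a).differentiable (by simp)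
    have hm' := aestronglyMeasurable_fderiv_of_plane hm hdiff
    have h1 : ∀ a p, ‖fderiv ℝ (F a) p‖ ≤ b 1 a := fun a p => by
      simpa [norm_iteratedFDeriv_one] using hle 1 (by omega) a p
    have hD : ∀ p, HasFDerivAt (fun p => ∫ a, F a p ∂μ) (∫ a, fderiv ℝ (F a) p ∂μ) p := fun p =>
      hasFDerivAt_integral_of_dominated_of_fderiv_le (F := fun p a => F a p)
        (F' := fun p a => fderiv ℝ (F a) p) (s := univ) univ_mem
        (Eventually.of_forall hm)
        ((hb 0 (by omega)).mono' (hm p) (Eventually.of_forall fun a => h0 a p)) (hm' p)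
        (Eventually.of_forall fun a p _ => h1 a p) (hb 1 (by omega))
        (Eventually.of_forall fun a p _ => (hdiff a p).hasFDerivAt)
    have hfd : fderiv ℝ (fun p => ∫ a, F a p ∂μ) = fun p => ∫ a, fderiv ℝ (F a) p ∂μ :=
      funext fun p => (hD p).fderiv
    obtain ⟨i1, i2⟩ := ih (F := fun a => fderiv ℝ (F a)) (b := fun k => b (k + 1)) hm'
      (fun a => (hF a).fderiv_right (by norm_cast)) (fun k hk => hb _ (by omega))
      (fun k hk a p => by rw [norm_iteratedFDeriv_fderiv]; exact hle _ (by omega) a p)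
    refine ⟨?_, ?_⟩
    · rw [Nat.cast_succ, contDiff_succ_iff_fderiv]
      refine ⟨fun p => (hD p).differentiableAt, by simp, ?_⟩
      rw [hfd]; exact i1
    · intro k hk p
      rcases k with _ | k
      · simpa using norm_integral_le_of_norm_le (hb 0 (by omega))
          (Eventually.of_forall fun a => h0 a p)
      · rw [← norm_iteratedFDeriv_fderiv, hfd]
        exact i2 k (by omega) p

/-- Interpolation between a function and its second derivative: the first derivative is controlled
by `‖f‖ / h + ‖D²f‖ h`, for every `h > 0`. -/
theorem norm_fderiv_le_of_norm_le_of_lipschitz {P E : Type*} [NormedAddCommGroup P] [NormedSpace ℝ P]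
    [NormedAddCommGroup E] [NormedSpace ℝ E] {f : P → E} {a B h : ℝ} (hf : Differentiable ℝ f)
    (ha : ∀ x, ‖f x‖ ≤ a) (hB : 0 ≤ B)
    (hL : ∀ x y, ‖fderiv ℝ f x - fderiv ℝ f y‖ ≤ B * ‖x - y‖) (hh : 0 < h) (x : P) :
    ‖fderiv ℝ f x‖ ≤ 2 * a / h + B * h := by
  have ha0 : 0 ≤ a := (norm_nonneg _).trans (ha x)
  refine ContinuousLinearMap.opNorm_le_of_unit_norm (by positivity) fun v hv => ?_
  have key : ‖f (x + h • v) - f x - fderiv ℝ f x (x + h • v - x)‖ ≤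
      (B * h) * ‖x + h • v - x‖ := by
    refine Convex.norm_image_sub_le_of_norm_hasFDerivWithin_le' (s := Metric.closedBall x h)
      (f' := fun y => fderiv ℝ f y)
      (fun y _ => (hf y).hasFDerivAt.hasFDerivWithinAt) (fun y hy => ?_) (convex_closedBall _ _)
      (Metric.mem_closedBall_self hh.le) ?_
    · refine (hL y x).trans ?_
      gcongr
      rwa [← mem_closedBall_iff_norm]
    · simp [norm_smul, hv, abs_of_pos hh]
  have e : x + h • v - x = h • v := by abel
  rw [e, map_smul, norm_smul, hv, Real.norm_of_nonneg hh.le, mul_one] at key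
  have h2 : ‖h • fderiv ℝ f x v‖ ≤ 2 * a + B * h * h := by
    calc ‖h • fderiv ℝ f x v‖ = ‖f (x + h • v) - f x -
          (f (x + h • v) - f x - h • fderiv ℝ f x v)‖ := by congr 1; abel
      _ ≤ ‖f (x + h • v)‖ + ‖f x‖ + ‖f (x + h • v) - f x - h • fderiv ℝ f x v‖ :=
        (norm_sub_le _ _).trans (by gcongr; exact norm_sub_le _ _)
      _ ≤ a + a + B * h * h := by gcongr <;> apply ha
      _ = _ := by ring
  rw [norm_smul, Real.norm_of_nonneg hh.le] at h2
  have : ‖fderiv ℝ f x v‖ ≤ (2 * a + B * h * h) / h := by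
    rw [le_div_iff₀ hh]; linarith
  calc _ ≤ _ := this
    _ = _ := by field_simp

/-- A uniform limit of functions whose derivatives of orders `2, …, m + 1` are uniformly bounded is
of class `C^m`. -/
theorem contDiff_of_tendstoUniformly_of_bounded {P : Type} [NormedAddCommGroup P] [NormedSpace ℝ P]
    (m : ℕ) : ∀ {E : Type*} [NormedAddCommGroup E] [NormedSpace ℝ E] [CompleteSpace E]
    {f : ℕ → P → E} {g : P → E} {B : ℝ},
    (∀ n, ContDiff ℝ (m + 1 : ℕ) (f n)) →
    (∀ k, 2 ≤ k → k ≤ m + 1 → ∀ n x, ‖iteratedFDeriv ℝ k (f n) x‖ ≤ B) →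
    TendstoUniformly f g atTop → ContDiff ℝ m g := by
  induction m with
  | zero =>
    intro E _ _ _ f g B hf _ hu
    simp only [Nat.cast_zero, contDiff_zero]
    exact hu.continuous (Frequently.of_forall fun n => (hf n).continuous)
  | succ m ih =>
    intro E _ _ _ f g B hf hB hu
    have hB0 : 0 ≤ B := (norm_nonneg _).trans (hB 2 le_rfl (by omega) 0 0)
    have hdiff : ∀ n, Differentiable ℝ (f n) := fun n => (hf n).differentiable (by simp)
    have hf2 : ∀ n, ContDiff ℝ (m + 1 : ℕ) (fderiv ℝ (f n)) := fun n =>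
      (hf n).fderiv_right (by norm_cast)
    have hLip : ∀ n x y, ‖fderiv ℝ (f n) x - fderiv ℝ (f n) y‖ ≤ B * ‖x - y‖ := by
      intro n x y
      refine Convex.norm_image_sub_le_of_norm_fderiv_le (s := univ) (𝕜 := ℝ)
        (fun z _ => ((hf2 n).differentiable (by simp)) z) (fun z _ => ?_) convex_univ
        (mem_univ _) (mem_univ _)
      have := hB 2 le_rfl (by omega) n z
      rwa [← norm_iteratedFDeriv_fderiv, norm_iteratedFDeriv_one] at this
    have hc : UniformCauchySeqOn (fun n => fderiv ℝ (f n)) atTop univ := by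
      rw [Metric.uniformCauchySeqOn_iff]
      intro ε hε
      set h : ℝ := ε / (4 * (2 * B + 1)) with hh
      have hhp : 0 < h := by positivity
      have hu' : UniformCauchySeqOn f atTop univ :=
        (tendstoUniformlyOn_univ.2 hu).uniformCauchySeqOn
      rw [Metric.uniformCauchySeqOn_iff] at hu'
      obtain ⟨N, hN⟩ := hu' (ε * h / 8) (by positivity)
      refine ⟨N, fun i hi j hj x _ => ?_⟩
      have hs : fderiv ℝ (fun y => f i y - f j y) = fun y => fderiv ℝ (f i) y - fderiv ℝ (f j) y :=
        funext fun y => fderiv_fun_sub (hdiff i y) (hdiff j y)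
      have := norm_fderiv_le_of_norm_le_of_lipschitz (f := fun y => f i y - f j y)
        (a := ε * h / 8) (B := 2 * B) (h := h) ((hdiff i).sub (hdiff j))
        (fun y => by rw [← dist_eq_norm]; exact (hN i hi j hj y (mem_univ _)).le) (by positivity)
        (fun y z => by
          rw [hs]
          calc _ = ‖(fderiv ℝ (f i) y - fderiv ℝ (f i) z) -
                (fderiv ℝ (f j) y - fderiv ℝ (f j) z)‖ := by rw [sub_sub_sub_comm]
            _ ≤ B * ‖y - z‖ + B * ‖y - z‖ :=
              (norm_sub_le _ _).trans (add_le_add (hLip i y z) (hLip j y z))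
            _ = _ := by ring) hhp x
      rw [hs] at this
      rw [dist_eq_norm]
      refine this.trans_lt ?_
      have e1 : 2 * (ε * h / 8) / h = ε / 4 := by field_simp; norm_num
      have e2 : 2 * B * h ≤ ε / 4 := by
        rw [hh, mul_div_assoc', div_le_div_iff₀ (by positivity) (by norm_num)]
        nlinarith
      rw [e1]; linarith
    have hpt : ∀ x, ∃ l, Tendsto (fun n => fderiv ℝ (f n) x) atTop (𝓝 l) := fun x =>
      cauchySeq_tendsto_of_complete (hc.cauchySeq (mem_univ x))
    choose g' hg' using hpt
    have hu2 : TendstoUniformly (fun n => fderiv ℝ (f n)) g' atTop :=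
      tendstoUniformlyOn_univ.1 (hc.tendstoUniformlyOn_of_tendsto fun x _ => hg' x)
    have hD : ∀ x, HasFDerivAt g (g' x) x := fun x =>
      hasFDerivAt_of_tendstoUniformly hu2 (fun n x => (hdiff n x).hasFDerivAt)
        (fun x => hu.tendsto_at x) x
    rw [Nat.cast_succ, contDiff_succ_iff_fderiv]
    refine ⟨fun x => (hD x).differentiableAt, by simp, ?_⟩
    rw [show fderiv ℝ g = g' from funext fun x => (hD x).fderiv]
    exact ih (B := B) hf2 (fun k hk hk' n x => by
      rw [norm_iteratedFDeriv_fderiv]; exact hB _ (by omega) (by omega) n x) hu2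

/-! ### The Lyapunov–Perron equation -/

theorem integrable_exp_neg_mul_abs {η : ℝ} (hη : 0 < η) :
    Integrable (fun s : ℝ => Real.exp (-(η * |s|))) := by
  have h1 : IntegrableOn (fun s : ℝ => Real.exp (-(η * |s|))) (Ioi 0) :=
    (exp_neg_integrableOn_Ioi 0 hη).congr_fun (fun s hs => by
      rw [abs_of_pos hs]; simp) measurableSet_Ioi
  have h2 : IntegrableOn (fun s : ℝ => Real.exp (-(η * |s|))) (Iic 0) := by
    have h3 : IntegrableOn (fun s : ℝ => Real.exp (-(η * |s|))) (Ici (-0)) := by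
      rw [neg_zero, integrableOn_Ici_iff_integrableOn_Ioi]
      exact h1
    simpa using h3.comp_neg_Iic
  rw [← integrableOn_univ, ← Iic_union_Ioi (a := (0 : ℝ))]
  exact h2.union h1

/-- The hypotheses of the Lyapunov–Perron construction: a Green kernel `K` that preserves each of
the growth rates `exp (j η |t|)`, `1 ≤ j ≤ m`, and a nonlinearity `Ψ` whose derivatives up to order
`m` are bounded by a constant `c` that is small compared with the kernel. -/
structure LyapunovPerronData {E : Type*} [NormedAddCommGroup E] [NormedSpace ℝ E]
    (m : ℕ) (η A c : ℝ) (K : ℝ → ℝ → E →L[ℝ] E) (Ψ : E → E) : Prop where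
  one_le : 1 ≤ m
  eta_pos : 0 < η
  kernel_meas : StronglyMeasurable (Function.uncurry K)
  kernel_le : ∀ j : ℕ, 1 ≤ j → j ≤ m → ∀ t s,
    ‖K t s‖ * Real.exp (j * (η * |s|)) ≤ A * Real.exp (j * (η * |t|)) * Real.exp (-(η * |t - s|))
  contDiff : ContDiff ℝ m Ψ
  deriv_le : ∀ i ≤ m, ∀ x, ‖iteratedFDeriv ℝ i Ψ x‖ ≤ c
  small : m ! * c * (A * ∫ s : ℝ, Real.exp (-(η * |s|))) ≤ 1 / 2

namespace LyapunovPerronData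

variable {E : Type*} [NormedAddCommGroup E] [NormedSpace ℝ E]
  {m : ℕ} {η A c : ℝ} {K : ℝ → ℝ → E →L[ℝ] E} {Ψ : E → E}

theorem c_nonneg (h : LyapunovPerronData m η A c K Ψ) : 0 ≤ c :=
  (norm_nonneg _).trans (h.deriv_le 0 (by omega) 0)

theorem A_nonneg (h : LyapunovPerronData m η A c K Ψ) : 0 ≤ A := by
  have := h.kernel_le 1 le_rfl h.one_le 0 0
  simp at this
  exact (norm_nonneg _).trans this

theorem integrable_shift (h : LyapunovPerronData m η A c K Ψ) (t : ℝ) :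
    Integrable (fun s => Real.exp (-(η * |t - s|))) :=
  (integrable_exp_neg_mul_abs h.eta_pos).comp_sub_left t

theorem integral_shift (t : ℝ) :
    ∫ s, Real.exp (-(η * |t - s|)) = ∫ s : ℝ, Real.exp (-(η * |s|)) :=
  integral_sub_left_eq_self (fun s => Real.exp (-(η * |s|))) volume t

theorem gain_nonneg (h : LyapunovPerronData m η A c K Ψ) :
    0 ≤ A * ∫ s : ℝ, Real.exp (-(η * |s|)) :=
  mul_nonneg h.A_nonneg (integral_nonneg fun _ => (Real.exp_pos _).le)

theorem norm_apply_le (h : LyapunovPerronData m η A c K Ψ) {j : ℕ} (hj : 1 ≤ j) (hjm : j ≤ m)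
    {B : ℝ} (hB : 0 ≤ B) {t s k : ℝ} (hk : k ≤ B * Real.exp (j * (η * |s|))) :
    ‖K t s‖ * k ≤ B * (A * Real.exp (j * (η * |t|))) * Real.exp (-(η * |t - s|)) := by
  calc ‖K t s‖ * k ≤ ‖K t s‖ * (B * Real.exp (j * (η * |s|))) := by gcongr
    _ = B * (‖K t s‖ * Real.exp (j * (η * |s|))) := by ring
    _ ≤ B * (A * Real.exp (j * (η * |t|)) * Real.exp (-(η * |t - s|))) :=
      mul_le_mul_of_nonneg_left (h.kernel_le j hj hjm t s) hB
    _ = _ := by ring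

theorem measurable_apply (h : LyapunovPerronData m η A c K Ψ) {f : ℝ → E}
    (hf : StronglyMeasurable f) :
    StronglyMeasurable (fun q : ℝ × ℝ => K q.1 q.2 (f q.2)) :=
  isBoundedBilinearMap_apply.continuous.comp_stronglyMeasurable
    (h.kernel_meas.prodMk (hf.comp_measurable measurable_snd))

theorem measurable_apply_right (h : LyapunovPerronData m η A c K Ψ) {f : ℝ → E}
    (hf : StronglyMeasurable f) (t : ℝ) : StronglyMeasurable (fun s => K t s (f s)) :=
  (h.measurable_apply hf).comp_measurable measurable_prodMk_left

theorem integrable_apply (h : LyapunovPerronData m η A c K Ψ) {j : ℕ} (hj : 1 ≤ j) (hjm : j ≤ m)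
    {B : ℝ} (hB : 0 ≤ B) {f : ℝ → E} (hf : StronglyMeasurable f)
    (hfB : ∀ s, ‖f s‖ ≤ B * Real.exp (j * (η * |s|))) (t : ℝ) :
    Integrable (fun s => K t s (f s)) :=
  ((h.integrable_shift t).const_mul _).mono' (h.measurable_apply_right hf t).aestronglyMeasurable
    (Eventually.of_forall fun s => ((K t s).le_opNorm _).trans (h.norm_apply_le hj hjm hB (hfB s)))

theorem norm_integral_apply_le (h : LyapunovPerronData m η A c K Ψ) {j : ℕ} (hj : 1 ≤ j)
    (hjm : j ≤ m) {B : ℝ} (hB : 0 ≤ B) {f : ℝ → E}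
    (hfB : ∀ s, ‖f s‖ ≤ B * Real.exp (j * (η * |s|))) (t : ℝ) :
    ‖∫ s, K t s (f s)‖ ≤
      B * (A * ∫ s : ℝ, Real.exp (-(η * |s|))) * Real.exp (j * (η * |t|)) := by
  refine (norm_integral_le_of_norm_le ((h.integrable_shift t).const_mul _)
    (Eventually.of_forall fun s =>
      ((K t s).le_opNorm _).trans (h.norm_apply_le hj hjm hB (hfB s)))).trans (le_of_eq ?_)
  rw [integral_const_mul, integral_shift]
  ring

theorem one_le_exp (h : LyapunovPerronData m η A c K Ψ) (t : ℝ) :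
    1 ≤ Real.exp ((1 : ℕ) * (η * |t|)) :=
  Real.one_le_exp (by have := h.eta_pos; positivity)

theorem norm_le (h : LyapunovPerronData m η A c K Ψ) (x : E) : ‖Ψ x‖ ≤ c := by
  simpa using h.deriv_le 0 (by omega) x

theorem norm_le_exp (h : LyapunovPerronData m η A c K Ψ) (x : E) (s : ℝ) :
    ‖Ψ x‖ ≤ c * Real.exp ((1 : ℕ) * (η * |s|)) :=
  (h.norm_le x).trans (le_mul_of_one_le_right h.c_nonneg (h.one_le_exp s))

theorem norm_sub_le (h : LyapunovPerronData m η A c K Ψ) (x y : E) :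
    ‖Ψ x - Ψ y‖ ≤ c * ‖x - y‖ := by
  refine Convex.norm_image_sub_le_of_norm_fderiv_le (s := univ) (𝕜 := ℝ)
    (fun z _ => (h.contDiff.differentiable
      (by have := h.one_le; norm_cast; omega)) z) (fun z _ => ?_) convex_univ
    (mem_univ _) (mem_univ _)
  rw [← norm_iteratedFDeriv_one]
  exact h.deriv_le 1 h.one_le z

theorem small_one (h : LyapunovPerronData m η A c K Ψ) :
    c * (A * ∫ s : ℝ, Real.exp (-(η * |s|))) ≤ 1 / 2 := by
  refine le_trans ?_ h.small
  have h1 : (1 : ℝ) ≤ m ! := by exact_mod_cast Nat.one_le_iff_ne_zero.2 (Nat.factorial_ne_zero m)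
  have := mul_nonneg h.c_nonneg h.gain_nonneg
  nlinarith

theorem measurable_comp (h : LyapunovPerronData m η A c K Ψ) {y : ℝ → E}
    (hy : StronglyMeasurable y) : StronglyMeasurable (fun s => Ψ (y s)) :=
  h.contDiff.continuous.comp_stronglyMeasurable hy

theorem integrable_comp (h : LyapunovPerronData m η A c K Ψ) {y : ℝ → E}
    (hy : StronglyMeasurable y) (t : ℝ) : Integrable (fun s => K t s (Ψ (y s))) :=
  h.integrable_apply le_rfl h.one_le h.c_nonneg (h.measurable_comp hy)
    (fun s => h.norm_le_exp _ s) t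

/-- One step of the contraction in the weight `exp (η |t|)`. -/
theorem norm_integral_sub_le (h : LyapunovPerronData m η A c K Ψ) {y z : ℝ → E} {B : ℝ}
    (hB : 0 ≤ B) (hy : StronglyMeasurable y) (hz : StronglyMeasurable z)
    (hyz : ∀ s, ‖y s - z s‖ ≤ B * Real.exp ((1 : ℕ) * (η * |s|))) (t : ℝ) :
    ‖(∫ s, K t s (Ψ (y s))) - ∫ s, K t s (Ψ (z s))‖ ≤
      B / 2 * Real.exp ((1 : ℕ) * (η * |t|)) := by
  rw [← integral_sub (h.integrable_comp hy t) (h.integrable_comp hz t)]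
  simp_rw [← map_sub]
  refine (h.norm_integral_apply_le (B := c * B) le_rfl h.one_le (mul_nonneg h.c_nonneg hB)
    (fun s => ?_) t).trans ?_
  · calc _ ≤ c * ‖y s - z s‖ := h.norm_sub_le _ _
      _ ≤ c * (B * Real.exp ((1 : ℕ) * (η * |s|))) :=
        mul_le_mul_of_nonneg_left (hyz s) h.c_nonneg
      _ = _ := by ring
  · have := h.small_one
    refine mul_le_mul_of_nonneg_right ?_ (Real.exp_pos _).le
    calc _ = B * (c * (A * ∫ s : ℝ, Real.exp (-(η * |s|)))) := by ring
      _ ≤ B * (1 / 2) := mul_le_mul_of_nonneg_left this hB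
      _ = _ := by ring

/-- Measurable solutions of the Lyapunov–Perron equation are unique. -/
theorem unique (h : LyapunovPerronData m η A c K Ψ) {x : E} {y z : ℝ → E}
    (hy : StronglyMeasurable y) (hz : StronglyMeasurable z)
    (hy' : ∀ t, y t = x + ∫ s, K t s (Ψ (y s))) (hz' : ∀ t, z t = x + ∫ s, K t s (Ψ (z s))) :
    y = z := by
  have hG := mul_nonneg h.c_nonneg h.gain_nonneg
  set B : ℝ := 2 * (c * (A * ∫ s : ℝ, Real.exp (-(η * |s|)))) with hBdef
  have hB : 0 ≤ B := by positivity
  have h0 : ∀ t, ‖y t - z t‖ ≤ B * Real.exp ((1 : ℕ) * (η * |t|)) := by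
    intro t
    rw [hy', hz', add_sub_add_left_eq_sub]
    refine (_root_.norm_sub_le _ _).trans ?_
    have e1 := h.norm_integral_apply_le le_rfl h.one_le h.c_nonneg
      (fun s => h.norm_le_exp (y s) s) t
    have e2 := h.norm_integral_apply_le le_rfl h.one_le h.c_nonneg
      (fun s => h.norm_le_exp (z s) s) t
    rw [hBdef]; linarith
  have hn : ∀ n : ℕ, ∀ t, ‖y t - z t‖ ≤ B / 2 ^ n * Real.exp ((1 : ℕ) * (η * |t|)) := by
    intro n
    induction n with
    | zero => simpa using h0
    | succ n ih =>
      intro t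
      have := h.norm_integral_sub_le (by positivity) hy hz ih t
      rw [hy', hz', add_sub_add_left_eq_sub]
      refine this.trans (le_of_eq ?_)
      rw [pow_succ]; ring
  funext t
  have hlim : Tendsto (fun n : ℕ => B / 2 ^ n * Real.exp ((1 : ℕ) * (η * |t|))) atTop (𝓝 0) := by
    have := (tendsto_pow_atTop_nhds_zero_of_lt_one (r := (1 / 2 : ℝ)) (by norm_num)
      (by norm_num)).const_mul (B * Real.exp ((1 : ℕ) * (η * |t|)))
    rw [mul_zero] at this
    refine this.congr fun n => ?_
    rw [one_div, inv_pow]; ring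
  have : ‖y t - z t‖ ≤ 0 := ge_of_tendsto' hlim fun n => hn n t
  exact sub_eq_zero.1 (norm_le_zero_iff.1 this)

end LyapunovPerronData

/-- The Picard iterates of the Lyapunov–Perron equation with linear part `L`. -/
noncomputable def lyapunovPerronIterate {E : Type*} [NormedAddCommGroup E] [NormedSpace ℝ E]
    (K : ℝ → ℝ → E →L[ℝ] E) (Ψ : E → E) (L : ℝ × ℝ →L[ℝ] E) : ℕ → ℝ → ℝ × ℝ → E
  | 0, _, p => L p
  | n + 1, t, p => L p + ∫ s, K t s (Ψ (lyapunovPerronIterate K Ψ L n s p))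

theorem norm_iteratedFDeriv_clm_le {E : Type*} [NormedAddCommGroup E] [NormedSpace ℝ E]
    {L : ℝ × ℝ →L[ℝ] E} (hL : ‖L‖ ≤ 1) {j : ℕ} (hj : 1 ≤ j) (p : ℝ × ℝ) :
    ‖iteratedFDeriv ℝ j L p‖ ≤ 1 := by
  rcases j with _ | _ | j
  · omega
  · rw [zero_add, norm_iteratedFDeriv_one, L.fderiv]; exact hL
  · rw [← norm_iteratedFDeriv_fderiv]
    have : fderiv ℝ L = fun _ => L := funext fun x => L.fderiv
    rw [this, iteratedFDeriv_succ_const]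
    simp

namespace LyapunovPerronData

variable {E : Type*} [NormedAddCommGroup E] [NormedSpace ℝ E]
  {m : ℕ} {η A c : ℝ} {K : ℝ → ℝ → E →L[ℝ] E} {Ψ : E → E} {L : ℝ × ℝ →L[ℝ] E}

theorem stronglyMeasurable_iterate (h : LyapunovPerronData m η A c K Ψ)
    (n : ℕ) (p : ℝ × ℝ) : StronglyMeasurable (fun t => lyapunovPerronIterate K Ψ L n t p) := by
  induction n with
  | zero => exact stronglyMeasurable_const
  | succ n ih =>
    exact stronglyMeasurable_const.add
      (h.measurable_apply (h.measurable_comp ih)).integral_prod_right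

/-- The derivatives of all the iterates obey one and the same geometric bound. This closes because
the `j`-th derivative of the nonlinear term is, by the Faà di Bruno formula, at most
`j! c (2 exp (η |t|)) ^ j`, of the right growth and with a small constant. -/
theorem contDiff_iterate (h : LyapunovPerronData m η A c K Ψ) [CompleteSpace E] (hL : ‖L‖ ≤ 1)
    (n : ℕ) : (∀ t, ContDiff ℝ m (lyapunovPerronIterate K Ψ L n t)) ∧
      ∀ j, 1 ≤ j → j ≤ m → ∀ t p, ‖iteratedFDeriv ℝ j (lyapunovPerronIterate K Ψ L n t) p‖ ≤
        (2 * Real.exp (η * |t|)) ^ j := by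
  have he : ∀ t : ℝ, 1 ≤ Real.exp (η * |t|) := fun t =>
    Real.one_le_exp (by have := h.eta_pos; positivity)
  induction n with
  | zero =>
    refine ⟨fun t => L.contDiff, fun j hj hjm t p => ?_⟩
    refine (norm_iteratedFDeriv_clm_le hL hj p).trans (one_le_pow₀ ?_)
    linarith [he t]
  | succ n ih =>
    obtain ⟨ih1, ih2⟩ := ih
    have hpow : ∀ (j : ℕ) (t : ℝ), (2 * Real.exp (η * |t|)) ^ j =
        2 ^ j * Real.exp (j * (η * |t|)) := fun j t => by
      rw [mul_pow, ← Real.exp_nat_mul]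
    have hcomp : ∀ t, ContDiff ℝ m (fun p => Ψ (lyapunovPerronIterate K Ψ L n t p)) := fun t =>
      h.contDiff.comp (ih1 t)
    have hcb : ∀ j, j ≤ m → ∀ t p,
        ‖iteratedFDeriv ℝ j (fun p => Ψ (lyapunovPerronIterate K Ψ L n t p)) p‖ ≤
          (j ! * c * 2 ^ j) * Real.exp (j * (η * |t|)) := by
      intro j hj t p
      have := norm_iteratedFDeriv_comp_le (g := Ψ) (f := lyapunovPerronIterate K Ψ L n t)
        h.contDiff (ih1 t) (n := j) (by exact_mod_cast hj) p (C := c)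
        (D := 2 * Real.exp (η * |t|)) (fun i hi => h.deriv_le i (by omega) _)
        (fun i hi hi' => ih2 i hi (by omega) t p)
      rw [hpow] at this
      refine this.trans (le_of_eq (by ring))
    -- the weight for the function itself is that of the first derivatives
    have hj1 : ∀ j : ℕ, 1 ≤ max j 1 := fun j => le_max_right _ _
    have hjm : ∀ j : ℕ, j ≤ m → max j 1 ≤ m := fun j hj => max_le hj h.one_le
    have hc := h.c_nonneg
    have hη := h.eta_pos
    have hmain := fun t => contDiff_integral_and_norm_iteratedFDeriv_le (μ := (volume : Measure ℝ))
      m (F := fun s p => K t s (Ψ (lyapunovPerronIterate K Ψ L n s p)))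
      (b := fun j s => (j ! * c * 2 ^ j) * (A * Real.exp ((max j 1 : ℕ) * (η * |t|))) *
        Real.exp (-(η * |t - s|)))
      (fun p => (h.measurable_apply_right
        (h.measurable_comp (h.stronglyMeasurable_iterate n p)) t).aestronglyMeasurable)
      (fun s => (K t s).contDiff.comp (hcomp s))
      (fun j hj => (h.integrable_shift t).const_mul _)
      (fun j hj s p => by
        refine ((K t s).norm_iteratedFDeriv_comp_left (N := m) (hcomp s).contDiffAt
          (by exact_mod_cast hj)).trans ?_
        refine h.norm_apply_le (hj1 j) (hjm j hj) (by positivity) ((hcb j hj s p).trans ?_)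
        gcongr
        exact le_max_left _ _)
    refine ⟨fun t => L.contDiff.add (hmain t).1, fun j hj hjm' t p => ?_⟩
    have e1 : iteratedFDeriv ℝ j (lyapunovPerronIterate K Ψ L (n + 1) t) p =
        iteratedFDeriv ℝ j L p +
        iteratedFDeriv ℝ j (fun p => ∫ s, K t s (Ψ (lyapunovPerronIterate K Ψ L n s p))) p :=
      iteratedFDeriv_add_apply (f := L)
        (g := fun p => ∫ s, K t s (Ψ (lyapunovPerronIterate K Ψ L n s p)))
        (L.contDiff.contDiffAt) (((hmain t).1.of_le (by exact_mod_cast hjm')).contDiffAt)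
    have e2 := (hmain t).2 j hjm' p
    rw [integral_const_mul, integral_shift, max_eq_left hj] at e2
    have e3 : (j ! : ℝ) * c * (A * ∫ s : ℝ, Real.exp (-(η * |s|))) ≤ 1 / 2 := by
      refine le_trans ?_ h.small
      have hg := h.gain_nonneg
      gcongr
    have e4 : ‖iteratedFDeriv ℝ j
        (fun p => ∫ s, K t s (Ψ (lyapunovPerronIterate K Ψ L n s p))) p‖ ≤
        1 / 2 * (2 ^ j * Real.exp (j * (η * |t|))) := by
      refine e2.trans ?_
      calc _ = ((j ! : ℝ) * c * (A * ∫ s : ℝ, Real.exp (-(η * |s|)))) *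
            (2 ^ j * Real.exp (j * (η * |t|))) := by ring
        _ ≤ _ := by gcongr
    rw [e1, hpow]
    refine (norm_add_le _ _).trans ?_
    have e5 := norm_iteratedFDeriv_clm_le hL hj p
    have e6 : 2 ≤ (2 : ℝ) ^ j * Real.exp (j * (η * |t|)) := by
      have a1 : (2 : ℝ) ≤ 2 ^ j := le_self_pow₀ (by norm_num) (by omega)
      have a2 : 1 ≤ Real.exp (j * (η * |t|)) := Real.one_le_exp (by positivity)
      nlinarith
    linarith

theorem norm_iterate_succ_sub_le (h : LyapunovPerronData m η A c K Ψ) (n : ℕ) (t : ℝ)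
    (p : ℝ × ℝ) :
    ‖lyapunovPerronIterate K Ψ L (n + 1) t p - lyapunovPerronIterate K Ψ L n t p‖ ≤
      1 / 2 / 2 ^ n * Real.exp ((1 : ℕ) * (η * |t|)) := by
  induction n generalizing t with
  | zero =>
    have e1 := h.norm_integral_apply_le le_rfl h.one_le h.c_nonneg
      (fun s => h.norm_le_exp (L p) s) t
    have : lyapunovPerronIterate K Ψ L (0 + 1) t p - lyapunovPerronIterate K Ψ L 0 t p =
        ∫ s, K t s (Ψ (L p)) := by
      simp [lyapunovPerronIterate]
    rw [this]
    refine e1.trans ?_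
    have := h.small_one
    gcongr
    simpa using this
  | succ n ih =>
    have := h.norm_integral_sub_le (B := 1 / 2 / 2 ^ n) (by positivity)
      (h.stronglyMeasurable_iterate (L := L) (n + 1) p) (h.stronglyMeasurable_iterate n p) ih t
    have e : lyapunovPerronIterate K Ψ L (n + 1 + 1) t p - lyapunovPerronIterate K Ψ L (n + 1) t p =
        (∫ s, K t s (Ψ (lyapunovPerronIterate K Ψ L (n + 1) s p))) -
        ∫ s, K t s (Ψ (lyapunovPerronIterate K Ψ L n s p)) :=
      add_sub_add_left_eq_sub _ _ _
    rw [e]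
    refine this.trans (le_of_eq ?_)
    rw [pow_succ]; ring

/-- The Lyapunov–Perron equation has a solution that is of class `C^m` in the parameters. One order
is lost against the nonlinearity, because the iterates converge only uniformly. -/
theorem exists_solution (h : LyapunovPerronData (m + 1) η A c K Ψ) [CompleteSpace E]
    (hL : ‖L‖ ≤ 1) :
    ∃ y : ℝ → ℝ × ℝ → E, (∀ p, StronglyMeasurable (fun t => y t p)) ∧
      (∀ t p, y t p = L p + ∫ s, K t s (Ψ (y s p))) ∧ (∀ t, ContDiff ℝ m (y t)) ∧
      ∀ t p q, ‖y t p - y t q‖ ≤ 2 * Real.exp (η * |t|) * ‖p - q‖ := by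
  set Y := lyapunovPerronIterate K Ψ L with hY
  have hdist : ∀ t p n, dist (Y n t p) (Y (n + 1) t p) ≤
      Real.exp ((1 : ℕ) * (η * |t|)) / 2 / 2 ^ n := by
    intro t p n
    rw [dist_comm, dist_eq_norm]
    exact (h.norm_iterate_succ_sub_le n t p).trans (le_of_eq (by ring))
  have hex : ∀ t p, ∃ l, Tendsto (fun n => Y n t p) atTop (𝓝 l) := fun t p =>
    cauchySeq_tendsto_of_complete (cauchySeq_of_le_geometric_two (hdist t p))
  choose y hy using hex
  have hrate : ∀ t p n, dist (Y n t p) (y t p) ≤ Real.exp ((1 : ℕ) * (η * |t|)) / 2 ^ n :=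
    fun t p n => dist_le_of_le_geometric_two_of_tendsto (hdist t p) (hy t p) n
  have hmeas : ∀ p, StronglyMeasurable (fun t => y t p) := fun p =>
    stronglyMeasurable_of_tendsto atTop (fun n => h.stronglyMeasurable_iterate n p)
      (tendsto_pi_nhds.2 fun t => hy t p)
  refine ⟨y, hmeas, fun t p => ?_, fun t => ?_, fun t p q => ?_⟩
  · have h1 : Tendsto (fun n => Y (n + 1) t p) atTop (𝓝 (y t p)) :=
      (hy t p).comp (tendsto_add_atTop_nat 1)
    refine tendsto_nhds_unique h1 ?_
    refine tendsto_const_nhds.add ?_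
    refine tendsto_integral_of_dominated_convergence
      (fun s => c * (A * Real.exp ((1 : ℕ) * (η * |t|))) * Real.exp (-(η * |t - s|)))
      (fun n => (h.measurable_apply_right (h.measurable_comp
        (h.stronglyMeasurable_iterate n p)) t).aestronglyMeasurable)
      ((h.integrable_shift t).const_mul _) (fun n => Eventually.of_forall fun s => ?_)
      (Eventually.of_forall fun s => ?_)
    · exact ((K t s).le_opNorm _).trans
        (h.norm_apply_le le_rfl h.one_le h.c_nonneg (h.norm_le_exp _ s))
    · exact ((K t s).continuous.tendsto _).comp
        ((h.contDiff.continuous.tendsto _).comp (hy s p))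
  · refine contDiff_of_tendstoUniformly_of_bounded m (f := fun n => Y n t)
      (B := (2 * Real.exp (η * |t|)) ^ (m + 1)) (fun n => (h.contDiff_iterate hL n).1 t)
      (fun k hk hk' n p => ((h.contDiff_iterate hL n).2 k (by omega) hk' t p).trans ?_) ?_
    · refine pow_le_pow_right₀ ?_ hk'
      have : 1 ≤ Real.exp (η * |t|) := Real.one_le_exp (by have := h.eta_pos; positivity)
      linarith
    · rw [Metric.tendstoUniformly_iff]
      intro ε hε
      have hlim : Tendsto (fun n : ℕ => Real.exp ((1 : ℕ) * (η * |t|)) / 2 ^ n) atTop (𝓝 0) := by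
        have := (tendsto_pow_atTop_nhds_zero_of_lt_one (r := (1 / 2 : ℝ)) (by norm_num)
          (by norm_num)).const_mul (Real.exp ((1 : ℕ) * (η * |t|)))
        rw [mul_zero] at this
        refine this.congr fun n => ?_
        rw [one_div, inv_pow]; ring
      filter_upwards [hlim.eventually (gt_mem_nhds hε)] with n hn p
      rw [dist_comm]
      exact (hrate t p n).trans_lt hn
  · refine le_of_tendsto ((hy t p).sub (hy t q)).norm (Eventually.of_forall fun n => ?_)
    refine Convex.norm_image_sub_le_of_norm_fderiv_le (s := univ) (𝕜 := ℝ) (f := Y n t)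
      (fun z _ => ((h.contDiff_iterate hL n).1 t).differentiable (by simp) z) (fun z _ => ?_)
      convex_univ (mem_univ _) (mem_univ _)
    rw [← norm_iteratedFDeriv_one]
    simpa using (h.contDiff_iterate hL n).2 1 le_rfl (by omega) t z

end LyapunovPerronData

/-! ### Green kernels -/

/-- The Green kernel of `u' = f` with prescribed value at time `0`: the signed indicator function
of the interval between `0` and `t`. -/
noncomputable def initialKernel (t s : ℝ) : ℝ :=
  if 0 < s ∧ s ≤ t then 1 else if t < s ∧ s ≤ 0 then -1 else 0

/-- The Green kernel of `v' = - l v + f` on bounded functions. -/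
noncomputable def decayKernel (l t s : ℝ) : ℝ :=
  if s ≤ t then Real.exp (-(l * (t - s))) else 0

theorem measurable_initialKernel : Measurable (Function.uncurry initialKernel) := by
  have e : Function.uncurry initialKernel = fun q : ℝ × ℝ =>
      if 0 < q.2 ∧ q.2 ≤ q.1 then (1 : ℝ) else if q.1 < q.2 ∧ q.2 ≤ 0 then -1 else 0 := by
    funext q; rfl
  rw [e]
  refine Measurable.ite ?_ measurable_const (Measurable.ite ?_ measurable_const measurable_const)
  · exact (measurableSet_lt measurable_const measurable_snd).inter
      (measurableSet_le measurable_snd measurable_fst)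
  · exact (measurableSet_lt measurable_fst measurable_snd).inter
      (measurableSet_le measurable_snd measurable_const)

theorem measurable_decayKernel (l : ℝ) : Measurable (Function.uncurry (decayKernel l)) := by
  have e : Function.uncurry (decayKernel l) = fun q : ℝ × ℝ =>
      if q.2 ≤ q.1 then Real.exp (-(l * (q.1 - q.2))) else 0 := by
    funext q; rfl
  rw [e]
  refine Measurable.ite (measurableSet_le measurable_snd measurable_fst) ?_ measurable_const
  fun_prop

theorem abs_initialKernel_mul_exp_le {η : ℝ} (hη : 0 < η) {j : ℕ} (hj : 1 ≤ j) (t s : ℝ) :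
    |initialKernel t s| * Real.exp (j * (η * |s|)) ≤
      Real.exp (j * (η * |t|)) * Real.exp (-(η * |t - s|)) := by
  have hj' : (1 : ℝ) ≤ j := by exact_mod_cast hj
  have key : |t - s| = |t| - |s| →
      Real.exp (j * (η * |s|)) ≤ Real.exp (j * (η * |t|)) * Real.exp (-(η * |t - s|)) := by
    intro h
    rw [← Real.exp_add]
    refine Real.exp_le_exp.2 ?_
    have h1 : 0 ≤ η * (|t| - |s|) := mul_nonneg hη.le (h ▸ abs_nonneg _)
    rw [h]
    nlinarith
  unfold initialKernel
  split_ifs with h1 h2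
  · simpa using key (by
      rw [abs_of_nonneg (sub_nonneg.2 h1.2), abs_of_pos h1.1, abs_of_pos (h1.1.trans_le h1.2)])
  · simpa using key (by
      rw [abs_of_neg (sub_neg.2 h2.1), abs_of_nonpos h2.2, abs_of_neg (h2.1.trans_le h2.2)]; ring)
  · simp only [abs_zero, zero_mul]; positivity

theorem abs_decayKernel_mul_exp_le {η l : ℝ} (hη : 0 < η) {j m : ℕ} (hjm : j ≤ m)
    (hl : (m + 1) * η ≤ l) (t s : ℝ) :
    |decayKernel l t s| * Real.exp (j * (η * |s|)) ≤
      Real.exp (j * (η * |t|)) * Real.exp (-(η * |t - s|)) := by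
  have hj' : (j : ℝ) ≤ m := by exact_mod_cast hjm
  unfold decayKernel
  split_ifs with h1
  · rw [abs_of_pos (Real.exp_pos _), ← Real.exp_add, ← Real.exp_add]
    refine Real.exp_le_exp.2 ?_
    have h0 : 0 ≤ t - s := sub_nonneg.2 h1
    have h2 : |s| ≤ |t| + (t - s) := by
      have := abs_sub_abs_le_abs_sub s t
      rw [abs_sub_comm, abs_of_nonneg h0] at this
      linarith
    rw [abs_of_nonneg h0]
    have h3 : (j : ℝ) * (η * |s|) ≤ j * (η * (|t| + (t - s))) := by gcongr
    have h4 : (j : ℝ) * η * (t - s) + η * (t - s) ≤ l * (t - s) := by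
      have : (j : ℝ) * η + η ≤ l := by nlinarith
      nlinarith
    nlinarith
  · simp only [abs_zero, zero_mul]; positivity

theorem integral_initialKernel_mul (g : ℝ → ℝ) (t : ℝ) :
    ∫ s, initialKernel t s * g s = ∫ s in (0 : ℝ)..t, g s := by
  rcases le_total 0 t with ht | ht
  · rw [intervalIntegral.integral_of_le ht, ← integral_indicator measurableSet_Ioc]
    congr 1
    funext s
    unfold initialKernel indicator
    by_cases h : 0 < s ∧ s ≤ t
    · simp [h]
    · have h2 : ¬ (t < s ∧ s ≤ 0) := fun h2 => by linarith [h2.1, h2.2]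
      rw [if_neg h, if_neg h2, if_neg (by simpa [mem_Ioc] using h)]; simp
  · rw [intervalIntegral.integral_of_ge ht, ← integral_indicator measurableSet_Ioc, ← integral_neg]
    congr 1
    funext s
    unfold initialKernel indicator
    by_cases h : t < s ∧ s ≤ 0
    · have h2 : ¬ (0 < s ∧ s ≤ t) := fun h2 => by linarith [h2.1, h.2]
      rw [if_neg h2, if_pos h, if_pos (by simpa [mem_Ioc] using h)]; simp
    · have h2 : ¬ (0 < s ∧ s ≤ t) := fun h2 => by linarith [h2.1, h2.2]
      rw [if_neg h2, if_neg h, if_neg (by simpa [mem_Ioc] using h)]; simp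

theorem intervalIntegrable_of_measurable_of_bounded {g : ℝ → ℝ} {c : ℝ} (hg : StronglyMeasurable g)
    (hc : ∀ s, ‖g s‖ ≤ c) (a b : ℝ) : IntervalIntegrable g volume a b :=
  (intervalIntegrable_const (c := c)).mono_fun' hg.aestronglyMeasurable
    (Eventually.of_forall fun s => hc s)

theorem integral_decayKernel_mul {l : ℝ} (hl : 0 < l) {g : ℝ → ℝ} {c : ℝ}
    (hg : StronglyMeasurable g) (hc : ∀ s, ‖g s‖ ≤ c) (t : ℝ) :
    ∫ s, decayKernel l t s * g s = Real.exp (-(l * t)) *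
      ((∫ s in Iic 0, Real.exp (l * s) * g s) + ∫ s in (0 : ℝ)..t, Real.exp (l * s) * g s) := by
  have hint : ∀ t, IntegrableOn (fun s => Real.exp (l * s) * g s) (Iic t) := by
    intro t
    refine ((integrableOn_exp_mul_Iic hl t).mul_const c).mono' ?_ (Eventually.of_forall fun s => ?_)
    · exact ((by fun_prop : Continuous fun s => Real.exp (l * s)).stronglyMeasurable.mul
        hg).aestronglyMeasurable
    · rw [norm_mul, Real.norm_of_nonneg (Real.exp_pos _).le]
      exact mul_le_mul_of_nonneg_left (hc s) (Real.exp_pos _).le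
  rw [← intervalIntegral.integral_Iic_sub_Iic (hint 0) (hint t), add_sub_cancel,
    ← integral_const_mul, ← integral_indicator measurableSet_Iic]
  congr 1
  funext s
  unfold decayKernel indicator
  by_cases h : s ≤ t
  · simp only [if_pos h, if_pos (mem_Iic.2 h)]
    rw [← mul_assoc, ← Real.exp_add]
    congr 2; ring
  · rw [if_neg h, if_neg (by simpa using h), zero_mul]

theorem continuous_integral_decayKernel_mul {l : ℝ} (hl : 0 < l) {g : ℝ → ℝ} {c : ℝ}
    (hg : StronglyMeasurable g) (hc : ∀ s, ‖g s‖ ≤ c) :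
    Continuous fun t => ∫ s, decayKernel l t s * g s := by
  simp_rw [integral_decayKernel_mul hl hg hc]
  refine (by fun_prop : Continuous fun t => Real.exp (-(l * t))).mul
    (continuous_const.add (intervalIntegral.continuous_primitive (fun a b => ?_) 0))
  exact (intervalIntegrable_of_measurable_of_bounded hg hc a b).continuousOn_mul (by fun_prop)

theorem hasDerivAt_integral_decayKernel_mul {l : ℝ} (hl : 0 < l) {g : ℝ → ℝ} {c : ℝ}
    (hg : Continuous g) (hc : ∀ s, ‖g s‖ ≤ c) (t : ℝ) :
    HasDerivAt (fun t => ∫ s, decayKernel l t s * g s)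
      (-(l * ∫ s, decayKernel l t s * g s) + g t) t := by
  have h := integral_decayKernel_mul hl hg.stronglyMeasurable hc
  rw [show (fun t => ∫ s, decayKernel l t s * g s) = _ from funext h, h t]
  have h1 : HasDerivAt (fun t => Real.exp (-(l * t))) (Real.exp (-(l * t)) * (-(l * 1))) t :=
    ((hasDerivAt_id t).const_mul l).neg.exp
  have h2 : HasDerivAt (fun t => ∫ s in (0 : ℝ)..t, Real.exp (l * s) * g s)
      (Real.exp (l * t) * g t) t :=
    (by fun_prop : Continuous fun s => Real.exp (l * s) * g s).integral_hasStrictDerivAt 0 t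
      |>.hasDerivAt
  convert! h1.mul (h2.const_add (∫ s in Iic 0, Real.exp (l * s) * g s)) using 1
  have : Real.exp (-(l * t)) * (Real.exp (l * t) * g t) = g t := by
    rw [← mul_assoc, ← Real.exp_add]; simp
  rw [this]; ring

/-- The projection of `((u, ρ), (v, w))` to the `u`-axis. -/
noncomputable def projU : (ℝ × ℝ) × (ℝ × ℝ) →L[ℝ] (ℝ × ℝ) × (ℝ × ℝ) :=
  (((ContinuousLinearMap.fst ℝ ℝ ℝ).comp (ContinuousLinearMap.fst ℝ (ℝ × ℝ) (ℝ × ℝ))).prod 0).prod 0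

/-- The projection of `((u, ρ), (v, w))` to the `v`-axis. -/
noncomputable def projV : (ℝ × ℝ) × (ℝ × ℝ) →L[ℝ] (ℝ × ℝ) × (ℝ × ℝ) :=
  ContinuousLinearMap.prod 0
    (((ContinuousLinearMap.fst ℝ ℝ ℝ).comp (ContinuousLinearMap.snd ℝ (ℝ × ℝ) (ℝ × ℝ))).prod 0)

/-- The projection of `((u, ρ), (v, w))` to the `w`-axis. -/
noncomputable def projW : (ℝ × ℝ) × (ℝ × ℝ) →L[ℝ] (ℝ × ℝ) × (ℝ × ℝ) :=
  ContinuousLinearMap.prod 0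
    (ContinuousLinearMap.prod 0
      ((ContinuousLinearMap.snd ℝ ℝ ℝ).comp (ContinuousLinearMap.snd ℝ (ℝ × ℝ) (ℝ × ℝ))))

@[simp] theorem projU_apply (x : (ℝ × ℝ) × (ℝ × ℝ)) : projU x = ((x.1.1, 0), (0, 0)) := rfl
@[simp] theorem projV_apply (x : (ℝ × ℝ) × (ℝ × ℝ)) : projV x = ((0, 0), (x.2.1, 0)) := rfl
@[simp] theorem projW_apply (x : (ℝ × ℝ) × (ℝ × ℝ)) : projW x = ((0, 0), (0, x.2.2)) := rfl

theorem norm_proj_le : ‖projU‖ ≤ 1 ∧ ‖projV‖ ≤ 1 ∧ ‖projW‖ ≤ 1 := by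
  refine ⟨?_, ?_, ?_⟩ <;>
    refine ContinuousLinearMap.opNorm_le_bound _ zero_le_one fun x => ?_ <;>
    simp [Prod.norm_def]

/-- The Green kernel of `u' = f₁`, `ρ' = 0`, `v' = - a v + f₂`, `w' = - b w + f₃`. -/
noncomputable def greenKernel (a b t s : ℝ) : (ℝ × ℝ) × (ℝ × ℝ) →L[ℝ] (ℝ × ℝ) × (ℝ × ℝ) :=
  initialKernel t s • projU + decayKernel a t s • projV + decayKernel b t s • projW

theorem greenKernel_apply (a b t s : ℝ) (x : (ℝ × ℝ) × (ℝ × ℝ)) :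
    greenKernel a b t s x = ((initialKernel t s * x.1.1, 0),
      (decayKernel a t s * x.2.1, decayKernel b t s * x.2.2)) := by
  simp [greenKernel]

theorem stronglyMeasurable_greenKernel (a b : ℝ) :
    StronglyMeasurable (Function.uncurry (greenKernel a b)) :=
  ((measurable_initialKernel.stronglyMeasurable.smul_const _).add
    ((measurable_decayKernel a).stronglyMeasurable.smul_const _)).add
    ((measurable_decayKernel b).stronglyMeasurable.smul_const _)

theorem norm_greenKernel_mul_exp_le {a b η : ℝ} (hη : 0 < η) {j m : ℕ} (hj : 1 ≤ j) (hjm : j ≤ m)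
    (ha : (m + 1) * η ≤ a) (hb : (m + 1) * η ≤ b) (t s : ℝ) :
    ‖greenKernel a b t s‖ * Real.exp (j * (η * |s|)) ≤
      3 * Real.exp (j * (η * |t|)) * Real.exp (-(η * |t - s|)) := by
  obtain ⟨n1, n2, n3⟩ := norm_proj_le
  have h : ‖greenKernel a b t s‖ ≤
      |initialKernel t s| + |decayKernel a t s| + |decayKernel b t s| := by
    refine norm_add₃_le.trans ?_
    simp only [norm_smul, Real.norm_eq_abs]
    gcongr <;> exact mul_le_of_le_one_right (abs_nonneg _) (by assumption)
  have h1 := abs_initialKernel_mul_exp_le hη hj t s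
  have h2 := abs_decayKernel_mul_exp_le hη hjm ha t s
  have h3 := abs_decayKernel_mul_exp_le hη hjm hb t s
  have := mul_le_mul_of_nonneg_right h (Real.exp_pos (j * (η * |s|))).le
  linarith

/-- Translation of the time `t` by `τ` translates the integration variable, except that the slow
components pick up their increment from time `0` to time `τ`. -/
theorem greenKernel_add (a b t τ s : ℝ) :
    greenKernel a b (t + τ) s = greenKernel a b t (s - τ) +
      ((ContinuousLinearMap.inl ℝ (ℝ × ℝ) (ℝ × ℝ)).comp
        (ContinuousLinearMap.fst ℝ (ℝ × ℝ) (ℝ × ℝ))).comp (greenKernel a b τ s) := by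
  have h1 : initialKernel (t + τ) s = initialKernel t (s - τ) + initialKernel τ s := by
    unfold initialKernel
    split_ifs <;> grind
  have h2 : ∀ l, decayKernel l (t + τ) s = decayKernel l t (s - τ) := by
    intro l
    unfold decayKernel
    by_cases h : s ≤ t + τ
    · rw [if_pos h, if_pos (by linarith)]; congr 2; ring
    · rw [if_neg h, if_neg (by intro h'; exact h (by linarith))]
  refine ContinuousLinearMap.ext fun x => ?_
  simp [greenKernel_apply, h1, h2, add_mul]

/-! ### Center manifolds of slow-fast fields -/

/-- The field `u' = ε N₁, ρ' = 0, v' = - a v + ε N₂, w' = - b w + ε N₃` at `((u, ρ), (v, w))`. -/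
noncomputable def slowFastField (a b ε : ℝ) (N : (ℝ × ℝ) × (ℝ × ℝ) → (ℝ × ℝ) × (ℝ × ℝ))
    (x : (ℝ × ℝ) × (ℝ × ℝ)) : (ℝ × ℝ) × (ℝ × ℝ) :=
  ((ε * (N x).1.1, 0), (-(a * x.2.1) + ε * (N x).2.1, -(b * x.2.2) + ε * (N x).2.2))

theorem exists_lipschitzWith_slowFastField (a b ε : ℝ)
    {N : (ℝ × ℝ) × (ℝ × ℝ) → (ℝ × ℝ) × (ℝ × ℝ)} (hN : ContDiff ℝ ∞ N)
    (hNc : HasCompactSupport N) : ∃ k : ℝ≥0, LipschitzWith k (slowFastField a b ε N) := by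
  obtain ⟨k, hk⟩ := hN.lipschitzWith_of_hasCompactSupport hNc (by simp)
  have e : slowFastField a b ε N = fun x =>
      (-(a • projV) - b • projW) x + (ε • (projU + projV + projW)) (N x) := by
    funext x
    simp [slowFastField]
  rw [e]
  exact ⟨_, (ContinuousLinearMap.lipschitz _).add ((ContinuousLinearMap.lipschitz _).comp hk)⟩

/-- After multiplication by a small `ε`, a smooth nonlinearity with compact support satisfies the
hypotheses of the Lyapunov–Perron construction, up to any order `m`. -/
theorem exists_lyapunovPerronData {a b : ℝ} (ha : 0 < a) (hb : 0 < b)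
    {N : (ℝ × ℝ) × (ℝ × ℝ) → (ℝ × ℝ) × (ℝ × ℝ)} (hN : ContDiff ℝ ∞ N)
    (hNc : HasCompactSupport N) {m : ℕ} (hm : 1 ≤ m) :
    ∃ η c ε : ℝ, 0 < ε ∧ LyapunovPerronData m η 3 c (greenKernel a b) (fun x => ε • N x) := by
  -- the decay kernels preserve the growth rates up to `m η` if `(m + 1) η` is at most `a` and `b`
  set η : ℝ := min a b / (m + 1) with hη
  have hη0 : 0 < η := by have := lt_min ha hb; positivity
  have hηm : (m + 1) * η = min a b := by rw [hη]; field_simp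
  have hbd : ∀ i : ℕ, ∃ c, ∀ x, ‖iteratedFDeriv ℝ i N x‖ ≤ c := fun i =>
    (hNc.iteratedFDeriv i).exists_bound_of_continuous
      (hN.continuous_iteratedFDeriv (by exact_mod_cast le_top))
  choose c' hc' using hbd
  have hc0 : ∀ i, 0 ≤ c' i := fun i => (norm_nonneg _).trans (hc' i 0)
  set C : ℝ := ∑ i ∈ Finset.range (m + 1), c' i with hC
  have hC0 : 0 ≤ C := Finset.sum_nonneg fun i _ => hc0 i
  have hCi : ∀ i ≤ m, ∀ x, ‖iteratedFDeriv ℝ i N x‖ ≤ C := fun i hi x =>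
    (hc' i x).trans (Finset.single_le_sum (f := c') (fun j _ => hc0 j)
      (Finset.mem_range.2 (by omega)))
  set G : ℝ := 3 * ∫ s : ℝ, Real.exp (-(η * |s|)) with hG
  have hG0 : 0 ≤ G := mul_nonneg (by norm_num) (integral_nonneg fun _ => (Real.exp_pos _).le)
  set ε : ℝ := 1 / (2 * (m ! * C * G + 1)) with hε
  have hε0 : 0 < ε := by positivity
  refine ⟨η, ε * C, ε, hε0, hm, hη0, stronglyMeasurable_greenKernel a b,
    fun j hj hjm t s => norm_greenKernel_mul_exp_le hη0 hj hjm (hηm ▸ min_le_left _ _)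
      (hηm ▸ min_le_right _ _) t s, (contDiff_infty.1 hN m).const_smul ε,
    fun i hi x => ?_, ?_⟩
  · rw [iteratedFDeriv_const_smul_apply' (hN.of_le (m := (i : ℕ))
      (by exact_mod_cast le_top)).contDiffAt, norm_smul,
      Real.norm_of_nonneg hε0.le]
    exact mul_le_mul_of_nonneg_left (hCi i hi x) hε0.le
  · have : (m ! : ℝ) * (ε * C) * G = (m ! * C * G) / (2 * (m ! * C * G + 1)) := by
      rw [hε]; ring
    rw [this, div_le_div_iff₀ (by positivity) (by norm_num)]
    linarith

/-- Global center manifold of a slow-fast field with compactly supported nonlinearity: a bundle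
`y t p` of global trajectories, indexed by their slow components `p` at time `0`, that depends
on `p` in a `C^m` manner, and that is closed under time translation. -/
theorem exists_trajectory_bundle {a b : ℝ} (ha : 0 < a) (hb : 0 < b)
    {N : (ℝ × ℝ) × (ℝ × ℝ) → (ℝ × ℝ) × (ℝ × ℝ)} (hN : ContDiff ℝ ∞ N)
    (hNc : HasCompactSupport N) {C : ℝ} (hC : 0 ≤ C) (hNQ : ∀ x, ‖N x‖ ≤ C * ‖x‖ ^ 2)
    {m : ℕ} (hm : 1 ≤ m) :
    ∃ (ε : ℝ) (y : ℝ → ℝ × ℝ → (ℝ × ℝ) × (ℝ × ℝ)), 0 < ε ∧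
      (∀ p, (y 0 p).1 = p) ∧ (∀ τ p, y τ p = y 0 (y τ p).1) ∧
      (∀ t p, HasDerivAt (fun t => y t p) (slowFastField a b ε N (y t p)) t) ∧
      ContDiff ℝ m (y 0) ∧ y 0 0 = 0 ∧
      HasFDerivAt (y 0) (ContinuousLinearMap.inl ℝ (ℝ × ℝ) (ℝ × ℝ)) 0 ∧
      ∀ p, ‖(y 0 p).2‖ ≤ 1 / 2 := by
  obtain ⟨η, c, ε, hε, h⟩ := exists_lyapunovPerronData ha hb hN hNc (m := m + 1) (by omega)
  set Ψ : (ℝ × ℝ) × (ℝ × ℝ) → (ℝ × ℝ) × (ℝ × ℝ) := fun x => ε • N x with hΨ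
  set L := ContinuousLinearMap.inl ℝ (ℝ × ℝ) (ℝ × ℝ) with hLdef
  have hL : ‖L‖ ≤ 1 := ContinuousLinearMap.opNorm_le_bound _ zero_le_one fun x => by
    simp [hLdef, Prod.norm_def]
  obtain ⟨y, hmeas, hy, hsm, hlip⟩ := h.exists_solution hL
  have hint : ∀ t p, Integrable (fun s => greenKernel a b t s (Ψ (y s p))) := fun t p =>
    h.integrable_comp (hmeas p) t
  -- the Lyapunov–Perron equation in components
  have hcomp : ∀ t p, y t p = ((p.1 + ∫ s in (0 : ℝ)..t, (Ψ (y s p)).1.1, p.2),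
      (∫ s, decayKernel a t s * (Ψ (y s p)).2.1, ∫ s, decayKernel b t s * (Ψ (y s p)).2.2)) := by
    intro t p
    have hi := hint t p
    have e1 : (∫ s, greenKernel a b t s (Ψ (y s p))).1.1 =
        ∫ s in (0 : ℝ)..t, (Ψ (y s p)).1.1 := by
      rw [fst_integral hi, fst_integral hi.fst, ← integral_initialKernel_mul]
      simp only [greenKernel_apply]
    have e2 : (∫ s, greenKernel a b t s (Ψ (y s p))).1.2 = 0 := by
      rw [fst_integral hi, snd_integral hi.fst]
      simp only [greenKernel_apply, integral_zero]
    have e3 : (∫ s, greenKernel a b t s (Ψ (y s p))).2.1 =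
        ∫ s, decayKernel a t s * (Ψ (y s p)).2.1 := by
      rw [snd_integral hi, fst_integral hi.snd]
      simp only [greenKernel_apply]
    have e4 : (∫ s, greenKernel a b t s (Ψ (y s p))).2.2 =
        ∫ s, decayKernel b t s * (Ψ (y s p)).2.2 := by
      rw [snd_integral hi, snd_integral hi.snd]
      simp only [greenKernel_apply]
    rw [← e1, ← e3, ← e4]
    conv_lhs => rw [hy t p]
    refine Prod.ext (Prod.ext rfl ?_) (Prod.ext ?_ ?_) <;> simp [hLdef, e2]
  have hinit : ∀ p, (y 0 p).1 = p := fun p => by rw [hcomp]; simp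
  have hbd : ∀ s p, ‖(Ψ (y s p)).1.1‖ ≤ c ∧ ‖(Ψ (y s p)).2.1‖ ≤ c ∧ ‖(Ψ (y s p)).2.2‖ ≤ c := by
    intro s p
    have hn := h.norm_le (y s p)
    exact ⟨(norm_fst_le _).trans ((norm_fst_le _).trans hn),
      (norm_fst_le _).trans ((norm_snd_le _).trans hn),
      (norm_snd_le _).trans ((norm_snd_le _).trans hn)⟩
  have hΨm : ∀ p, StronglyMeasurable (fun s => Ψ (y s p)) := fun p => h.measurable_comp (hmeas p)
  have hcont : ∀ p, Continuous (fun t => y t p) := by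
    intro p
    rw [show (fun t => y t p) = _ from funext fun t => hcomp t p]
    refine Continuous.prodMk (Continuous.prodMk (continuous_const.add
      (intervalIntegral.continuous_primitive (fun u v =>
        intervalIntegrable_of_measurable_of_bounded (hΨm p).fst.fst (fun s => (hbd s p).1) u v) 0))
      continuous_const) (Continuous.prodMk ?_ ?_)
    · exact continuous_integral_decayKernel_mul ha (hΨm p).snd.fst (fun s => (hbd s p).2.1)
    · exact continuous_integral_decayKernel_mul hb (hΨm p).snd.snd (fun s => (hbd s p).2.2)
  have hΨc : ∀ p, Continuous (fun s => Ψ (y s p)) := fun p =>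
    h.contDiff.continuous.comp (hcont p)
  have hzero : ∀ t, y t 0 = 0 := by
    have hN0 : Ψ 0 = 0 := by
      have := hNQ 0
      simp only [norm_zero, ne_eq, OfNat.ofNat_ne_zero, not_false_eq_true, zero_pow, mul_zero,
        norm_le_zero_iff] at this
      simp [hΨ, this]
    have := h.unique (x := L 0) (y := fun t => y t 0) (z := fun _ => 0) (hmeas 0)
      stronglyMeasurable_const (fun t => hy t 0) (fun t => by simp [hN0])
    exact fun t => congrFun this t
  refine ⟨ε, y, hε, hinit, fun τ p => ?_, fun t p => ?_, hsm 0, hzero 0, ?_, fun p => ?_⟩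
  · -- the translate of a solution solves the equation with the slow part at `τ` as parameter
    have hz : ∀ t, y (t + τ) p = L (y τ p).1 +
        ∫ s, greenKernel a b t s (Ψ (y (s + τ) p)) := by
      intro t
      have hsh : ∫ s, greenKernel a b t s (Ψ (y (s + τ) p)) =
          ∫ s, greenKernel a b t (s - τ) (Ψ (y s p)) := by
        rw [← integral_add_right_eq_self (fun s => greenKernel a b t (s - τ) (Ψ (y s p))) τ]
        simp
      have hi2 : Integrable (fun s => greenKernel a b t (s - τ) (Ψ (y s p))) := by
        have := h.integrable_comp (y := fun s => y (s + τ) p)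
          ((hmeas p).comp_measurable (measurable_add_const τ)) t
        simpa using this.comp_sub_right τ
      rw [hsh, hy (t + τ) p]
      have hadd : ∀ s x, greenKernel a b (t + τ) s x = greenKernel a b t (s - τ) x +
          (L.comp (ContinuousLinearMap.fst ℝ (ℝ × ℝ) (ℝ × ℝ))) (greenKernel a b τ s x) := by
        intro s x
        rw [greenKernel_add]
        rfl
      simp_rw [hadd]
      rw [integral_add hi2 (ContinuousLinearMap.integrable_comp _ (hint τ p)),
        ContinuousLinearMap.integral_comp_comm _ (hint τ p)]
      have e : L (y τ p).1 = L p + (L.comp (ContinuousLinearMap.fst ℝ (ℝ × ℝ) (ℝ × ℝ)))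
          (∫ s, greenKernel a b τ s (Ψ (y s p))) := by
        conv_lhs => rw [hy τ p]
        simp [hLdef]
      rw [e, add_right_comm, add_assoc]
    have := h.unique (x := L (y τ p).1) (y := fun t => y (t + τ) p) (z := fun t => y t (y τ p).1)
      ((hmeas p).comp_measurable (measurable_add_const τ)) (hmeas _) hz (fun t => hy t _)
    simpa using congrFun this 0
  · rw [show (fun t => y t p) = _ from funext fun t => hcomp t p]
    have d1 : HasDerivAt (fun t => p.1 + ∫ s in (0 : ℝ)..t, (Ψ (y s p)).1.1) (Ψ (y t p)).1.1 t :=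
      ((hΨc p).fst.fst.integral_hasStrictDerivAt 0 t).hasDerivAt.const_add _
    have d2 := hasDerivAt_integral_decayKernel_mul ha (hΨc p).snd.fst (fun s => (hbd s p).2.1) t
    have d3 := hasDerivAt_integral_decayKernel_mul hb (hΨc p).snd.snd (fun s => (hbd s p).2.2) t
    have e := hcomp t p
    have e2 : (y t p).2.1 = ∫ s, decayKernel a t s * (Ψ (y s p)).2.1 := by rw [e]
    have e3 : (y t p).2.2 = ∫ s, decayKernel b t s * (Ψ (y s p)).2.2 := by rw [e]
    rw [← e2] at d2
    rw [← e3] at d3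
    exact (d1.prodMk (hasDerivAt_const t p.2)).prodMk (d2.prodMk d3)
  · -- the nonlinear term is quadratic in `p`, by the Lipschitz bound on the trajectories
    have hq : ∀ p, ‖y 0 p - L p‖ ≤
        ε * C * 4 * ‖p‖ ^ 2 * (3 * ∫ s : ℝ, Real.exp (-(η * |s|))) := by
      intro p
      have hb2 : ∀ s, ‖Ψ (y s p)‖ ≤ (ε * C * 4 * ‖p‖ ^ 2) * Real.exp ((2 : ℕ) * (η * |s|)) := by
        intro s
        have h1 := hlip s p 0
        rw [hzero, sub_zero, sub_zero] at h1
        calc ‖Ψ (y s p)‖ = ε * ‖N (y s p)‖ := by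
              rw [hΨ]; simp only [norm_smul, Real.norm_of_nonneg hε.le]
          _ ≤ ε * (C * (2 * Real.exp (η * |s|) * ‖p‖) ^ 2) := by
              refine mul_le_mul_of_nonneg_left ((hNQ _).trans ?_) hε.le
              gcongr
          _ = _ := by rw [mul_pow, mul_pow, ← Real.exp_nat_mul]; ring
      have := h.norm_integral_apply_le (j := 2) (by norm_num) (by omega) (by positivity) hb2 0
      rw [hy 0 p, add_sub_cancel_left]
      simpa using this
    rw [hasFDerivAt_iff_isLittleO_nhds_zero]
    have hO : (fun p : ℝ × ℝ => y 0 (0 + p) - y 0 0 - L p) =O[𝓝 0] fun p => ‖p‖ ^ 2 := by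
      refine IsBigO.of_bound (ε * C * 4 * (3 * ∫ s : ℝ, Real.exp (-(η * |s|))))
        (Eventually.of_forall fun p => ?_)
      rw [zero_add, hzero, sub_zero]
      refine (hq p).trans (le_of_eq ?_)
      rw [norm_pow, norm_norm]; ring
    refine hO.trans_isLittleO ?_
    exact (isLittleO_norm_pow_id (by norm_num)).trans_isBigO (isBigO_refl _ _)
  · have := h.norm_integral_apply_le le_rfl h.one_le h.c_nonneg
      (fun s => h.norm_le_exp (y s p) s) 0
    have h2 := h.small_one
    have e : (y 0 p).2 = (∫ s, greenKernel a b 0 s (Ψ (y s p))).2 := by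
      conv_lhs => rw [hy 0 p]
      simp [hLdef]
    rw [e]
    refine (norm_snd_le _).trans (this.trans ?_)
    simpa using h2

/-! ### Existence of a center manifold for the Lorenz system -/

theorem eqOn_Icc_of_eqOn_isOpen_right {E : Type*} [NormedAddCommGroup E] [NormedSpace ℝ E]
    {v w : E → E} {O : Set E} (hO : IsOpen O) (hvw : EqOn v w O) {k : ℝ≥0} (hw : LipschitzWith k w)
    {f g : ℝ → E} {a b : ℝ}
    (hf : ∀ t ∈ Icc a b, HasDerivWithinAt f (v (f t)) (Icc a b) t)
    (hg : ∀ t ∈ Icc a b, HasDerivWithinAt g (w (g t)) (Icc a b) t) (h0 : f a = g a)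
    (hmem : ∀ t ∈ Icc a b, f t = g t → f t ∈ O) : EqOn f g (Icc a b) := by
  have hfc : ContinuousOn f (Icc a b) := fun t ht => (hf t ht).continuousWithinAt
  have hgc : ContinuousOn g (Icc a b) := fun t ht => (hg t ht).continuousWithinAt
  have hcl : IsClosed ({t | f t = g t} ∩ Icc a b) := by
    have : {t | f t = g t} ∩ Icc a b = Icc a b ∩ (fun t => f t - g t) ⁻¹' {0} := by
      ext t
      simp [sub_eq_zero, and_comm]
    rw [this]
    exact (hfc.sub hgc).preimage_isClosed_of_isClosed isClosed_Icc isClosed_singleton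
  refine hcl.Icc_subset_of_forall_exists_gt h0 fun x hx y hy => ?_
  obtain ⟨hxe, hxa, hxb⟩ := hx
  have hxm : x ∈ Icc a b := ⟨hxa, hxb.le⟩
  have hev : ∀ᶠ t in 𝓝[Icc a b] x, f t ∈ O :=
    (hfc x hxm).eventually (hO.mem_nhds (hmem x hxm hxe))
  rw [eventually_nhdsWithin_iff, Metric.eventually_nhds_iff] at hev
  obtain ⟨δ, hδ, hδO⟩ := hev
  -- on `[x, z]` the first trajectory stays in `O`, where it also solves the second equation
  set z := min (min y b) (x + δ / 2) with hz
  have hxz : x < z := lt_min (lt_min hy hxb) (by linarith)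
  have hzb : z ≤ b := (min_le_left _ _).trans (min_le_right _ _)
  have hzd : z ≤ x + δ / 2 := min_le_right _ _
  have hsub : Icc x z ⊆ Icc a b := Icc_subset_Icc hxa hzb
  have hright : ∀ t ∈ Ico x z, Icc a b ∈ 𝓝[Ici t] t := fun t ht =>
    mem_of_superset (Icc_mem_nhdsGE (ht.2.trans_le hzb))
      (Icc_subset_Icc_left (hxa.trans ht.1))
  have := ODE_solution_unique_of_mem_Icc_right (v := fun _ => w) (s := fun _ => univ)
    (fun t _ => hw.lipschitzOnWith) (hfc.mono hsub)
    (fun t ht => by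
      have htm := hsub (Ico_subset_Icc_self ht)
      have : v (f t) = w (f t) := hvw (hδO (by
        rw [Real.dist_eq, abs_of_nonneg (sub_nonneg.2 ht.1)]; linarith [ht.2]) htm)
      rw [← this]
      exact (hf t htm).mono_of_mem_nhdsWithin (hright t ht)) (fun _ _ => mem_univ _)
    (hgc.mono hsub)
    (fun t ht => (hg t (hsub (Ico_subset_Icc_self ht))).mono_of_mem_nhdsWithin (hright t ht))
    (fun _ _ => mem_univ _) hxe
  exact ⟨z, this ⟨hxz.le, le_rfl⟩, hxz, (min_le_left _ _).trans (min_le_left _ _)⟩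

/-- Let `f` and `g` be trajectories of two fields that agree on an open set `O`, the second one
being Lipschitz. If they meet at one time, and can only meet inside `O`, they are equal. -/
theorem eqOn_Icc_of_eqOn_isOpen {E : Type*} [NormedAddCommGroup E] [NormedSpace ℝ E]
    {v w : E → E} {O : Set E} (hO : IsOpen O) (hvw : EqOn v w O) {k : ℝ≥0} (hw : LipschitzWith k w)
    {f g : ℝ → E} {a b t₀ : ℝ} (ht₀ : t₀ ∈ Icc a b)
    (hf : ∀ t ∈ Icc a b, HasDerivWithinAt f (v (f t)) (Icc a b) t)
    (hg : ∀ t ∈ Icc a b, HasDerivWithinAt g (w (g t)) (Icc a b) t) (h0 : f t₀ = g t₀)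
    (hmem : ∀ t ∈ Icc a b, f t = g t → f t ∈ O) : EqOn f g (Icc a b) := by
  have hR : EqOn f g (Icc t₀ b) := by
    have hs : Icc t₀ b ⊆ Icc a b := Icc_subset_Icc_left ht₀.1
    exact eqOn_Icc_of_eqOn_isOpen_right hO hvw hw (fun t ht => (hf t (hs ht)).mono hs)
      (fun t ht => (hg t (hs ht)).mono hs) h0 fun t ht => hmem t (hs ht)
  have hL : EqOn (fun t => f (-t)) (fun t => g (-t)) (Icc (-t₀) (-a)) := by
    have hs : MapsTo (fun t : ℝ => -t) (Icc (-t₀) (-a)) (Icc a b) := fun t ht =>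
      ⟨by linarith [ht.2], by linarith [ht.1, ht₀.2]⟩
    refine eqOn_Icc_of_eqOn_isOpen_right (v := fun x => -v x) (w := fun x => -w x) hO
      (fun x hx => congrArg Neg.neg (hvw hx)) hw.neg
      (fun t ht => ?_) (fun t ht => ?_) (by simpa using h0) fun t ht => hmem _ (hs ht)
    · simpa using! (hf (-t) (hs ht)).scomp t (hasDerivAt_neg t).hasDerivWithinAt hs
    · simpa using! (hg (-t) (hs ht)).scomp t (hasDerivAt_neg t).hasDerivWithinAt hs
  intro t ht
  rcases le_total t₀ t with h | h
  · exact hR ⟨h, ht.2⟩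
  · simpa using hL (x := -t) ⟨by linarith, by linarith [ht.1]⟩

namespace LorenzCM

/-- The `u`-component of the Lorenz field in the coordinates `(u, v, w)`. -/
noncomputable def fieldU (ζ ρ u v w : ℝ) : ℝ := ζ / (1 + ζ) * ((u + ζ * v) * (ρ - w))

/-- The `v`-component of the Lorenz field in the coordinates `(u, v, w)`. -/
noncomputable def fieldV (ζ ρ u v w : ℝ) : ℝ :=
  -((1 + ζ) * v) + -(1 / (1 + ζ)) * ((u + ζ * v) * (ρ - w))

/-- The `w`-component of the Lorenz field in the coordinates `(u, v, w)`. -/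
noncomputable def fieldW (ζ θ u v w : ℝ) : ℝ := -(θ * w) + (u + ζ * v) * (u - v)

theorem ofEigen_eq (ζ u v w : ℝ) : ofEigen ζ u v w = ![u + ζ * v, u - v, w] := by
  funext i
  fin_cases i <;> simp [ofEigen, eigenBasis, sub_eq_add_neg, mul_comm]

theorem lorenzField_ofEigen {ζ : ℝ} (hζ : -1 < ζ) (θ ρ u v w : ℝ) :
    lorenzField ζ θ ρ (ofEigen ζ u v w) =
      ofEigen ζ (fieldU ζ ρ u v w) (fieldV ζ ρ u v w) (fieldW ζ θ u v w) := by
  have h : 1 + ζ ≠ 0 := by linarith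
  rw [ofEigen_eq, ofEigen_eq]
  funext i
  fin_cases i <;> simp [lorenzField, fieldU, fieldV, fieldW] <;> field_simp <;> ring

theorem inv_eigenBasis_mulVec {ζ : ℝ} (hζ : -1 < ζ) (u v w : ℝ) :
    (eigenBasis ζ)⁻¹ *ᵥ ofEigen ζ u v w = ![u, v, w] := by
  have hdet : IsUnit (eigenBasis ζ).det := by
    rw [isUnit_iff_ne_zero, Matrix.det_fin_three]
    simp [eigenBasis]
    linarith
  rw [ofEigen, Matrix.mulVec_mulVec, Matrix.nonsing_inv_mul _ hdet, Matrix.one_mulVec]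

theorem reducedField_eq {ζ : ℝ} (hζ : -1 < ζ) (θ : ℝ) (h : ℝ × ℝ → ℝ × ℝ) (ρ u : ℝ) :
    reducedField ζ θ h ρ u = fieldU ζ ρ u (h (u, ρ)).1 (h (u, ρ)).2 := by
  rw [reducedField, lorenzField_ofEigen hζ, inv_eigenBasis_mulVec hζ]
  rfl

theorem hasDerivWithinAt_ofEigen_iff {ζ : ℝ} (hζ : -1 < ζ) {u v w : ℝ → ℝ} {u' v' w' t : ℝ}
    {s : Set ℝ} :
    HasDerivWithinAt (fun t => ofEigen ζ (u t) (v t) (w t)) (ofEigen ζ u' v' w') s t ↔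
      HasDerivWithinAt u u' s t ∧ HasDerivWithinAt v v' s t ∧ HasDerivWithinAt w w' s t := by
  have h : 1 + ζ ≠ 0 := by linarith
  simp only [ofEigen_eq]
  rw [hasDerivWithinAt_pi]
  simp only [Fin.forall_fin_succ, Matrix.cons_val_zero, Matrix.cons_val_succ]
  constructor
  · rintro ⟨h1, h2, h3, -⟩
    refine ⟨?_, ?_, h3⟩
    · have := (h1.add (h2.const_mul ζ)).div_const (1 + ζ)
      convert! this using 1
      · funext t; simp; field_simp; ring
      · field_simp; ring
    · have := (h1.sub h2).div_const (1 + ζ)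
      convert! this using 1
      · funext t; simp; field_simp; ring
      · field_simp; ring
  · rintro ⟨h1, h2, h3⟩
    exact ⟨h1.add (h2.const_mul ζ), h1.sub h2, h3, fun i => i.elim0⟩

theorem isIntegralCurveOn_ofEigen_iff {ζ : ℝ} (hζ : -1 < ζ) {θ ρ : ℝ} {u v w : ℝ → ℝ} {s : Set ℝ} :
    IsIntegralCurveOn (fun t => ofEigen ζ (u t) (v t) (w t)) (fun _ => lorenzField ζ θ ρ) s ↔
      ∀ t ∈ s, HasDerivWithinAt u (fieldU ζ ρ (u t) (v t) (w t)) s t ∧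
        HasDerivWithinAt v (fieldV ζ ρ (u t) (v t) (w t)) s t ∧
        HasDerivWithinAt w (fieldW ζ θ (u t) (v t) (w t)) s t := by
  simp only [IsIntegralCurveOn, lorenzField_ofEigen hζ, hasDerivWithinAt_ofEigen_iff hζ]

/-- The quadratic part of the Lorenz field at `((u, ρ), (v, w))`. -/
noncomputable def quadraticPart (ζ : ℝ) (x : (ℝ × ℝ) × (ℝ × ℝ)) : (ℝ × ℝ) × (ℝ × ℝ) :=
  ((ζ / (1 + ζ) * ((x.1.1 + ζ * x.2.1) * (x.1.2 - x.2.2)), 0),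
    (-(1 / (1 + ζ)) * ((x.1.1 + ζ * x.2.1) * (x.1.2 - x.2.2)),
      (x.1.1 + ζ * x.2.1) * (x.1.1 - x.2.1)))

theorem norm_quadraticPart_le (ζ : ℝ) (x : (ℝ × ℝ) × (ℝ × ℝ)) :
    ‖quadraticPart ζ x‖ ≤
      (|ζ / (1 + ζ)| + |1 / (1 + ζ)| + 1) * (2 * (1 + |ζ|)) * ‖x‖ ^ 2 := by
  have hu : |x.1.1| ≤ ‖x‖ := (norm_fst_le x.1).trans (norm_fst_le x)
  have hρ : |x.1.2| ≤ ‖x‖ := (norm_snd_le x.1).trans (norm_fst_le x)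
  have hv : |x.2.1| ≤ ‖x‖ := (norm_fst_le x.2).trans (norm_snd_le x)
  have hw : |x.2.2| ≤ ‖x‖ := (norm_snd_le x.2).trans (norm_snd_le x)
  have h1 : |x.1.1 + ζ * x.2.1| ≤ (1 + |ζ|) * ‖x‖ := by
    refine (abs_add_le _ _).trans ?_
    rw [abs_mul]
    nlinarith [abs_nonneg ζ]
  have h2 : |x.1.2 - x.2.2| ≤ 2 * ‖x‖ := (abs_sub _ _).trans (by linarith)
  have h3 : |x.1.1 - x.2.1| ≤ 2 * ‖x‖ := (abs_sub _ _).trans (by linarith)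
  have h4 : |(x.1.1 + ζ * x.2.1) * (x.1.2 - x.2.2)| ≤ 2 * (1 + |ζ|) * ‖x‖ ^ 2 := by
    rw [abs_mul]
    calc _ ≤ (1 + |ζ|) * ‖x‖ * (2 * ‖x‖) := by gcongr
      _ = _ := by ring
  have h5 : |(x.1.1 + ζ * x.2.1) * (x.1.1 - x.2.1)| ≤ 2 * (1 + |ζ|) * ‖x‖ ^ 2 := by
    rw [abs_mul]
    calc _ ≤ (1 + |ζ|) * ‖x‖ * (2 * ‖x‖) := by gcongr
      _ = _ := by ring
  have hB : 0 ≤ 2 * (1 + |ζ|) * ‖x‖ ^ 2 := by positivity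
  set B := 2 * (1 + |ζ|) * ‖x‖ ^ 2
  have e : (|ζ / (1 + ζ)| + |1 / (1 + ζ)| + 1) * (2 * (1 + |ζ|)) * ‖x‖ ^ 2 =
      |ζ / (1 + ζ)| * B + |1 / (1 + ζ)| * B + B := by ring
  rw [e]
  have p1 : 0 ≤ |ζ / (1 + ζ)| * B := by positivity
  have p2 : 0 ≤ |1 / (1 + ζ)| * B := by positivity
  refine max_le (max_le ?_ ?_) (max_le ?_ ?_)
  · change |ζ / (1 + ζ) * ((x.1.1 + ζ * x.2.1) * (x.1.2 - x.2.2))| ≤ _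
    rw [abs_mul]
    linarith [mul_le_mul_of_nonneg_left h4 (abs_nonneg (ζ / (1 + ζ)))]
  · change |(0 : ℝ)| ≤ _
    rw [abs_zero]; linarith
  · change |-(1 / (1 + ζ)) * ((x.1.1 + ζ * x.2.1) * (x.1.2 - x.2.2))| ≤ _
    rw [abs_mul, abs_neg]
    linarith [mul_le_mul_of_nonneg_left h4 (abs_nonneg (1 / (1 + ζ)))]
  · change |(x.1.1 + ζ * x.2.1) * (x.1.1 - x.2.1)| ≤ _
    linarith

/-- A local center manifold of class `C^r` exists: rescale the Lorenz field by a small `ε`, which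
makes it a slow-fast field, cut off its quadratic part, and take the slow components of the
trajectory bundle as coordinates. -/
theorem exists_isLocalCenterManifold {ζ θ : ℝ} (hζ : -1 < ζ) (hθ : 0 < θ) {r : ℕ} (hr : 1 ≤ r) :
    ∃ (U : Set (ℝ × ℝ)) (h : ℝ × ℝ → ℝ × ℝ), IsLocalCenterManifold ζ θ r U h := by
  let χ : ContDiffBump (0 : (ℝ × ℝ) × (ℝ × ℝ)) := ⟨1, 2, one_pos, one_lt_two⟩
  set N : (ℝ × ℝ) × (ℝ × ℝ) → (ℝ × ℝ) × (ℝ × ℝ) := fun x => χ x • quadraticPart ζ x with hN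
  have hNs : ContDiff ℝ ∞ N := by
    refine χ.contDiff.smul ?_
    unfold quadraticPart
    fun_prop
  have hNc : HasCompactSupport N := χ.hasCompactSupport.smul_right
  have hNQ : ∀ x, ‖N x‖ ≤ (|ζ / (1 + ζ)| + |1 / (1 + ζ)| + 1) * (2 * (1 + |ζ|)) * ‖x‖ ^ 2 := by
    intro x
    rw [hN, norm_smul, Real.norm_of_nonneg χ.nonneg]
    exact (mul_le_of_le_one_left (norm_nonneg _) χ.le_one).trans (norm_quadraticPart_le ζ x)
  have hN1 : ∀ x ∈ Metric.ball (0 : (ℝ × ℝ) × (ℝ × ℝ)) 1, N x = quadraticPart ζ x := by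
    intro x hx
    rw [hN]
    simp only
    rw [χ.one_of_mem_closedBall (Metric.ball_subset_closedBall hx), one_smul]
  obtain ⟨ε, y, hε, hy1, hyτ, hyd, hys, hy0, hyD, hyb⟩ :=
    exists_trajectory_bundle (a := 1 + ζ) (b := θ) (by linarith) hθ hNs hNc (by positivity) hNQ hr
  obtain ⟨k, hk⟩ := exists_lipschitzWith_slowFastField (1 + ζ) θ ε hNs hNc
  refine ⟨Metric.ball 0 ε, fun q => ε • (y 0 (ε⁻¹ • q)).2, Metric.isOpen_ball, ?_, ?_, ?_, ?_, ?_⟩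
  · exact Metric.mem_ball_self hε
  · refine ContDiff.contDiffOn ?_
    exact ((hys.comp (contDiff_id.const_smul ε⁻¹)).snd).const_smul ε
  · change ε • (y 0 (ε⁻¹ • (0 : ℝ × ℝ))).2 = 0
    rw [smul_zero, hy0]; simp
  · have h1 : HasFDerivAt (fun q : ℝ × ℝ => ε⁻¹ • q) (ε⁻¹ • ContinuousLinearMap.id ℝ (ℝ × ℝ)) 0 :=
      (hasFDerivAt_id _).const_smul ε⁻¹
    have h2 : HasFDerivAt (y 0) (ContinuousLinearMap.inl ℝ (ℝ × ℝ) (ℝ × ℝ))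
        (ε⁻¹ • (0 : ℝ × ℝ)) := by rwa [smul_zero]
    have h3 := ((h2.comp (0 : ℝ × ℝ) h1).snd).const_smul ε
    convert! h3 using 1
    refine ContinuousLinearMap.ext fun q => ?_
    simp
  · intro ρ a b u v w hint hmem t₀ ht₀ h0 t ht
    rw [isIntegralCurveOn_ofEigen_iff hζ] at hint
    set f : ℝ → (ℝ × ℝ) × (ℝ × ℝ) := fun t => ((ε⁻¹ * u t, ε⁻¹ * ρ), (ε⁻¹ * v t, ε⁻¹ * w t)) with hf
    set p : ℝ × ℝ := (ε⁻¹ * u t₀, ε⁻¹ * ρ) with hp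
    have hf1 : ∀ t, (f t).1 = ε⁻¹ • (u t, ρ) := fun t => rfl
    have hf2 : ∀ t, (f t).2 = ε⁻¹ • (v t, w t) := fun t => rfl
    have hsmall : ∀ t ∈ Icc a b, ‖(f t).1‖ < 1 := by
      intro t ht
      rw [hf1, norm_smul, norm_inv, Real.norm_of_nonneg hε.le, inv_mul_lt_iff₀ hε, mul_one]
      simpa using hmem t ht
    have key : EqOn f (fun t => y (t - t₀) p) (Icc a b) := by
      refine eqOn_Icc_of_eqOn_isOpen (v := slowFastField (1 + ζ) θ ε (quadraticPart ζ))
        (O := Metric.ball 0 1) Metric.isOpen_ball (fun x hx => ?_) hk ht₀ (fun t ht => ?_)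
        (fun t _ => ?_) ?_ (fun t ht he => ?_)
      · simp only [slowFastField, hN1 x hx]
      · obtain ⟨h1, h2, h3⟩ := hint t ht
        have := ((h1.const_mul ε⁻¹).prodMk (hasDerivWithinAt_const t (Icc a b) (ε⁻¹ * ρ))).prodMk
          ((h2.const_mul ε⁻¹).prodMk (h3.const_mul ε⁻¹))
        convert! this using 1
        have h4 : 1 + ζ ≠ 0 := by linarith
        simp only [slowFastField, quadraticPart, fieldU, fieldV, fieldW, hf]
        refine Prod.ext (Prod.ext ?_ rfl) (Prod.ext ?_ ?_) <;> field_simp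
      · have := (hyd (t - t₀) p).scomp t ((hasDerivAt_id t).sub_const t₀)
        simpa using! this.hasDerivWithinAt
      · rw [sub_self]
        refine Prod.ext (hy1 p).symm ?_
        rw [hf2, h0, inv_smul_smul₀ hε.ne']
        rfl
      · have h2 : ‖(f t).2‖ ≤ 1 / 2 := by
          rw [he]
          rw [hyτ]
          exact hyb _
        rw [mem_ball_zero_iff, Prod.norm_def]
        exact max_lt (hsmall t ht) (by linarith)
    have h1 := key ht
    have h2 : (f t).2 = (y 0 (f t).1).2 := by
      rw [h1]
      change (y (t - t₀) p).2 = _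
      rw [hyτ]
    rw [hf1, hf2] at h2
    change (v t, w t) = ε • (y 0 (ε⁻¹ • (u t, ρ))).2
    rw [← h2, smul_inv_smul₀ hε.ne']

end LorenzCM

/-! ### The invariance equation and the reduced equation -/

/-- A field that is Lipschitz on an interval, extended constantly beyond its ends, has solutions
for all times. -/
theorem exists_solution_projIcc {f : ℝ → ℝ} {p q : ℝ} (hpq : p ≤ q) {k : ℝ≥0}
    (hf : LipschitzOnWith k f (Icc p q)) {T : ℝ} (hT : 0 ≤ T) (x : ℝ) :
    ∃ γ : ℝ → ℝ, γ 0 = x ∧ ∀ t ∈ Icc (-T) T,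
      HasDerivWithinAt γ (f (projIcc p q hpq (γ t))) (Icc (-T) T) t := by
  obtain ⟨L, hL⟩ := isCompact_Icc.exists_bound_of_continuousOn hf.continuousOn
  have hL0 : 0 ≤ L := (norm_nonneg _).trans (hL p ⟨le_rfl, hpq⟩)
  have hlip : LipschitzWith k (fun y => f (projIcc p q hpq y)) := by
    have := (lipschitzOnWith_iff_restrict.1 hf).comp (LipschitzWith.projIcc hpq)
    rwa [mul_one] at this
  have hP : IsPicardLindelof (fun _ y => f (projIcc p q hpq y)) (tmin := -T) (tmax := T)
      ⟨0, by simpa using hT⟩ x ⟨L * T, by positivity⟩ 0 ⟨L, hL0⟩ k := by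
    refine IsPicardLindelof.of_time_independent (fun y _ => hL _ (projIcc p q hpq y).2)
      hlip.lipschitzOnWith ?_
    simp only [sub_zero, zero_sub, neg_neg, max_self, NNReal.coe_zero]
    exact le_rfl
  obtain ⟨γ, h0, hγ⟩ := hP.exists_eq_forall_mem_Icc_hasDerivWithinAt₀
  exact ⟨γ, h0, hγ⟩

/-- A scalar field bounded by `L` on `[x - d, x + d]` has a solution through `x` on `[-T, 0]` that
stays in this interval, as long as `L T ≤ d`. -/
theorem exists_backward_solution {f : ℝ → ℝ} {x d L T : ℝ} (hd : 0 ≤ d) (hT : 0 ≤ T) {k : ℝ≥0}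
    (hf : LipschitzOnWith k f (Icc (x - d) (x + d))) (hL : ∀ y ∈ Icc (x - d) (x + d), |f y| ≤ L)
    (hLT : L * T ≤ d) :
    ∃ γ : ℝ → ℝ, γ 0 = x ∧ ∀ t ∈ Icc (-T) 0, γ t ∈ Icc (x - d) (x + d) ∧
      HasDerivWithinAt γ (f (γ t)) (Icc (-T) 0) t := by
  obtain ⟨γ, h0, hγ⟩ := exists_solution_projIcc (by linarith : x - d ≤ x + d) hf hT x
  have hL0 : 0 ≤ L := (abs_nonneg _).trans (hL x ⟨by linarith, by linarith⟩)
  have hmem : ∀ t ∈ Icc (-T) 0, γ t ∈ Icc (x - d) (x + d) := by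
    intro t ht
    have := Convex.norm_image_sub_le_of_norm_hasDerivWithin_le hγ
      (fun s _ => hL _ (projIcc _ _ _ (γ s)).2) (convex_Icc _ _)
      (⟨by linarith, hT⟩ : (0 : ℝ) ∈ Icc (-T) T) ⟨ht.1, by linarith [ht.2]⟩ (y := t)
    rw [h0, sub_zero, Real.norm_eq_abs, Real.norm_eq_abs, abs_of_nonpos ht.2] at this
    have h2 : L * -t ≤ L * T := by gcongr; linarith [ht.1]
    have := abs_le.1 (this.trans (h2.trans hLT))
    exact ⟨by linarith, by linarith⟩
  refine ⟨γ, h0, fun t ht => ⟨hmem t ht, ?_⟩⟩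
  have h1 := (hγ t ⟨ht.1, by linarith [ht.2]⟩).mono
    (Icc_subset_Icc_right hT : Icc (-T) 0 ⊆ Icc (-T) T)
  rwa [projIcc_of_mem _ (hmem t ht)] at h1

/-- A Grönwall inequality for `S' ≤ - l S + B` on `[-T, 0]`. -/
theorem le_exp_mul_add_of_deriv_le {S S' : ℝ → ℝ} {l B T : ℝ} (hl : 0 < l) (hB : 0 ≤ B)
    (hT : 0 ≤ T) (hS : ∀ t ∈ Icc (-T) 0, HasDerivWithinAt S (S' t) (Icc (-T) 0) t)
    (hS' : ∀ t ∈ Icc (-T) 0, S' t ≤ -(l * S t) + B) :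
    S 0 ≤ Real.exp (-(l * T)) * S (-T) + B / l := by
  have hE : ∀ t, HasDerivAt (fun t => Real.exp (l * t)) (Real.exp (l * t) * (l * 1)) t := fun t =>
    ((hasDerivAt_id t).const_mul l).exp
  have hF : ∀ t ∈ Icc (-T) 0, HasDerivWithinAt (fun t => Real.exp (l * t) * (S t - B / l))
      (Real.exp (l * t) * (l * 1) * (S t - B / l) + Real.exp (l * t) * S' t) (Icc (-T) 0) t :=
    fun t ht => (hE t).hasDerivWithinAt.mul ((hS t ht).sub_const _)
  have hanti : AntitoneOn (fun t => Real.exp (l * t) * (S t - B / l)) (Icc (-T) 0) := by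
    refine antitoneOn_of_hasDerivWithinAt_nonpos (convex_Icc _ _)
      (fun t ht => (hF t ht).continuousWithinAt)
      (fun t ht => (hF t (interior_subset ht)).mono interior_subset) fun t ht => ?_
    have h1 := hS' t (interior_subset ht)
    have h2 : Real.exp (l * t) * (l * 1) * (S t - B / l) + Real.exp (l * t) * S' t =
        Real.exp (l * t) * (l * S t - B + S' t) := by field_simp
    rw [h2]
    exact mul_nonpos_of_nonneg_of_nonpos (Real.exp_pos _).le (by linarith)
  have := hanti (a := -T) (b := 0) ⟨le_rfl, by linarith⟩ ⟨by linarith, le_rfl⟩ (by linarith)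
  simp only [mul_zero, Real.exp_zero, one_mul, mul_neg] at this
  have hp : 0 ≤ Real.exp (-(l * T)) * (B / l) := by positivity
  linarith

namespace LorenzCM

theorem contDiff_lorenzField (ζ θ ρ : ℝ) : ContDiff ℝ 1 (lorenzField ζ θ ρ) := by
  rw [contDiff_pi]
  intro i
  fin_cases i <;> simp [lorenzField] <;> fun_prop

section

variable {ζ θ : ℝ} {r : ℕ} {U : Set (ℝ × ℝ)} {h : ℝ × ℝ → ℝ × ℝ}

theorem IsLocalCenterManifold.hasFDerivAt (H : IsLocalCenterManifold ζ θ r U h) (hr : 1 ≤ r)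
    {q : ℝ × ℝ} (hq : q ∈ U) : HasFDerivAt h (fderiv ℝ h q) q :=
  ((H.contDiffOn.contDiffAt (H.isOpen.mem_nhds hq)).differentiableAt
    (by norm_cast; omega)).hasFDerivAt

/-- The invariance equation: on the graph, the `(v, w)`-part of the field is the derivative of `h`
in the direction of the reduced field. -/
theorem IsLocalCenterManifold.fderiv_apply (H : IsLocalCenterManifold ζ θ r U h) (hζ : -1 < ζ)
    (hr : 1 ≤ r) {u₀ ρ : ℝ} (hq : (u₀, ρ) ∈ U) :
    fderiv ℝ h (u₀, ρ) (reducedField ζ θ h ρ u₀, 0) =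
      (fieldV ζ ρ u₀ (h (u₀, ρ)).1 (h (u₀, ρ)).2, fieldW ζ θ u₀ (h (u₀, ρ)).1 (h (u₀, ρ)).2) := by
  have hne : 1 + ζ ≠ 0 := by linarith
  obtain ⟨γ, hγ0, ε, hε, hγ⟩ :=
    (contDiff_lorenzField ζ θ ρ).contDiffAt
      (x := ofEigen ζ u₀ (h (u₀, ρ)).1 (h (u₀, ρ)).2)
      |>.exists_forall_mem_closedBall_exists_eq_forall_mem_Ioo_hasDerivAt₀ 0
  set u : ℝ → ℝ := fun t => (γ t 0 + ζ * γ t 1) / (1 + ζ) with hu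
  set v : ℝ → ℝ := fun t => (γ t 0 - γ t 1) / (1 + ζ) with hv
  set w : ℝ → ℝ := fun t => γ t 2 with hw
  have hof : (fun t => ofEigen ζ (u t) (v t) (w t)) = γ := by
    funext t i
    rw [ofEigen_eq]
    fin_cases i <;> simp [hu, hv, hw] <;> field_simp <;> ring
  have hu0 : u 0 = u₀ := by
    simp only [hu, hγ0, ofEigen_eq]; simp; field_simp; ring
  have hv0 : v 0 = (h (u₀, ρ)).1 := by
    simp only [hv, hγ0, ofEigen_eq]; simp; field_simp; ring
  have hw0 : w 0 = (h (u₀, ρ)).2 := by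
    simp only [hw, hγ0, ofEigen_eq]; simp
  have hγc : ContinuousAt γ 0 := (hγ 0 ⟨by linarith, by linarith⟩).continuousAt
  have huc : ContinuousAt u 0 := by
    have h0 : ∀ i, ContinuousAt (fun t => γ t i) 0 := fun i =>
      (continuous_apply i).continuousAt.comp hγc
    exact ((h0 0).add ((h0 1).const_mul ζ)).div_const _
  have hev : ∀ᶠ t in 𝓝 (0 : ℝ), (u t, ρ) ∈ U := by
    have : ContinuousAt (fun t => (u t, ρ)) 0 := huc.prodMk continuousAt_const
    refine this.eventually (H.isOpen.mem_nhds ?_)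
    simpa only [hu0] using hq
  obtain ⟨δ, hδ, hδU⟩ := Metric.eventually_nhds_iff.1 hev
  set d := min (ε / 2) (δ / 2) with hd
  have hd0 : 0 < d := lt_min (by linarith) (by linarith)
  have hdε : d < ε := (min_le_left _ _).trans_lt (by linarith)
  have hdδ : d < δ := (min_le_right _ _).trans_lt (by linarith)
  have hint : IsIntegralCurveOn (fun t => ofEigen ζ (u t) (v t) (w t))
      (fun _ => lorenzField ζ θ ρ) (Icc (-d) d) := by
    rw [hof]
    exact fun t ht => (hγ t ⟨by linarith [ht.1], by linarith [ht.2]⟩).hasDerivWithinAt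
  have hgr := H.invariant ρ (-d) d u v w hint
    (fun t ht => hδU (by
      rw [Real.dist_eq, sub_zero, abs_lt]; exact ⟨by linarith [ht.1], by linarith [ht.2]⟩))
    0 ⟨by linarith, hd0.le⟩ (by rw [hu0, hv0, hw0])
  have hnhds : Icc (-d) d ∈ 𝓝 (0 : ℝ) := Icc_mem_nhds (by linarith) hd0
  obtain ⟨d1, d2, d3⟩ := (isIntegralCurveOn_ofEigen_iff hζ).1 hint 0 ⟨by linarith, hd0.le⟩
  have e1 := (d2.hasDerivAt hnhds).prodMk (d3.hasDerivAt hnhds)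
  have e2 : HasDerivAt (fun t => h (u t, ρ))
      (fderiv ℝ h (u 0, ρ) (fieldU ζ ρ (u 0) (v 0) (w 0), 0)) 0 :=
    (H.hasFDerivAt hr (by rwa [hu0])).comp_hasDerivAt (0 : ℝ)
      ((d1.hasDerivAt hnhds).prodMk (hasDerivAt_const 0 ρ))
  have e3 := e1.congr_of_eventuallyEq (f₁ := fun t => h (u t, ρ))
    (mem_of_superset hnhds fun t ht => (hgr t ht).symm)
  have := e2.unique e3
  rw [hu0, hv0, hw0] at this
  rw [reducedField_eq hζ]
  exact this

/-- Along a solution of the reduced equation, the graph has the derivative of a Lorenz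
trajectory. -/
theorem IsLocalCenterManifold.hasDerivWithinAt_comp (H : IsLocalCenterManifold ζ θ r U h)
    (hζ : -1 < ζ) (hr : 1 ≤ r) {ρ t : ℝ} {u : ℝ → ℝ} {s : Set ℝ} (hq : (u t, ρ) ∈ U)
    (hu : HasDerivWithinAt u (reducedField ζ θ h ρ (u t)) s t) :
    HasDerivWithinAt (fun t => (h (u t, ρ)).1)
        (fieldV ζ ρ (u t) (h (u t, ρ)).1 (h (u t, ρ)).2) s t ∧
      HasDerivWithinAt (fun t => (h (u t, ρ)).2)
        (fieldW ζ θ (u t) (h (u t, ρ)).1 (h (u t, ρ)).2) s t := by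
  have h1 : HasDerivWithinAt (fun t => h (u t, ρ))
      (fderiv ℝ h (u t, ρ) (reducedField ζ θ h ρ (u t), 0)) s t :=
    (H.hasFDerivAt hr hq).comp_hasDerivWithinAt t (hu.prodMk (hasDerivWithinAt_const t s ρ))
  rw [H.fderiv_apply hζ hr hq] at h1
  exact ⟨h1.fst, h1.snd⟩

theorem IsLocalCenterManifold.isIntegralCurveOn_iff (H : IsLocalCenterManifold ζ θ r U h)
    (hζ : -1 < ζ) (hr : 1 ≤ r) {ρ : ℝ} {u : ℝ → ℝ} {s : Set ℝ} (hq : ∀ t ∈ s, (u t, ρ) ∈ U) :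
    IsIntegralCurveOn (fun t => ofEigen ζ (u t) (h (u t, ρ)).1 (h (u t, ρ)).2)
        (fun _ => lorenzField ζ θ ρ) s ↔
      IsIntegralCurveOn u (fun _ => reducedField ζ θ h ρ) s := by
  rw [isIntegralCurveOn_ofEigen_iff hζ (v := fun t => (h (u t, ρ)).1)
    (w := fun t => (h (u t, ρ)).2)]
  constructor
  · intro hs t ht
    simpa only [reducedField_eq hζ] using (hs t ht).1
  · intro hs t ht
    refine ⟨?_, H.hasDerivWithinAt_comp hζ hr (hq t ht) (hs t ht)⟩
    simpa only [reducedField_eq hζ] using hs t ht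

theorem IsLocalCenterManifold.contDiffOn_reducedField (H : IsLocalCenterManifold ζ θ r U h)
    (hζ : -1 < ζ) {ρ : ℝ} {s : Set ℝ} (hs : ∀ u ∈ s, (u, ρ) ∈ U) :
    ContDiffOn ℝ r (reducedField ζ θ h ρ) s := by
  have e : reducedField ζ θ h ρ = fun u => fieldU ζ ρ u (h (u, ρ)).1 (h (u, ρ)).2 :=
    funext fun u => reducedField_eq hζ θ h ρ u
  have h1 : ContDiffOn ℝ r (fun u : ℝ => h (u, ρ)) s :=
    H.contDiffOn.comp (contDiff_id.prodMk contDiff_const).contDiffOn hs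
  rw [e]
  unfold fieldU
  exact contDiffOn_const.mul ((contDiffOn_id.add (contDiffOn_const.mul h1.fst)).mul
    (contDiffOn_const.sub h1.snd))

theorem IsLocalCenterManifold.exists_norm_le (H : IsLocalCenterManifold ζ θ r U h) :
    ∃ d > 0, ∀ q : ℝ × ℝ, ‖q‖ < d → q ∈ U ∧ ‖h q‖ ≤ ‖q‖ := by
  have h1 := H.tangent
  rw [← Prod.zero_eq_mk, hasFDerivAt_iff_isLittleO_nhds_zero] at h1
  have h2 : ∀ᶠ q in 𝓝 (0 : ℝ × ℝ), ‖h q‖ ≤ ‖q‖ := by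
    filter_upwards [h1.bound (c := 1) one_pos] with q hq
    have h0 : h 0 = 0 := H.map_zero
    simpa [h0] using hq
  obtain ⟨d, hd, hd'⟩ := Metric.eventually_nhds_iff.1 (h2.and (H.isOpen.mem_nhds H.zero_mem))
  exact ⟨d, hd, fun q hq => (hd' (by simpa using hq)).symm⟩

end

/-- The deviation of `v` from its second order approximation. -/
noncomputable def errV (ζ u ρ v : ℝ) : ℝ := v - -(1 / (1 + ζ) ^ 2) * ρ * u

/-- The deviation of `w` from its second order approximation. -/
noncomputable def errW (θ u w : ℝ) : ℝ := w - 1 / θ * u ^ 2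

/-- The remainders in the invariance equation are products in which one factor is `v` or `w`. These
are of second order up to the error `s`, by the last two hypotheses. -/
theorem abs_quadratic_remainder_le {ζ u ρ v w n s a k : ℝ} (hu : |u| ≤ n) (hρ : |ρ| ≤ n)
    (hv : |v| ≤ n) (hw : |w| ≤ n) (ha : 0 ≤ a) (hk : 0 ≤ k)
    (hv2 : n * |v| ≤ n * s + a * n ^ 3) (hw2 : n * |w| ≤ n * s + k * n ^ 3) :
    |u * w - ζ * v * (ρ - w)| ≤ (1 + 2 * |ζ|) * (n * s + (a + k) * n ^ 3) ∧
      |(ζ - 1) * u * v - ζ * v * v| ≤ (1 + 2 * |ζ|) * (n * s + (a + k) * n ^ 3) := by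
  have hn0 : 0 ≤ n := (abs_nonneg _).trans hu
  have hZ := abs_nonneg ζ
  have c4 : 0 ≤ a * n ^ 3 := by positivity
  have c5 : 0 ≤ k * n ^ 3 := by positivity
  have c3 : |ζ| * (n * |v|) ≤ |ζ| * (n * s + (a + k) * n ^ 3) := by
    gcongr; linarith
  constructor
  · refine (abs_sub _ _).trans ?_
    rw [abs_mul, abs_mul, abs_mul]
    have c1 : |u| * |w| ≤ n * |w| := by gcongr
    have c2 : |ζ| * |v| * |ρ - w| ≤ |ζ| * |v| * (2 * n) := by
      gcongr
      exact (abs_sub _ _).trans (by linarith)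
    linarith
  · refine (abs_sub _ _).trans ?_
    rw [abs_mul, abs_mul, abs_mul, abs_mul]
    have b0 : |ζ - 1| ≤ |ζ| + 1 := by simpa using abs_sub ζ 1
    have c1 : |ζ - 1| * |u| * |v| ≤ (|ζ| + 1) * n * |v| := by gcongr
    have c2 : |ζ| * |v| * |v| ≤ |ζ| * n * |v| := by gcongr
    linarith

/-- The second order approximation satisfies the invariance equation up to third order. -/
theorem exists_residual_bound {ζ θ : ℝ} (hζ : -1 < ζ) (hθ : 0 < θ) : ∃ C > 0, ∀ u ρ v w n : ℝ,
    |u| ≤ n → |ρ| ≤ n → |v| ≤ n → |w| ≤ n → n ≤ 1 →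
    |fieldU ζ ρ u v w| ≤ C * n ^ 2 ∧
    |fieldV ζ ρ u v w - -(1 / (1 + ζ) ^ 2) * ρ * fieldU ζ ρ u v w + (1 + ζ) * errV ζ u ρ v| ≤
      C * (n * (|errV ζ u ρ v| + |errW θ u w|) + n ^ 3) ∧
    |fieldW ζ θ u v w - 1 / θ * (2 * u * fieldU ζ ρ u v w) + θ * errW θ u w| ≤
      C * (n * (|errV ζ u ρ v| + |errW θ u w|) + n ^ 3) ∧
    errV ζ u ρ v ^ 2 + errW θ u w ^ 2 ≤ C := by
  have h1 : 0 < 1 + ζ := by linarith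
  obtain ⟨i, hi⟩ : ∃ i, i = 1 / (1 + ζ) := ⟨_, rfl⟩
  obtain ⟨a, ha⟩ : ∃ a, a = 1 / (1 + ζ) ^ 2 := ⟨_, rfl⟩
  obtain ⟨k, hk⟩ : ∃ k, k = 1 / θ := ⟨_, rfl⟩
  obtain ⟨G, hG⟩ : ∃ G, G = |ζ / (1 + ζ)| * ((1 + |ζ|) * 2) := ⟨_, rfl⟩
  have hi0 : 0 < i := by rw [hi]; positivity
  have ha0 : 0 < a := by rw [ha]; positivity
  have hk0 : 0 < k := by rw [hk]; positivity
  have hG0 : 0 ≤ G := by rw [hG]; positivity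
  obtain ⟨P, hP⟩ : ∃ P, P = (1 + 2 * |ζ|) * (1 + a + k) := ⟨_, rfl⟩
  have hP0 : 0 < P := by rw [hP]; positivity
  rw [← ha, ← hk]
  refine ⟨G + (i * P + a * G) + (P + 2 * k * G) + ((1 + a) ^ 2 + (1 + k) ^ 2), by positivity,
    fun u ρ v w n hu hρ hv hw hn => ?_⟩
  have hn0 : 0 ≤ n := (abs_nonneg _).trans hu
  have hg : |fieldU ζ ρ u v w| ≤ G * n ^ 2 := by
    rw [fieldU, abs_mul, abs_mul]
    have hx : |u + ζ * v| ≤ (1 + |ζ|) * n := by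
      refine (abs_add_le _ _).trans ?_
      rw [abs_mul]
      linarith [mul_le_mul_of_nonneg_left hv (abs_nonneg ζ)]
    have hrw : |ρ - w| ≤ 2 * n := (abs_sub _ _).trans (by linarith)
    calc _ ≤ |ζ / (1 + ζ)| * ((1 + |ζ|) * n * (2 * n)) := by gcongr
      _ = _ := by rw [hG]; ring
  have eV : fieldV ζ ρ u v w - -a * ρ * fieldU ζ ρ u v w + (1 + ζ) * errV ζ u ρ v =
      i * (u * w - ζ * v * (ρ - w)) + a * (ρ * fieldU ζ ρ u v w) := by
    rw [errV, fieldV, ha, hi]; field_simp; ring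
  have eW : fieldW ζ θ u v w - k * (2 * u * fieldU ζ ρ u v w) + θ * errW θ u w =
      (ζ - 1) * u * v - ζ * v * v - 2 * k * (u * fieldU ζ ρ u v w) := by
    rw [errW, fieldW, hk]; field_simp; ring
  rw [eV, eW]
  have hve : errV ζ u ρ v = v + a * (ρ * u) := by rw [errV, ha]; ring
  have hwe : errW θ u w = w - k * u ^ 2 := by rw [errW, hk]
  generalize fieldU ζ ρ u v w = g at hg ⊢
  generalize errV ζ u ρ v = e₁ at hve ⊢
  generalize errW θ u w = e₂ at hwe ⊢
  have hρu : |a * (ρ * u)| ≤ a * n ^ 2 := by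
    rw [abs_mul, abs_of_pos ha0, abs_mul, pow_two]
    gcongr
  have hu2 : |k * u ^ 2| ≤ k * n ^ 2 := by
    rw [abs_mul, abs_of_pos hk0, abs_pow]
    gcongr
  have hn21 : n ^ 2 ≤ 1 := pow_le_one₀ hn0 hn
  have hvb : |v| ≤ |e₁| + a * n ^ 2 := by
    rw [show v = e₁ - a * (ρ * u) by rw [hve]; ring]
    exact (abs_sub _ _).trans (by linarith)
  have hwb : |w| ≤ |e₂| + k * n ^ 2 := by
    rw [show w = e₂ + k * u ^ 2 by rw [hwe]; ring]
    exact (abs_add_le _ _).trans (by linarith)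
  have he₁b : |e₁| ≤ 1 + a := by
    rw [hve]
    refine (abs_add_le _ _).trans ?_
    linarith [mul_le_mul_of_nonneg_left hn21 ha0.le]
  have he₂b : |e₂| ≤ 1 + k := by
    rw [hwe]
    refine (abs_sub _ _).trans ?_
    linarith [mul_le_mul_of_nonneg_left hn21 hk0.le]
  have b1 : e₁ ^ 2 ≤ (1 + a) ^ 2 :=
    sq_le_sq' (by linarith [neg_abs_le e₁]) (by linarith [le_abs_self e₁])
  have b2 : e₂ ^ 2 ≤ (1 + k) ^ 2 :=
    sq_le_sq' (by linarith [neg_abs_le e₂]) (by linarith [le_abs_self e₂])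
  have hs₁ : |e₁| ≤ |e₁| + |e₂| := le_add_of_nonneg_right (abs_nonneg _)
  have hs₂ : |e₂| ≤ |e₁| + |e₂| := le_add_of_nonneg_left (abs_nonneg _)
  have hs0 : 0 ≤ |e₁| + |e₂| := by positivity
  generalize |e₁| + |e₂| = s at hs₁ hs₂ hs0 ⊢
  -- both `v` and `w` are of second order, up to the errors
  have hv2 : n * |v| ≤ n * s + a * n ^ 3 := by
    calc n * |v| ≤ n * (s + a * n ^ 2) := by gcongr; linarith
      _ = _ := by ring
  have hw2 : n * |w| ≤ n * s + k * n ^ 3 := by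
    calc n * |w| ≤ n * (s + k * n ^ 2) := by gcongr; linarith
      _ = _ := by ring
  obtain ⟨q1, q2⟩ := abs_quadratic_remainder_le (ζ := ζ) hu hρ hv hw ha0.le hk0.le hv2 hw2
  have hR : (1 + 2 * |ζ|) * (n * s + (a + k) * n ^ 3) ≤ P * (n * s + n ^ 3) := by
    rw [hP, mul_assoc]
    refine mul_le_mul_of_nonneg_left ?_ (by positivity)
    have : 0 ≤ (a + k) * (n * s) + n ^ 3 := by positivity
    linarith
  replace q1 := q1.trans hR
  replace q2 := q2.trans hR
  have hg2 : n * (G * n ^ 2) ≤ G * (n * s + n ^ 3) := by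
    have : 0 ≤ G * (n * s) := by positivity
    linarith
  have g1 : |ρ * g| ≤ G * (n * s + n ^ 3) := by
    rw [abs_mul]; exact (mul_le_mul hρ hg (abs_nonneg _) hn0).trans hg2
  have g2 : |u * g| ≤ G * (n * s + n ^ 3) := by
    rw [abs_mul]; exact (mul_le_mul hu hg (abs_nonneg _) hn0).trans hg2
  have hY : 0 ≤ n * s + n ^ 3 := by positivity
  generalize n * s + n ^ 3 = Y at hY q1 q2 g1 g2 ⊢
  have z1 : 0 ≤ i * P + a * G := by positivity
  have z2 : 0 ≤ P + 2 * k * G := by positivity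
  have z3 : 0 ≤ (1 + a) ^ 2 + (1 + k) ^ 2 := by positivity
  refine ⟨hg.trans (mul_le_mul_of_nonneg_right (by linarith) (by positivity)), ?_, ?_, ?_⟩
  · refine ((abs_add_le _ _).trans ?_).trans
      (mul_le_mul_of_nonneg_right (by linarith : i * P + a * G ≤ _) hY)
    rw [abs_mul, abs_mul a, abs_of_pos hi0, abs_of_pos ha0]
    linarith [mul_le_mul_of_nonneg_left q1 hi0.le, mul_le_mul_of_nonneg_left g1 ha0.le]
  · refine ((abs_sub _ _).trans ?_).trans
      (mul_le_mul_of_nonneg_right (by linarith : P + 2 * k * G ≤ _) hY)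
    rw [abs_mul (2 * k), abs_of_pos (by positivity : 0 < 2 * k)]
    linarith [mul_le_mul_of_nonneg_left g2 (by positivity : 0 ≤ 2 * k)]
  · linarith

end LorenzCM

/-! ### Taylor expansion of a center manifold -/

/-- The energy `e₁² + e₂²` of an error that satisfies `e₁' = - α e₁ + R₁`, `e₂' = - β e₂ + R₂` decays
at the rate `l`, half of what the linear part gives, up to the contribution of the residual `C n³`:
the rest of the rate absorbs the terms of `R₁`, `R₂` that involve the error. -/
theorem energy_derivative_le {l α β e₁ e₂ R₁ R₂ C n : ℝ} (hl : 0 < l) (hα : l ≤ α) (hβ : l ≤ β)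
    (hn : 8 * C * n ≤ l)
    (h₁ : |R₁| ≤ C * (n * (|e₁| + |e₂|) + n ^ 3)) (h₂ : |R₂| ≤ C * (n * (|e₁| + |e₂|) + n ^ 3)) :
    2 * e₁ * (R₁ - α * e₁) + 2 * e₂ * (R₂ - β * e₂) ≤
      -(l * (e₁ ^ 2 + e₂ ^ 2)) + 4 * C ^ 2 / l * n ^ 6 := by
  have a1 : e₁ * R₁ ≤ |e₁| * (C * (n * (|e₁| + |e₂|) + n ^ 3)) := by
    refine (le_abs_self _).trans ?_
    rw [abs_mul]; gcongr
  have a2 : e₂ * R₂ ≤ |e₂| * (C * (n * (|e₁| + |e₂|) + n ^ 3)) := by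
    refine (le_abs_self _).trans ?_
    rw [abs_mul]; gcongr
  have hS : (|e₁| + |e₂|) ^ 2 ≤ 2 * (e₁ ^ 2 + e₂ ^ 2) := by
    have := sq_nonneg (|e₁| - |e₂|)
    rw [← sq_abs e₁, ← sq_abs e₂]; linarith
  have a3 : l * e₁ ^ 2 ≤ α * e₁ ^ 2 := by gcongr
  have a4 : l * e₂ ^ 2 ≤ β * e₂ ^ 2 := by gcongr
  obtain ⟨s, hs⟩ : ∃ s, s = |e₁| + |e₂| := ⟨_, rfl⟩
  rw [← hs] at a1 a2 hS
  have a5 : 2 * (s * (C * n ^ 3)) ≤ l / 4 * s ^ 2 + 4 * C ^ 2 / l * n ^ 6 := by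
    have e : l / 4 * s ^ 2 + 4 * C ^ 2 / l * n ^ 6 - 2 * (s * (C * n ^ 3)) =
        l / 4 * (s - 4 / l * (C * n ^ 3)) ^ 2 := by field_simp; ring
    have : 0 ≤ l / 4 * (s - 4 / l * (C * n ^ 3)) ^ 2 := by positivity
    linarith
  have a6 : 8 * C * n * s ^ 2 ≤ l * s ^ 2 := by gcongr
  have a7 : e₁ * R₁ + e₂ * R₂ ≤ s * (C * (n * s + n ^ 3)) := by
    calc _ ≤ _ := add_le_add a1 a2
      _ = (|e₁| + |e₂|) * (C * (n * s + n ^ 3)) := by ring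
      _ = _ := by rw [hs]
  have a8 := mul_le_mul_of_nonneg_left hS hl.le
  linarith

theorem exp_neg_le_div_pow_six {x : ℝ} (hx : 0 < x) : Real.exp (-x) ≤ 720 / x ^ 6 := by
  have h1 := Real.pow_div_factorial_le_exp x hx.le 6
  have h2 : ((6 ! : ℕ) : ℝ) = 720 := by norm_num [Nat.factorial]
  rw [h2] at h1
  rw [Real.exp_neg, ← inv_div]
  exact inv_anti₀ (by positivity) h1

namespace LorenzCM

variable {ζ θ : ℝ} {r : ℕ} {U : Set (ℝ × ℝ)} {h : ℝ × ℝ → ℝ × ℝ}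

/-- Any `C¹` center manifold agrees with its formal expansion up to third order. The reduced flow
has speed `O(n²)` at distance `n` from the origin, so it can be followed backwards for a time of
order `1 / n` without leaving the ball of radius `2 n`. Over this time the energy of the error
contracts by a factor that is exponentially small in `1 / n`, and only the residual of the
approximation remains. -/
theorem IsLocalCenterManifold.exists_error_bound (H : IsLocalCenterManifold ζ θ r U h)
    (hζ : -1 < ζ) (hθ : 0 < θ) (hr : 1 ≤ r) :
    ∃ C ≥ 0, ∃ d > 0, d ≤ 1 ∧ ∀ u ρ : ℝ, ‖(u, ρ)‖ < d → (u, ρ) ∈ U ∧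
      |(h (u, ρ)).1| ≤ ‖(u, ρ)‖ ∧ |(h (u, ρ)).2| ≤ ‖(u, ρ)‖ ∧
      |errV ζ u ρ (h (u, ρ)).1| ≤ C * ‖(u, ρ)‖ ^ 3 ∧
      |errW θ u (h (u, ρ)).2| ≤ C * ‖(u, ρ)‖ ^ 3 := by
  obtain ⟨C, hC, hres⟩ := exists_residual_bound hζ hθ
  obtain ⟨d₀, hd₀, hsmall⟩ := H.exists_norm_le
  obtain ⟨l, hldef⟩ : ∃ l, l = min (1 + ζ) θ := ⟨_, rfl⟩
  have hl : 0 < l := by rw [hldef]; exact lt_min (by linarith) hθ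
  -- the first term of `M` comes from the energy at time `-T`, the second one from the residual
  obtain ⟨M, hM⟩ : ∃ M, M = 720 * (4 * C / l) ^ 6 * C + 4 * C ^ 2 / l * 64 / l := ⟨_, rfl⟩
  have hM0 : 0 ≤ M := by rw [hM]; positivity
  refine ⟨√M, Real.sqrt_nonneg M, min (d₀ / 2) (min (1 / 2) (l / (16 * C))), by positivity,
    (min_le_right _ _).trans ((min_le_left _ _).trans (by norm_num)), fun u₀ ρ hq => ?_⟩
  obtain ⟨n, hn⟩ : ∃ n, n = ‖(u₀, ρ)‖ := ⟨_, rfl⟩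
  rw [← hn] at hq ⊢
  have hq1 : n < d₀ / 2 := hq.trans_le (min_le_left _ _)
  have hq2 : n < 1 / 2 := hq.trans_le ((min_le_right _ _).trans (min_le_left _ _))
  have hq3 : n < l / (16 * C) := hq.trans_le ((min_le_right _ _).trans (min_le_right _ _))
  have hn0 : 0 ≤ n := hn ▸ norm_nonneg _
  have hmem : ∀ u : ℝ, |u| ≤ 2 * n → (u, ρ) ∈ U ∧ |(h (u, ρ)).1| ≤ 2 * n ∧
      |(h (u, ρ)).2| ≤ 2 * n := by
    intro u hu
    have hρ : |ρ| ≤ n := hn ▸ norm_snd_le (u₀, ρ)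
    have h1 : ‖(u, ρ)‖ ≤ 2 * n := by
      rw [Prod.norm_def]
      exact max_le hu (hρ.trans (by linarith))
    obtain ⟨h2, h3⟩ := hsmall (u, ρ) (h1.trans_lt (by linarith))
    exact ⟨h2, (norm_fst_le _).trans (h3.trans h1), (norm_snd_le _).trans (h3.trans h1)⟩
  have hu₀ : |u₀| ≤ n := hn ▸ norm_fst_le (u₀, ρ)
  have hρ : |ρ| ≤ n := hn ▸ norm_snd_le (u₀, ρ)
  obtain ⟨hU₀, hh₀⟩ := hsmall (u₀, ρ) (hn ▸ (by linarith))
  rw [← hn] at hh₀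
  refine ⟨hU₀, (norm_fst_le _).trans hh₀, (norm_snd_le _).trans hh₀, ?_⟩
  suffices hS : errV ζ u₀ ρ (h (u₀, ρ)).1 ^ 2 + errW θ u₀ (h (u₀, ρ)).2 ^ 2 ≤ M * n ^ 6 by
    have e : (√M * n ^ 3) ^ 2 = M * n ^ 6 := by rw [mul_pow, Real.sq_sqrt hM0]; ring
    constructor
    · refine abs_le_of_sq_le_sq ?_ (by positivity)
      rw [e]; linarith [sq_nonneg (errW θ u₀ (h (u₀, ρ)).2)]
    · refine abs_le_of_sq_le_sq ?_ (by positivity)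
      rw [e]; linarith [sq_nonneg (errV ζ u₀ ρ (h (u₀, ρ)).1)]
  rcases hn0.eq_or_lt with hz | hpos
  · have hu : u₀ = 0 := abs_nonpos_iff.1 (by rwa [hz])
    have hr' : ρ = 0 := abs_nonpos_iff.1 (by rwa [hz])
    rw [hu, hr', H.map_zero, ← hz]
    simp [errV, errW]
  -- the backward solution of the reduced equation: its speed is at most `4 C n²`, so that it moves by
  -- at most `n` up to time `T`
  obtain ⟨T, hT⟩ : ∃ T, T = 1 / (4 * C * n) := ⟨_, rfl⟩
  have hT0 : 0 < T := by rw [hT]; positivity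
  have hin : ∀ u ∈ Icc (u₀ - n) (u₀ + n), |u| ≤ 2 * n := fun u hu => by
    have := abs_le.1 hu₀
    exact abs_le.2 ⟨by linarith [hu.1], by linarith [hu.2]⟩
  have hbound : ∀ u, |u| ≤ 2 * n → _ := fun u hu =>
    hres u ρ (h (u, ρ)).1 (h (u, ρ)).2 (2 * n) hu (by linarith) (hmem u hu).2.1 (hmem u hu).2.2
      (by linarith)
  obtain ⟨k, hk⟩ := (H.contDiffOn_reducedField hζ (ρ := ρ) (s := Icc (u₀ - n) (u₀ + n))
    (fun u hu => (hmem u (hin u hu)).1)).exists_lipschitzOnWith (by norm_cast; omega)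
    (convex_Icc _ _) isCompact_Icc
  obtain ⟨γ, hγ0, hγ⟩ := exists_backward_solution hn0 hT0.le hk
    (L := C * (2 * n) ^ 2) (fun u hu => by
      rw [reducedField_eq hζ]; exact (hbound u (hin u hu)).1) (by
      rw [hT]; refine le_of_eq ?_; field_simp; ring)
  -- the energy of the error along it
  have hE : ∀ t ∈ Icc (-T) 0, HasDerivWithinAt
      (fun t => errV ζ (γ t) ρ (h (γ t, ρ)).1 ^ 2 + errW θ (γ t) (h (γ t, ρ)).2 ^ 2)
      (2 * errV ζ (γ t) ρ (h (γ t, ρ)).1 * (fieldV ζ ρ (γ t) (h (γ t, ρ)).1 (h (γ t, ρ)).2 -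
          -(1 / (1 + ζ) ^ 2) * ρ * fieldU ζ ρ (γ t) (h (γ t, ρ)).1 (h (γ t, ρ)).2) +
        2 * errW θ (γ t) (h (γ t, ρ)).2 * (fieldW ζ θ (γ t) (h (γ t, ρ)).1 (h (γ t, ρ)).2 -
          1 / θ * (2 * γ t * fieldU ζ ρ (γ t) (h (γ t, ρ)).1 (h (γ t, ρ)).2)))
      (Icc (-T) 0) t := by
    intro t ht
    obtain ⟨g1, g2⟩ := hγ t ht
    obtain ⟨d1, d2⟩ := H.hasDerivWithinAt_comp hζ hr (hmem _ (hin _ g1)).1 g2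
    rw [reducedField_eq hζ] at g2
    have d3 := (d1.sub (g2.const_mul (-(1 / (1 + ζ) ^ 2) * ρ))).pow 2
    have d4 := (d2.sub ((g2.pow 2).const_mul (1 / θ))).pow 2
    refine ((d3.add d4).congr_deriv ?_).congr (fun s _ => ?_) ?_
    · simp [errV, errW]
    · simp [errV, errW]
    · simp [errV, errW]
  have h8 : 8 * C * (2 * n) ≤ l := by
    rw [lt_div_iff₀ (by positivity)] at hq3
    linarith
  have hfin := le_exp_mul_add_of_deriv_le hl (B := 4 * C ^ 2 / l * (2 * n) ^ 6) (by positivity)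
    hT0.le hE (fun t ht => by
      obtain ⟨-, b1, b2, -⟩ := hbound (γ t) (hin _ (hγ t ht).1)
      have := energy_derivative_le hl (α := 1 + ζ) (β := θ) (hldef ▸ min_le_left _ _)
        (hldef ▸ min_le_right _ _) h8 b1 b2
      simpa only [add_sub_cancel_right] using this)
  simp only [hγ0] at hfin
  have hstart := (hbound (γ (-T)) (hin _ (hγ (-T) ⟨le_rfl, by linarith⟩).1)).2.2.2
  have hexp : Real.exp (-(l * T)) ≤ 720 * (4 * C / l) ^ 6 * n ^ 6 := by
    refine (exp_neg_le_div_pow_six (by positivity)).trans (le_of_eq ?_)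
    rw [hT]; field_simp
  have hs0 : 0 ≤ errV ζ (γ (-T)) ρ (h (γ (-T), ρ)).1 ^ 2 + errW θ (γ (-T)) (h (γ (-T), ρ)).2 ^ 2 := by
    positivity
  have := mul_le_mul hexp hstart hs0 (by positivity)
  have e : M * n ^ 6 = 720 * (4 * C / l) ^ 6 * n ^ 6 * C + 4 * C ^ 2 / l * (2 * n) ^ 6 / l := by
    rw [hM]; ring
  rw [e]
  linarith

theorem IsLocalCenterManifold.exists_reducedField_bound (H : IsLocalCenterManifold ζ θ r U h)
    (hζ : -1 < ζ) (hθ : 0 < θ) (hr : 1 ≤ r) :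
    ∃ C ≥ 0, ∃ d > 0, ∀ u ρ : ℝ, ‖(u, ρ)‖ < d → (u, ρ) ∈ U ∧
      |reducedField ζ θ h ρ u - (ζ / (1 + ζ) * ρ * u - normalFormCoeff ζ θ * u ^ 3
        - ζ ^ 2 / (1 + ζ) ^ 3 * ρ ^ 2 * u)| ≤ C * ‖(u, ρ)‖ ^ 4 := by
  obtain ⟨C, hC, d, hd, hd1, hb⟩ := H.exists_error_bound hζ hθ hr
  have h1 : 0 < 1 + ζ := by linarith
  obtain ⟨a, ha⟩ : ∃ a, a = 1 / (1 + ζ) ^ 2 := ⟨_, rfl⟩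
  have ha0 : 0 < a := by rw [ha]; positivity
  refine ⟨|ζ / (1 + ζ)| * (2 * |ζ| * C + (1 + |ζ| * a) * C + |ζ| * a / θ), by positivity, d, hd,
    fun u ρ hq => ?_⟩
  obtain ⟨hU, hv, hw, h₁, h₂⟩ := hb u ρ hq
  refine ⟨hU, ?_⟩
  rw [reducedField_eq hζ]
  have hu : |u| ≤ ‖(u, ρ)‖ := norm_fst_le (u, ρ)
  have hρ : |ρ| ≤ ‖(u, ρ)‖ := norm_snd_le (u, ρ)
  have hn0 := norm_nonneg (u, ρ)
  have hn1 : ‖(u, ρ)‖ ≤ 1 := (hq.trans_le hd1).le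
  generalize ‖(u, ρ)‖ = n at *
  generalize (h (u, ρ)).1 = v at *
  generalize (h (u, ρ)).2 = w at *
  have e : fieldU ζ ρ u v w - (ζ / (1 + ζ) * ρ * u - normalFormCoeff ζ θ * u ^ 3
      - ζ ^ 2 / (1 + ζ) ^ 3 * ρ ^ 2 * u) = ζ / (1 + ζ) * (ζ * errV ζ u ρ v * (ρ - w) -
        (u - ζ * a * (ρ * u)) * errW θ u w + ζ * a / θ * (ρ * u ^ 3)) := by
    rw [fieldU, errV, errW, normalFormCoeff, ha]
    field_simp
    ring
  rw [e, abs_mul, mul_assoc |ζ / (1 + ζ)|]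
  refine mul_le_mul_of_nonneg_left ?_ (abs_nonneg _)
  have hρw : |ρ - w| ≤ 2 * n := (abs_sub ρ w).trans (by linarith)
  have c1 : |ζ * errV ζ u ρ v * (ρ - w)| ≤ 2 * |ζ| * C * n ^ 4 := by
    rw [abs_mul, abs_mul]
    calc _ ≤ |ζ| * (C * n ^ 3) * (2 * n) := by gcongr
      _ = _ := by ring
  have hρu : |ρ * u| ≤ n := by
    rw [abs_mul]
    calc _ ≤ 1 * n := mul_le_mul (hρ.trans hn1) hu (abs_nonneg _) zero_le_one
      _ = n := one_mul n
  have c2 : |(u - ζ * a * (ρ * u)) * errW θ u w| ≤ (1 + |ζ| * a) * C * n ^ 4 := by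
    rw [abs_mul]
    have : |u - ζ * a * (ρ * u)| ≤ (1 + |ζ| * a) * n := by
      refine (abs_sub _ _).trans ?_
      rw [abs_mul, abs_mul, abs_of_pos ha0, add_mul, one_mul]
      gcongr
    calc _ ≤ (1 + |ζ| * a) * n * (C * n ^ 3) := by gcongr
      _ = _ := by ring
  have c3 : |ζ * a / θ * (ρ * u ^ 3)| ≤ |ζ| * a / θ * n ^ 4 := by
    rw [abs_mul, abs_div, abs_mul, abs_of_pos ha0, abs_of_pos hθ, abs_mul, abs_pow]
    calc _ ≤ |ζ| * a / θ * (n * n ^ 3) := by gcongr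
      _ = _ := by ring
  refine (abs_add_le _ _).trans ?_
  have := abs_sub (ζ * errV ζ u ρ v * (ρ - w)) ((u - ζ * a * (ρ * u)) * errW θ u w)
  linarith

theorem IsLocalCenterManifold.isBigO_fst (H : IsLocalCenterManifold ζ θ r U h)
    (hζ : -1 < ζ) (hθ : 0 < θ) (hr : 1 ≤ r) :
    (fun q : ℝ × ℝ => (h q).1 - (-(1 / (1 + ζ) ^ 2) * q.2 * q.1))
      =O[𝓝 (0, 0)] (fun q : ℝ × ℝ => ‖q‖ ^ 3) := by
  obtain ⟨C, -, d, hd, -, hb⟩ := H.exists_error_bound hζ hθ hr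
  refine IsBigO.of_bound C ?_
  filter_upwards [Metric.ball_mem_nhds ((0, 0) : ℝ × ℝ) hd] with q hq
  rw [norm_pow, norm_norm]
  exact (hb q.1 q.2 (mem_ball_zero_iff.1 hq)).2.2.2.1

theorem IsLocalCenterManifold.isBigO_snd (H : IsLocalCenterManifold ζ θ r U h)
    (hζ : -1 < ζ) (hθ : 0 < θ) (hr : 1 ≤ r) :
    (fun q : ℝ × ℝ => (h q).2 - 1 / θ * q.1 ^ 2)
      =O[𝓝 (0, 0)] (fun q : ℝ × ℝ => ‖q‖ ^ 3) := by
  obtain ⟨C, -, d, hd, -, hb⟩ := H.exists_error_bound hζ hθ hr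
  refine IsBigO.of_bound C ?_
  filter_upwards [Metric.ball_mem_nhds ((0, 0) : ℝ × ℝ) hd] with q hq
  rw [norm_pow, norm_norm]
  exact (hb q.1 q.2 (mem_ball_zero_iff.1 hq)).2.2.2.2

theorem IsLocalCenterManifold.isBigO_reducedField (H : IsLocalCenterManifold ζ θ r U h)
    (hζ : -1 < ζ) (hθ : 0 < θ) (hr : 1 ≤ r) :
    (fun q : ℝ × ℝ => reducedField ζ θ h q.2 q.1 -
        (ζ / (1 + ζ) * q.2 * q.1 - normalFormCoeff ζ θ * q.1 ^ 3
          - ζ ^ 2 / (1 + ζ) ^ 3 * q.2 ^ 2 * q.1))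
      =O[𝓝 (0, 0)] (fun q : ℝ × ℝ => ‖q‖ ^ 4) := by
  obtain ⟨C, -, d, hd, hb⟩ := H.exists_reducedField_bound hζ hθ hr
  refine IsBigO.of_bound C ?_
  filter_upwards [Metric.ball_mem_nhds ((0, 0) : ℝ × ℝ) hd] with q hq
  rw [norm_pow, norm_norm]
  exact (hb q.1 q.2 (mem_ball_zero_iff.1 hq)).2

end LorenzCM

/-! ### Equilibria of the reduced equation and their stability -/

theorem eq_zero_of_eventually_sub_mul_pos {F : ℝ → ℝ} {x : ℝ} (hc : ContinuousAt F x)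
    (h : ∀ᶠ s in 𝓝[≠] x, 0 < (s - x) * F s) : F x = 0 := by
  have hR : ∀ᶠ s in 𝓝[>] x, 0 ≤ F s := by
    filter_upwards [h.filter_mono (nhdsWithin_mono x fun s (hs : x < s) => hs.ne'),
      self_mem_nhdsWithin] with s h1 h2
    exact (pos_of_mul_pos_right h1 (sub_pos.2 h2).le).le
  have hL : ∀ᶠ s in 𝓝[<] x, F s ≤ 0 := by
    filter_upwards [h.filter_mono (nhdsWithin_mono x fun s (hs : s < x) => hs.ne),
      self_mem_nhdsWithin] with s h1 h2
    exact (neg_of_mul_pos_right h1 (sub_neg.2 h2).le).le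
  exact le_antisymm (le_of_tendsto (hc.mono_left nhdsWithin_le_nhds) hL)
    (ge_of_tendsto (hc.mono_left nhdsWithin_le_nhds) hR)

theorem eq_zero_of_sub_mul_pos {f : ℝ → ℝ} {p η : ℝ} (hη : 0 < η)
    (hf : ContinuousOn f (Icc (p - η) (p + η)))
    (h : ∀ u, 0 < |u - p| → |u - p| ≤ η → 0 < (u - p) * f u) : f p = 0 := by
  refine eq_zero_of_eventually_sub_mul_pos
    (hf.continuousAt (Icc_mem_nhds (by linarith) (by linarith))) ?_
  filter_upwards [self_mem_nhdsWithin,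
    mem_nhdsWithin_of_mem_nhds (Metric.closedBall_mem_nhds p hη)] with u h1 h2
  exact h u (abs_pos.2 (sub_ne_zero.2 h1)) (by rwa [Metric.mem_closedBall, Real.dist_eq] at h2)

namespace LorenzCM

theorem hasDerivWithinAt_sub_sq {γ : ℝ → ℝ} {γ' p t : ℝ} {s : Set ℝ}
    (h : HasDerivWithinAt γ γ' s t) :
    HasDerivWithinAt (fun t => (γ t - p) ^ 2) (2 * ((γ t - p) * γ')) s t := by
  refine ((h.sub_const p).pow 2).congr_deriv ?_
  simp; ring

/-- A ball around an attracting zero is forward invariant. -/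
theorem abs_sub_lt_of_attracting {f : ℝ → ℝ} {p η e T : ℝ} (he : e ≤ η)
    (h : ∀ u, 0 < |u - p| → |u - p| ≤ η → (u - p) * f u < 0) {γ : ℝ → ℝ}
    (hγ : IsIntegralCurveOn γ (fun _ => f) (Icc 0 T)) (h0 : |γ 0 - p| < e) :
    ∀ t ∈ Icc 0 T, |γ t - p| < e := by
  have he0 : 0 ≤ e := (abs_nonneg _).trans h0.le
  obtain ⟨c, hc1, hc2⟩ := exists_between h0
  have hc0 : 0 < c := (abs_nonneg _).trans_lt hc1
  have key := image_le_of_deriv_right_lt_deriv_boundary (f := fun t => (γ t - p) ^ 2)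
    (f' := fun t => 2 * ((γ t - p) * f (γ t))) (a := 0) (b := T) (B := fun _ => c ^ 2)
    (B' := fun _ => 0)
    (fun t ht => (hasDerivWithinAt_sub_sq (hγ t ht)).continuousWithinAt)
    (fun t ht => (hasDerivWithinAt_sub_sq
      (hγ t (Ico_subset_Icc_self ht))).mono_of_mem_nhdsWithin
        (mem_of_superset (Icc_mem_nhdsGE ht.2) (Icc_subset_Icc_left ht.1)))
    (by rw [← sq_abs]; exact pow_le_pow_left₀ (abs_nonneg _) hc1.le 2)
    (fun t => hasDerivAt_const t _) (fun t _ heq => by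
      have : |γ t - p| = c := by
        rw [← sq_abs] at heq
        exact (pow_left_inj₀ (abs_nonneg _) hc0.le two_ne_zero).1 heq
      have := h (γ t) (by rw [this]; exact hc0) (by rw [this]; linarith)
      linarith)
  intro t ht
  exact (abs_le_of_sq_le_sq (key ht) hc0.le).trans_lt hc2

/-- An attracting zero is asymptotically stable: as long as a solution stays away from it, the
squared distance to it decreases at least at a fixed rate. -/
theorem isAsympStableEq_of_attracting {f : ℝ → ℝ} {p η : ℝ} (hη : 0 < η)
    (hf : ContinuousOn f (Icc (p - η) (p + η)))
    (h : ∀ u, 0 < |u - p| → |u - p| ≤ η → (u - p) * f u < 0) : IsAsympStableEq f p := by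
  have hp : f p = 0 := by
    have := eq_zero_of_sub_mul_pos hη hf.neg
      (fun u h1 h2 => by have := h u h1 h2; show 0 < (u - p) * -f u; linarith)
    simpa using this
  refine ⟨⟨hp, fun ε hε => ⟨min ε η, lt_min hε hη, fun T γ hγ h0 t ht =>
    (abs_sub_lt_of_attracting (min_le_right _ _) h hγ h0 t ht).trans_le (min_le_left _ _)⟩⟩,
    η, hη, fun γ hγ h0 => ?_⟩
  have hin : ∀ t, 0 ≤ t → |γ t - p| < η := fun t ht =>
    abs_sub_lt_of_attracting le_rfl h (hγ.mono Icc_subset_Ici_self) h0 t ⟨ht, le_rfl⟩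
  rw [Metric.tendsto_atTop]
  intro ε hε
  -- it is enough to come close to `p` once
  suffices hN : ∃ N ≥ 0, |γ N - p| < min ε η by
    obtain ⟨N, hN0, hN⟩ := hN
    refine ⟨N, fun t ht => ?_⟩
    have hsh : IsIntegralCurveOn (fun s => γ (N + s)) (fun _ => f) (Icc 0 (t - N)) := by
      intro s hs
      have := (hγ (N + s) (by have := hs.1; rw [mem_Ici]; linarith)).scomp s
        ((hasDerivAt_id s).const_add N).hasDerivWithinAt
        (s := Icc 0 (t - N)) (fun x hx => by show 0 ≤ N + x; linarith [hx.1])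
      simpa using! this
    have := abs_sub_lt_of_attracting (min_le_right ε η) h hsh (by simpa using hN) (t - N)
      ⟨by linarith, le_rfl⟩
    rw [Real.dist_eq]
    simp only [add_sub_cancel] at this
    exact this.trans_le (min_le_left _ _)
  by_contra! hcon
  have he0 : 0 < min ε η := lt_min hε hη
  have hcomp : IsCompact (Icc (p - η) (p + η) ∩ {u | min ε η ≤ |u - p|}) :=
    isCompact_Icc.inter_right (isClosed_le continuous_const (by fun_prop))
  obtain ⟨u₁, ⟨hu₁, hu₁'⟩, hmax⟩ := hcomp.exists_isMaxOn (f := fun u => (u - p) * f u)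
    ⟨γ 0, by
      have := abs_lt.1 h0
      exact ⟨⟨by linarith, by linarith⟩, hcon 0 le_rfl⟩⟩
    (((continuous_id.sub continuous_const).continuousOn.mul hf).mono inter_subset_left)
  have hneg : (u₁ - p) * f u₁ < 0 := h u₁ (he0.trans_le hu₁')
    (abs_le.2 ⟨by linarith [hu₁.1], by linarith [hu₁.2]⟩)
  set m := (u₁ - p) * f u₁ with hm
  have hdec : ∀ T ≥ 0, (γ T - p) ^ 2 ≤ (γ 0 - p) ^ 2 + 2 * m * T := by
    intro T hT
    have := image_le_of_deriv_right_le_deriv_boundary (f := fun t => (γ t - p) ^ 2)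
      (f' := fun t => 2 * ((γ t - p) * f (γ t))) (a := 0) (b := T)
      (B := fun t => (γ 0 - p) ^ 2 + 2 * m * t) (B' := fun _ => 2 * m * 1)
      (fun t ht => ((hasDerivWithinAt_sub_sq (hγ t ht.1)).mono
        Icc_subset_Ici_self).continuousWithinAt)
      (fun t ht => (hasDerivWithinAt_sub_sq (hγ t ht.1)).mono (Ici_subset_Ici.2 ht.1))
      (by simp) (by fun_prop)
      (fun t ht => (((hasDerivAt_id t).const_mul (2 * m)).const_add _).hasDerivWithinAt)
      (fun t ht => by
        have h1 := abs_lt.1 (hin t ht.1)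
        have h2 : (γ t - p) * f (γ t) ≤ m :=
          hmax ⟨⟨by linarith, by linarith⟩, hcon t ht.1⟩
        linarith)
    exact this ⟨hT, le_rfl⟩
  have h1 := hdec ((γ 0 - p) ^ 2 / (-m)) (by
    have : 0 < -m := by linarith
    positivity)
  have h2 : 2 * m * ((γ 0 - p) ^ 2 / (-m)) = -(2 * (γ 0 - p) ^ 2) := by
    have hm0 : m ≠ 0 := hneg.ne
    field_simp
  have h3 : 0 < (γ 0 - p) ^ 2 := by
    rw [← sq_abs]; exact pow_pos (he0.trans_le (hcon 0 le_rfl)) 2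
  rw [h2] at h1
  linarith [sq_nonneg (γ ((γ 0 - p) ^ 2 / (-m)) - p)]

/-- A repelling zero of a Lipschitz field is unstable: the solution that starts close to it on its
right moves with a positive minimal speed until it is at distance `η`. -/
theorem isUnstableEq_of_repelling {f : ℝ → ℝ} {p η : ℝ} (hη : 0 < η) {k : ℝ≥0}
    (hf : LipschitzOnWith k f (Icc (p - η) (p + η)))
    (h : ∀ u, 0 < |u - p| → |u - p| ≤ η → 0 < (u - p) * f u) : IsUnstableEq f p := by
  refine ⟨eq_zero_of_sub_mul_pos hη hf.continuousOn h, fun hst => ?_⟩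
  obtain ⟨δ, hδ, hst⟩ := hst.2 η hη
  set x := p + min δ η / 2 with hx
  have hmin : 0 < min δ η := lt_min hδ hη
  have hxp : p < x := by linarith
  have hxη : x < p + η := by linarith [min_le_right δ η]
  have hsub : Icc x (p + η) ⊆ Icc (p - η) (p + η) := Icc_subset_Icc_left (by linarith)
  have hpos : ∀ u ∈ Icc x (p + η), 0 < f u := by
    intro u hu
    have h0 : 0 < u - p := by linarith [hu.1]
    have := h u (abs_pos.2 h0.ne') (by rw [abs_of_pos h0]; linarith [hu.2])
    exact pos_of_mul_pos_right this h0.le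
  obtain ⟨u₁, hu₁, hmin'⟩ := isCompact_Icc.exists_isMinOn (nonempty_Icc.2 hxη.le)
    (hf.continuousOn.mono hsub)
  set c := f u₁ with hc
  have hc0 : 0 < c := hpos u₁ hu₁
  set T := η / c with hT
  have hT0 : 0 < T := by positivity
  obtain ⟨γ, hγ0, hγ⟩ := exists_solution_projIcc hxη.le (hf.mono hsub) hT0.le x
  have hsubT : Icc 0 T ⊆ Icc (-T) T := Icc_subset_Icc_left (by linarith)
  have hγ' : ∀ t ∈ Icc 0 T, HasDerivWithinAt γ (f (projIcc x (p + η) hxη.le (γ t))) (Icc 0 T) t :=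
    fun t ht => (hγ t (hsubT ht)).mono hsubT
  have hγc : ContinuousOn γ (Icc 0 T) := fun t ht => (hγ' t ht).continuousWithinAt
  have hmono : MonotoneOn γ (Icc 0 T) :=
    monotoneOn_of_hasDerivWithinAt_nonneg (convex_Icc _ _) hγc
      (fun t ht => (hγ' t (interior_subset ht)).mono interior_subset)
      (fun t _ => (hpos _ (projIcc _ _ hxη.le (γ t)).2).le)
  have hlin : x + c * T ≤ γ T := by
    have := monotoneOn_of_hasDerivWithinAt_nonneg (f := fun t => γ t - c * t)
      (f' := fun t => f (projIcc x (p + η) hxη.le (γ t)) - c * 1) (convex_Icc 0 T)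
      (hγc.sub (by fun_prop))
      (fun t ht => ((hγ' t (interior_subset ht)).mono interior_subset).sub
        ((hasDerivAt_id t).const_mul c).hasDerivWithinAt)
      (fun t _ => by
        have : c ≤ f (projIcc x (p + η) hxη.le (γ t)) := hmin' (projIcc _ _ hxη.le (γ t)).2
        linarith)
    have := this (a := 0) (b := T) ⟨le_rfl, hT0.le⟩ ⟨hT0.le, le_rfl⟩ hT0.le
    simp only [mul_zero, sub_zero, hγ0] at this
    linarith
  have hcT : c * T = η := by rw [hT]; field_simp
  obtain ⟨t₁, ht₁, hγt₁⟩ := intermediate_value_Icc hT0.le hγc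
    (⟨by rw [hγ0]; exact hxη.le, by linarith⟩ : p + η ∈ Icc (γ 0) (γ T))
  have hsub1 : Icc 0 t₁ ⊆ Icc 0 T := Icc_subset_Icc_right ht₁.2
  have hcurve : IsIntegralCurveOn γ (fun _ => f) (Icc 0 t₁) := by
    intro t ht
    have h1 := (hγ' t (hsub1 ht)).mono hsub1
    have h2 : γ t ∈ Icc x (p + η) :=
      ⟨hγ0 ▸ hmono ⟨le_rfl, hT0.le⟩ (hsub1 ht) ht.1, hγt₁ ▸ hmono (hsub1 ht) ht₁ ht.2⟩
    rwa [projIcc_of_mem _ h2] at h1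
  have := hst t₁ γ hcurve (by
    rw [hγ0, hx, add_sub_cancel_left, abs_of_pos (by linarith)]
    linarith [min_le_left δ η]) t₁ ⟨ht₁.1, le_rfl⟩
  rw [hγt₁, add_sub_cancel_left, abs_of_pos hη] at this
  exact lt_irrefl _ this

variable {ζ θ : ℝ} {r : ℕ} {U : Set (ℝ × ℝ)} {h : ℝ × ℝ → ℝ × ℝ}

/-- The equilibria of the reduced equation are equilibria of the Lorenz system. -/
theorem IsLocalCenterManifold.eq_zero_or_sq_eq (H : IsLocalCenterManifold ζ θ r U h)
    (hζ : -1 < ζ) (hζ0 : ζ ≠ 0) (hr : 1 ≤ r) {u ρ : ℝ} (hq : (u, ρ) ∈ U)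
    (hg : reducedField ζ θ h ρ u = 0) : u = 0 ∨ u ^ 2 = θ * ρ := by
  have h1 : 1 + ζ ≠ 0 := by linarith
  have hinv := H.fderiv_apply hζ hr hq
  have hz : ((0 : ℝ), (0 : ℝ)) = 0 := rfl
  rw [hg, hz, ContinuousLinearMap.map_zero, Prod.ext_iff] at hinv
  obtain ⟨hV, hW⟩ := hinv
  simp only [Prod.fst_zero, Prod.snd_zero, fieldV, fieldW] at hV hW
  rw [reducedField_eq hζ, fieldU] at hg
  have hx := (mul_eq_zero.1 hg).resolve_left (div_ne_zero hζ0 h1)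
  rw [hx, mul_zero, add_zero, eq_comm, neg_eq_zero, mul_eq_zero] at hV
  have hv := hV.resolve_left h1
  rw [hv] at hx hW
  simp only [mul_zero, add_zero, sub_zero] at hx hW
  rcases mul_eq_zero.1 hx with h0 | h0
  · exact Or.inl h0
  · right
    have : ρ = (h (u, ρ)).2 := by linarith
    rw [← this] at hW
    linarith

theorem IsLocalCenterManifold.continuousAt_reducedField (H : IsLocalCenterManifold ζ θ r U h)
    (hζ : -1 < ζ) {u ρ : ℝ} (hq : (u, ρ) ∈ U) :
    ContinuousAt (fun q : ℝ × ℝ => reducedField ζ θ h q.2 q.1) (u, ρ) := by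
  have e : (fun q : ℝ × ℝ => reducedField ζ θ h q.2 q.1) =
      fun q => fieldU ζ q.2 q.1 (h q).1 (h q).2 := funext fun q => reducedField_eq hζ θ h q.2 q.1
  have hc : ContinuousAt h (u, ρ) := H.contDiffOn.continuousOn.continuousAt (H.isOpen.mem_nhds hq)
  rw [e]
  unfold fieldU
  exact continuousAt_const.mul ((continuousAt_fst.add (continuousAt_const.mul hc.fst)).mul
    (continuousAt_snd.sub hc.snd))

/-- The sign of the reduced field on both sides of the parabola `u² = θ ρ`. There are no equilibria
off the parabola and the axis `u = 0`, so the sign is constant along vertical segments that avoid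
them, and the expansion gives it at `ρ = 0` and at `ρ = |u|`. -/
theorem IsLocalCenterManifold.exists_sign (H : IsLocalCenterManifold ζ θ r U h)
    (hζ : -1 < ζ) (hζ0 : ζ ≠ 0) (hθ : 0 < θ) (hr : 1 ≤ r) :
    ∃ d > 0, ∀ u ρ : ℝ, |u| < d → |ρ| < d → (u, ρ) ∈ U ∧ (u ≠ 0 →
      (θ * ρ < u ^ 2 → ζ / (1 + ζ) * (u * reducedField ζ θ h ρ u) < 0) ∧
      (u ^ 2 < θ * ρ → 0 < ζ / (1 + ζ) * (u * reducedField ζ θ h ρ u))) := by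
  obtain ⟨C, hC, d₀, hd₀, hb⟩ := H.exists_reducedField_bound hζ hθ hr
  have h1 : 0 < 1 + ζ := by linarith
  obtain ⟨κ, hκ⟩ : ∃ κ, κ = ζ / (1 + ζ) := ⟨_, rfl⟩
  have hκ0 : 0 < |κ| := abs_pos.2 (hκ ▸ div_ne_zero hζ0 h1.ne')
  obtain ⟨D, hD⟩ : ∃ D, D = ζ ^ 2 / (1 + ζ) ^ 3 := ⟨_, rfl⟩
  have hD0 : 0 ≤ D := by rw [hD]; positivity
  have hX : normalFormCoeff ζ θ = κ / θ := by rw [normalFormCoeff, hκ]; field_simp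
  rw [hX, ← hκ, ← hD] at hb
  rw [← hκ]
  -- for `|u| < E` the leading term of the expansion dominates, at `ρ = 0` and at `ρ = |u|`
  obtain ⟨E, hE⟩ : ∃ E, E = |κ| / (|κ| / θ + D + C + 1) / (1 + θ) := ⟨_, rfl⟩
  have hE0 : 0 < E := by rw [hE]; positivity
  refine ⟨min (min d₀ 1) (min θ E), by positivity, fun u ρ hu hρ => ?_⟩
  set d := min (min d₀ 1) (min θ E) with hd
  have hd1 : d ≤ d₀ := (min_le_left _ _).trans (min_le_left _ _)
  have hd2 : d ≤ 1 := (min_le_left _ _).trans (min_le_right _ _)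
  have hd3 : d ≤ θ := (min_le_right _ _).trans (min_le_left _ _)
  have hd4 : d ≤ E := (min_le_right _ _).trans (min_le_right _ _)
  have hnorm : ∀ s, |s| < d → ‖(u, s)‖ < d₀ := fun s hs => by
    rw [Prod.norm_def]; exact (max_lt hu hs).trans_le hd1
  refine ⟨(hb u ρ (hnorm ρ hρ)).1, fun hu0 => ?_⟩
  have hapos : 0 < |u| := abs_pos.2 hu0
  have hu1 : |u| ≤ 1 := (hu.trans_le hd2).le
  have husq : u ^ 2 = |u| ^ 2 := (sq_abs u).symm
  have hEu : |u| * (1 + θ) * (|κ| / θ + D + C + 1) < |κ| := by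
    have h3 := hu.trans_le hd4
    rw [hE, lt_div_iff₀ (by positivity), lt_div_iff₀ (by positivity)] at h3
    exact h3
  have hEθ : |u| * θ * (D + C) < |κ| := by
    have : |u| * θ * (D + C) ≤ |u| * (1 + θ) * (|κ| / θ + D + C + 1) := by
      have a1 : 0 ≤ |κ| / θ := by positivity
      exact mul_le_mul (by gcongr; linarith) (by linarith) (by positivity) (by positivity)
    linarith
  have hE1 : |u| * (|κ| / θ + D + C) < |κ| := by
    have : |u| * (|κ| / θ + D + C) ≤ |u| * (1 + θ) * (|κ| / θ + D + C + 1) := by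
      have a1 : 0 ≤ |κ| / θ := by positivity
      have a2 : |u| * 1 ≤ |u| * (1 + θ) := by gcongr; linarith
      rw [mul_one] at a2
      exact mul_le_mul a2 (by linarith) (by positivity) (by positivity)
    linarith
  -- transport of the sign along vertical segments
  have hmove : ∀ s, |s| < d → (∀ x ∈ uIcc s ρ, x ≠ u ^ 2 / θ) →
      (0 ∉ uIcc (κ * (u * reducedField ζ θ h s u)) (κ * (u * reducedField ζ θ h ρ u))) := by
    intro s hs hx h0
    have hsegd : ∀ x ∈ uIcc s ρ, |x| < d := by
      intro x hx
      have a1 := abs_lt.1 hs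
      have a2 := abs_lt.1 hρ
      rcases mem_uIcc.1 hx with h | h <;> exact abs_lt.2 ⟨by linarith, by linarith⟩
    have hcont : ContinuousOn (fun x => κ * (u * reducedField ζ θ h x u)) (uIcc s ρ) := by
      intro x hx
      have := (H.continuousAt_reducedField hζ (hb u x (hnorm x (hsegd x hx))).1).comp
        (f := fun x : ℝ => (u, x)) (by fun_prop)
      exact (continuousAt_const.mul (continuousAt_const.mul this)).continuousWithinAt
    obtain ⟨x, hxm, hx0⟩ := intermediate_value_uIcc hcont h0
    have hκ1 : κ ≠ 0 := abs_pos.1 hκ0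
    have hg0 : reducedField ζ θ h x u = 0 := by simpa [hκ1, hu0] using hx0
    rcases H.eq_zero_or_sq_eq hζ hζ0 hr (hb u x (hnorm x (hsegd x hxm))).1 hg0 with h2 | h2
    · exact hu0 h2
    · exact hx x hxm (by rw [h2]; field_simp)
  constructor
  · intro hlt
    -- the point `(u, 0)` lies below the parabola
    have hlt' : ρ < u ^ 2 / θ := by rw [lt_div_iff₀ hθ]; linarith
    have hpos : 0 < u ^ 2 / θ := by positivity
    have h00 : κ * (u * reducedField ζ θ h 0 u) < 0 := by
      have hn : ‖(u, (0 : ℝ))‖ = |u| := by simp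
      obtain ⟨-, h2⟩ := hb u 0 (hnorm 0 (by rw [abs_zero]; exact hapos.trans hu))
      rw [hn] at h2
      have h3 := (abs_le.1 (le_refl |κ * u * (reducedField ζ θ h 0 u -
        (κ * 0 * u - κ / θ * u ^ 3 - D * 0 ^ 2 * u))|)).2
      rw [abs_mul, abs_mul] at h3
      have h4 : |κ| * |u| * |reducedField ζ θ h 0 u -
          (κ * 0 * u - κ / θ * u ^ 3 - D * 0 ^ 2 * u)| ≤ |κ| * |u| * (C * |u| ^ 4) := by gcongr
      have e : κ * (u * reducedField ζ θ h 0 u) = κ * u * (reducedField ζ θ h 0 u -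
          (κ * 0 * u - κ / θ * u ^ 3 - D * 0 ^ 2 * u)) - |κ| ^ 2 / θ * |u| ^ 4 := by
        rw [sq_abs, show |u| ^ 4 = u ^ 4 by rw [show (4 : ℕ) = 2 * 2 by rfl, pow_mul, sq_abs,
          ← pow_mul]]
        ring
      have h5 : |κ| * |u| * (C * |u| ^ 4) < |κ| ^ 2 / θ * |u| ^ 4 := by
        have h6 : |u| * C < |κ| / θ := by
          rw [lt_div_iff₀ hθ]
          have : 0 ≤ |u| * θ * D := by positivity
          linarith
        calc |κ| * |u| * (C * |u| ^ 4) = |κ| * |u| ^ 4 * (|u| * C) := by ring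
          _ < |κ| * |u| ^ 4 * (|κ| / θ) := by gcongr
          _ = _ := by ring
      linarith
    by_contra! hcon
    refine hmove 0 (by rw [abs_zero]; exact hapos.trans hu) (fun x hx => ?_)
      (mem_uIcc.2 (Or.inl ⟨h00.le, hcon⟩))
    rcases mem_uIcc.1 hx with h | h
    · exact (h.2.trans_lt hlt').ne
    · exact (h.2.trans_lt hpos).ne
  · intro hgt
    -- the point `(u, |u|)` lies above the parabola
    have hgt' : u ^ 2 / θ < ρ := by rw [div_lt_iff₀ hθ]; linarith
    have hgu : u ^ 2 / θ < |u| := by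
      rw [div_lt_iff₀ hθ, husq, pow_two]
      have := hu.trans_le hd3
      gcongr
    have h00 : 0 < κ * (u * reducedField ζ θ h |u| u) := by
      have hn : ‖(u, |u|)‖ = |u| := by simp [Prod.norm_def]
      obtain ⟨-, h2⟩ := hb u |u| (hnorm |u| (by rwa [abs_abs]))
      rw [hn] at h2
      have h3 := (abs_le.1 (le_refl |κ * u * (reducedField ζ θ h |u| u -
        (κ * |u| * u - κ / θ * u ^ 3 - D * |u| ^ 2 * u))|)).1
      rw [abs_mul, abs_mul] at h3
      have h4 : |κ| * |u| * |reducedField ζ θ h |u| u -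
          (κ * |u| * u - κ / θ * u ^ 3 - D * |u| ^ 2 * u)| ≤ |κ| * |u| * (C * |u| ^ 4) := by gcongr
      have hu4 : |u| ^ 4 = u ^ 4 := by
        rw [show (4 : ℕ) = 2 * 2 by rfl, pow_mul, sq_abs, ← pow_mul]
      have e : κ * (u * reducedField ζ θ h |u| u) = κ * u * (reducedField ζ θ h |u| u -
          (κ * |u| * u - κ / θ * u ^ 3 - D * |u| ^ 2 * u)) +
          (|κ| ^ 2 * |u| ^ 3 - |κ| ^ 2 / θ * |u| ^ 4 - κ * D * |u| ^ 4) := by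
        rw [sq_abs, hu4, show |u| ^ 3 = |u| * u ^ 2 by rw [← sq_abs u]; ring,
          show u ^ 4 = u ^ 2 * u ^ 2 by ring]
        rw [sq_abs]
        ring
      have h5 : κ * D * |u| ^ 4 ≤ |κ| * D * |u| ^ 4 := by
        gcongr; exact le_abs_self κ
      have h6 : C * |u| ^ 5 ≤ C * |u| ^ 4 := by
        gcongr C * ?_
        exact pow_le_pow_of_le_one hapos.le hu1 (by norm_num)
      have h7 : |κ| * |u| ^ 3 * (|u| * (|κ| / θ + D + C)) < |κ| * |u| ^ 3 * |κ| := by gcongr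
      have h8 := mul_le_mul_of_nonneg_left h6 hκ0.le
      have e7 : |κ| * |u| ^ 3 * (|u| * (|κ| / θ + D + C)) =
          |κ| ^ 2 / θ * |u| ^ 4 + |κ| * D * |u| ^ 4 + |κ| * (C * |u| ^ 4) := by ring
      have e8 : |κ| * |u| * (C * |u| ^ 4) = |κ| * (C * |u| ^ 5) := by ring
      have e9 : |κ| * |u| ^ 3 * |κ| = |κ| ^ 2 * |u| ^ 3 := by ring
      rw [e7, e9] at h7
      rw [e8] at h4
      linarith
    by_contra! hcon
    refine hmove |u| (by rwa [abs_abs]) (fun x hx => ?_)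
      (mem_uIcc.2 (Or.inr ⟨hcon, h00.le⟩))
    rcases mem_uIcc.1 hx with h | h
    · exact (hgu.trans_le h.1).ne'
    · exact (hgt'.trans_le h.1).ne'

end LorenzCM

/-! ### The pitchfork bifurcation -/

namespace LorenzCM

variable {ζ θ : ℝ} {r : ℕ} {U : Set (ℝ × ℝ)} {h : ℝ × ℝ → ℝ × ℝ}

/-- A family whose zeros are `u = 0` and the parabola `u² = θ ρ`, and for which `κ u g` is negative
below the parabola and positive above it, has a pitchfork. The stability types enter only through
sufficient conditions in terms of signs. -/
theorem isPitchfork_of_sign {A B : (ℝ → ℝ) → ℝ → Prop} {g : ℝ → ℝ → ℝ} {κ d : ℝ}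
    (hd : 0 < d) (hθ : 0 < θ)
    (hA : ∀ ρ p η, 0 < η → |ρ| < d → |p| + η < d →
      (∀ u, 0 < |u - p| → |u - p| ≤ η → κ * ((u - p) * g ρ u) < 0) → A (g ρ) p)
    (hB : ∀ ρ p η, 0 < η → |ρ| < d → |p| + η < d →
      (∀ u, 0 < |u - p| → |u - p| ≤ η → 0 < κ * ((u - p) * g ρ u)) → B (g ρ) p)
    (hzero : ∀ ρ u, |ρ| < d → |u| < d → (g ρ u = 0 ↔ u = 0 ∨ u ^ 2 = θ * ρ))
    (hneg : ∀ ρ u, |ρ| < d → |u| < d → u ≠ 0 → θ * ρ < u ^ 2 → κ * (u * g ρ u) < 0)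
    (hpos : ∀ ρ u, |ρ| < d → |u| < d → u ≠ 0 → u ^ 2 < θ * ρ → 0 < κ * (u * g ρ u)) :
    IsPitchfork A B g := by
  have hsmall : ∀ ρ, |ρ| < min d (d ^ 2 / θ) → |ρ| < d ∧ √(θ * ρ) < d := by
    intro ρ hρ
    refine ⟨hρ.trans_le (min_le_left _ _), ?_⟩
    rw [Real.sqrt_lt' hd]
    have := (le_abs_self ρ).trans_lt (hρ.trans_le (min_le_right _ _))
    rw [lt_div_iff₀ hθ] at this
    linarith
  have hlim : Tendsto (fun ρ => √(θ * ρ)) (𝓝[{ρ | 0 < (1 : ℝ) * ρ}] 0) (𝓝 0) := by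
    have : ContinuousAt (fun ρ => √(θ * ρ)) 0 := by fun_prop
    have := this.tendsto
    simp only [mul_zero, Real.sqrt_zero] at this
    exact this.mono_left nhdsWithin_le_nhds
  refine ⟨1, Or.inl rfl, d, hd, min d (d ^ 2 / θ), by positivity, fun ρ hρ hρ0 => ?_,
    fun ρ => -√(θ * ρ), fun ρ => √(θ * ρ), by simpa using hlim.neg, hlim, fun ρ hρ hρ0 => ?_⟩
  · have hρd := (hsmall ρ hρ).1
    rw [one_mul] at hρ0
    have hθρ : θ * ρ ≤ 0 := mul_nonpos_of_nonneg_of_nonpos hθ.le hρ0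
    constructor
    · ext u
      simp only [mem_ofPred_eq, mem_Ioo, mem_singleton_iff]
      constructor
      · rintro ⟨hu, hg⟩
        rcases (hzero ρ u hρd (abs_lt.2 hu)).1 hg with h0 | h0
        · exact h0
        · exact pow_eq_zero_iff two_ne_zero |>.1 (le_antisymm (by linarith) (sq_nonneg u))
      · rintro rfl
        exact ⟨⟨by linarith, hd⟩, (hzero ρ 0 hρd (by simpa)).2 (Or.inl rfl)⟩
    · refine hA ρ 0 (d / 2) (by linarith) hρd (by rw [abs_zero]; linarith) fun u h1 h2 => ?_
      rw [sub_zero] at h1 h2 ⊢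
      have hu0 : u ≠ 0 := abs_pos.1 h1
      have : 0 < u ^ 2 := by positivity
      exact hneg ρ u hρd (by linarith) hu0 (by linarith)
  · obtain ⟨hρd, hsd⟩ := hsmall ρ hρ
    rw [one_mul] at hρ0
    set s := √(θ * ρ) with hs
    have hs0 : 0 < s := Real.sqrt_pos.2 (by positivity)
    have hs2 : s ^ 2 = θ * ρ := Real.sq_sqrt (by positivity)
    -- the two outer equilibria `c = ± s`
    have houter : ∀ c, |c| = s → A (g ρ) c := by
      intro c hc
      have hc2 : c ^ 2 = θ * ρ := by rw [← sq_abs, hc, hs2]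
      refine hA ρ c (min (s / 2) ((d - s) / 2)) (lt_min (by linarith) (by linarith)) hρd
        (by rw [hc]; linarith [min_le_right (s / 2) ((d - s) / 2)]) fun u h1 h2 => ?_
      have h3 : |u - c| ≤ s / 2 := h2.trans (min_le_left _ _)
      have h4 : |u - c| ≤ (d - s) / 2 := h2.trans (min_le_right _ _)
      have hud : |u| < d := by
        have := abs_add_le (u - c) c
        rw [sub_add_cancel, hc] at this
        linarith
      -- `u` and `c` have the same sign
      have huc : 0 < u * c := by
        have := neg_abs_le ((u - c) * c)
        rw [abs_mul, hc] at this
        have h5 : |u - c| * s ≤ s / 2 * s := by gcongr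
        nlinarith
      have hu0 : u ≠ 0 := fun h => by simp [h] at huc
      have hplus : 0 < u * (u + c) := by
        have : 0 < u ^ 2 := by positivity
        linarith
      have hu2 : 0 < u ^ 2 := by positivity
      -- `(u - c) * (u * (u + c)) = u * (u ^ 2 - c ^ 2)`
      have key : (κ * ((u - c) * g ρ u)) * (u * (u + c)) =
          (κ * (u * g ρ u)) * (u ^ 2 - c ^ 2) := by ring
      have hne : u ^ 2 - c ^ 2 ≠ 0 := by
        have : u ^ 2 - c ^ 2 = (u - c) * (u + c) := by ring
        rw [this]
        exact mul_ne_zero (abs_pos.1 h1) fun h => by simp [h] at hplus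
      have hlt : (κ * (u * g ρ u)) * (u ^ 2 - c ^ 2) < 0 := by
        rcases lt_or_gt_of_ne hne with h | h
        · exact mul_neg_of_pos_of_neg (hpos ρ u hρd hud hu0 (by linarith)) h
        · exact mul_neg_of_neg_of_pos (hneg ρ u hρd hud hu0 (by linarith)) h
      rw [← key] at hlt
      exact neg_of_mul_neg_left hlt hplus.le
    refine ⟨by linarith, hs0, ?_, houter _ (by rw [abs_neg, abs_of_pos hs0]), ?_,
      houter _ (abs_of_pos hs0)⟩
    · ext u
      simp only [mem_ofPred_eq, mem_Ioo, mem_insert_iff, mem_singleton_iff]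
      have hiff : u ^ 2 = θ * ρ ↔ u = s ∨ u = -s := by rw [← hs2, sq_eq_sq_iff_eq_or_eq_neg]
      constructor
      · rintro ⟨hu, hg⟩
        have := (hzero ρ u hρd (abs_lt.2 hu)).1 hg
        rw [hiff] at this
        tauto
      · intro hu
        have hu' : |u| < d := by
          rcases hu with rfl | rfl | rfl
          · rwa [abs_neg, abs_of_pos hs0]
          · simpa
          · rwa [abs_of_pos hs0]
        exact ⟨abs_lt.1 hu', (hzero ρ u hρd hu').2 (by rw [hiff]; tauto)⟩
    · refine hB ρ 0 (s / 2) (by linarith) hρd (by rw [abs_zero]; linarith) fun u h1 h2 => ?_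
      rw [sub_zero] at h1 h2 ⊢
      have : u ^ 2 < s ^ 2 := by
        rw [← sq_abs]
        exact pow_lt_pow_left₀ (by linarith) (abs_nonneg u) two_ne_zero
      exact hpos ρ u hρd (by linarith) (abs_pos.1 h1) (by linarith)

/-- The curves `u = 0` and `u² = θ ρ` consist of equilibria: the reduced field changes its sign on
them. -/
theorem IsLocalCenterManifold.exists_zero_iff (H : IsLocalCenterManifold ζ θ r U h)
    (hζ : -1 < ζ) (hζ0 : ζ ≠ 0) (hθ : 0 < θ) (hr : 1 ≤ r) :
    ∃ d > 0, (∀ u ρ : ℝ, |u| < d → |ρ| < d → (u, ρ) ∈ U) ∧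
      (∀ ρ u, |ρ| < d → |u| < d → (reducedField ζ θ h ρ u = 0 ↔ u = 0 ∨ u ^ 2 = θ * ρ)) ∧
      (∀ ρ u, |ρ| < d → |u| < d → u ≠ 0 → θ * ρ < u ^ 2 →
        ζ / (1 + ζ) * (u * reducedField ζ θ h ρ u) < 0) ∧
      (∀ ρ u, |ρ| < d → |u| < d → u ≠ 0 → u ^ 2 < θ * ρ →
        0 < ζ / (1 + ζ) * (u * reducedField ζ θ h ρ u)) := by
  obtain ⟨d, hd, hs⟩ := H.exists_sign hζ hζ0 hθ hr
  have h1 : 0 < 1 + ζ := by linarith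
  obtain ⟨κ, hκ⟩ : ∃ κ, κ = ζ / (1 + ζ) := ⟨_, rfl⟩
  have hκ0 : κ ≠ 0 := hκ ▸ div_ne_zero hζ0 h1.ne'
  rw [← hκ] at hs ⊢
  refine ⟨d, hd, fun u ρ hu hρ => (hs u ρ hu hρ).1, fun ρ u hρ hu =>
    ⟨H.eq_zero_or_sq_eq hζ hζ0 hr (hs u ρ hu hρ).1, fun h0 => ?_⟩,
    fun ρ u hρ hu hu0 => ((hs u ρ hu hρ).2 hu0).1, fun ρ u hρ hu hu0 => ((hs u ρ hu hρ).2 hu0).2⟩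
  have hc := H.continuousAt_reducedField hζ (hs u ρ hu hρ).1
  by_cases hu0 : u = 0
  · -- the sign of `g` on both sides of `u = 0`
    subst hu0
    have hcu : ContinuousAt (fun s => reducedField ζ θ h ρ s) 0 :=
      hc.comp (f := fun s : ℝ => (s, ρ)) (by fun_prop)
    have hnear : ∀ᶠ s in 𝓝 (0 : ℝ), |s| < d := by
      filter_upwards [Metric.ball_mem_nhds (0 : ℝ) hd] with s hs
      simpa using hs
    rcases le_or_gt ρ 0 with hρ0 | hρ0
    · have := eq_zero_of_eventually_sub_mul_pos (F := fun s => -κ * reducedField ζ θ h ρ s)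
        (continuousAt_const.mul hcu) (by
          filter_upwards [self_mem_nhdsWithin, hnear.filter_mono nhdsWithin_le_nhds] with s h1 h2
          have hs0 : s ≠ 0 := h1
          have h3 := ((hs s ρ h2 hρ).2 hs0).1 (by
            have : 0 < s ^ 2 := by positivity
            have := mul_nonpos_of_nonneg_of_nonpos hθ.le hρ0
            linarith)
          linarith)
      simpa [hκ0] using this
    · have hnear' : ∀ᶠ s in 𝓝 (0 : ℝ), s ^ 2 < θ * ρ := by
        have : Tendsto (fun s : ℝ => s ^ 2) (𝓝 0) (𝓝 0) := by
          simpa using (continuous_pow 2 (M := ℝ)).tendsto 0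
        exact this.eventually_lt_const (by positivity)
      have := eq_zero_of_eventually_sub_mul_pos (F := fun s => κ * reducedField ζ θ h ρ s)
        (continuousAt_const.mul hcu) (by
          filter_upwards [self_mem_nhdsWithin, hnear.filter_mono nhdsWithin_le_nhds,
            hnear'.filter_mono nhdsWithin_le_nhds] with s h1 h2 h4
          have h3 := ((hs s ρ h2 hρ).2 h1).2 h4
          linarith)
      simpa [hκ0] using this
  · -- the sign of `g` below and above the parabola
    have hsq := h0.resolve_left hu0
    have hcρ : ContinuousAt (fun s => reducedField ζ θ h s u) ρ :=
      hc.comp (f := fun s : ℝ => (u, s)) (by fun_prop)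
    have hnear : ∀ᶠ s in 𝓝 ρ, |s| < d := continuous_abs.continuousAt.eventually_lt_const hρ
    have := eq_zero_of_eventually_sub_mul_pos (F := fun s => κ * (u * reducedField ζ θ h s u))
      (continuousAt_const.mul (continuousAt_const.mul hcρ)) (by
        filter_upwards [self_mem_nhdsWithin, hnear.filter_mono nhdsWithin_le_nhds] with s h1 h2
        obtain ⟨h3, h4⟩ := (hs u s hu h2).2 hu0
        rw [hsq] at h3 h4
        rcases lt_or_gt_of_ne (show s ≠ ρ from h1) with h | h
        · exact mul_pos_of_neg_of_neg (by linarith) (h3 (by gcongr))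
        · exact mul_pos (by linarith) (h4 (by gcongr)))
    simpa [hκ0, hu0] using this

theorem IsLocalCenterManifold.isAsympStableEq_and_isUnstableEq
    (H : IsLocalCenterManifold ζ θ r U h) (hζ : -1 < ζ) (hr : 1 ≤ r) {d : ℝ}
    (hU : ∀ u ρ : ℝ, |u| < d → |ρ| < d → (u, ρ) ∈ U) {ρ p η : ℝ} (hη : 0 < η) (hρ : |ρ| < d)
    (hp : |p| + η < d) :
    ((∀ u, 0 < |u - p| → |u - p| ≤ η → (u - p) * reducedField ζ θ h ρ u < 0) →
      IsAsympStableEq (reducedField ζ θ h ρ) p) ∧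
    ((∀ u, 0 < |u - p| → |u - p| ≤ η → 0 < (u - p) * reducedField ζ θ h ρ u) →
      IsUnstableEq (reducedField ζ θ h ρ) p) := by
  have hc : ContDiffOn ℝ r (reducedField ζ θ h ρ) (Icc (p - η) (p + η)) :=
    H.contDiffOn_reducedField hζ fun u hu => hU u ρ (by
      have := abs_le.1 (le_refl |p|)
      exact abs_lt.2 ⟨by linarith [hu.1], by linarith [hu.2]⟩) hρ
  obtain ⟨k, hk⟩ := hc.exists_lipschitzOnWith (by exact_mod_cast (by omega : r ≠ 0))
    (convex_Icc _ _) isCompact_Icc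
  exact ⟨isAsympStableEq_of_attracting hη hc.continuousOn, isUnstableEq_of_repelling hη hk⟩

theorem IsLocalCenterManifold.isSupercriticalPitchfork (H : IsLocalCenterManifold ζ θ r U h)
    (hζ : 0 < ζ) (hθ : 0 < θ) (hr : 1 ≤ r) :
    IsSupercriticalPitchfork (reducedField ζ θ h) := by
  have hζ1 : -1 < ζ := by linarith
  obtain ⟨d, hd, hU, hz, hn, hp⟩ := H.exists_zero_iff hζ1 hζ.ne' hθ hr
  have hκ : 0 < ζ / (1 + ζ) := by positivity
  exact isPitchfork_of_sign hd hθ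
    (fun ρ p η hη hρ hpη hs => (H.isAsympStableEq_and_isUnstableEq hζ1 hr hU hη hρ hpη).1
      fun u h1 h2 => neg_of_mul_neg_right (hs u h1 h2) hκ.le)
    (fun ρ p η hη hρ hpη hs => (H.isAsympStableEq_and_isUnstableEq hζ1 hr hU hη hρ hpη).2
      fun u h1 h2 => (mul_pos_iff_of_pos_left hκ).1 (hs u h1 h2)) hz hn hp

theorem IsLocalCenterManifold.isSubcriticalPitchfork (H : IsLocalCenterManifold ζ θ r U h)
    (hζ : -1 < ζ) (hζ0 : ζ < 0) (hθ : 0 < θ) (hr : 1 ≤ r) :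
    IsSubcriticalPitchfork (reducedField ζ θ h) := by
  obtain ⟨d, hd, hU, hz, hn, hp⟩ := H.exists_zero_iff hζ hζ0.ne hθ hr
  have hκ : ζ / (1 + ζ) < 0 := div_neg_of_neg_of_pos hζ0 (by linarith)
  exact isPitchfork_of_sign hd hθ
    (fun ρ p η hη hρ hpη hs => (H.isAsympStableEq_and_isUnstableEq hζ hr hU hη hρ hpη).2
      fun u h1 h2 => pos_of_mul_neg_right (hs u h1 h2) hκ.le)
    (fun ρ p η hη hρ hpη hs => (H.isAsympStableEq_and_isUnstableEq hζ hr hU hη hρ hpη).1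
      fun u h1 h2 => neg_of_mul_pos_right (hs u h1 h2) hκ.le) hz hn hp

/-- At `ρ = 0` the equilibrium `0` is stable in the supercritical case and unstable in the
subcritical one. -/
theorem IsSupercriticalPitchfork.not_isSubcriticalPitchfork {g : ℝ → ℝ → ℝ}
    (hs : IsSupercriticalPitchfork g) : ¬ IsSubcriticalPitchfork g := by
  obtain ⟨_, _, _, _, ε, hε, h, _⟩ := hs
  rintro ⟨_, _, _, _, ε', hε', h', _⟩
  exact (h' 0 (by simpa) (by simp)).2.2 (h 0 (by simpa) (by simp)).2.1

theorem not_isPitchfork_of_forall_eq_zero {A B : (ℝ → ℝ) → ℝ → Prop} {g : ℝ → ℝ → ℝ}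
    (hg : ∀ ρ u, g ρ u = 0) : ¬ IsPitchfork A B g := by
  rintro ⟨σ, _, δ, hδ, ε, hε, h, _⟩
  have hmem : δ / 2 ∈ {u ∈ Ioo (-δ) δ | g 0 u = 0} :=
    ⟨⟨by linarith, by linarith⟩, hg 0 _⟩
  rw [(h 0 (by simpa) (by simp)).1, mem_singleton_iff] at hmem
  linarith

theorem IsLocalCenterManifold.isPitchfork_iff (H : IsLocalCenterManifold ζ θ r U h)
    (hζ : -1 < ζ) (hθ : 0 < θ) (hr : 1 ≤ r) :
    (IsSupercriticalPitchfork (reducedField ζ θ h) ↔ 0 < normalFormCoeff ζ θ) ∧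
      (IsSubcriticalPitchfork (reducedField ζ θ h) ↔ normalFormCoeff ζ θ < 0) := by
  have hden : 0 < θ * (1 + ζ) := mul_pos hθ (by linarith)
  rcases lt_trichotomy ζ 0 with h0 | h0 | h0
  · have hX : normalFormCoeff ζ θ < 0 := div_neg_of_neg_of_pos h0 hden
    have hsub := H.isSubcriticalPitchfork hζ h0 hθ hr
    exact ⟨⟨fun h => absurd hsub h.not_isSubcriticalPitchfork, fun h => absurd h hX.not_gt⟩,
      ⟨fun _ => hX, fun _ => hsub⟩⟩
  · subst h0
    have hX : normalFormCoeff 0 θ = 0 := by simp [normalFormCoeff]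
    have hg : ∀ ρ u, reducedField 0 θ h ρ u = 0 := fun ρ u => by
      rw [reducedField_eq hζ, fieldU]; simp
    rw [hX]
    exact ⟨⟨fun h => (not_isPitchfork_of_forall_eq_zero hg h).elim, fun h => (lt_irrefl _ h).elim⟩,
      ⟨fun h => (not_isPitchfork_of_forall_eq_zero hg h).elim, fun h => (lt_irrefl _ h).elim⟩⟩
  · have hX : 0 < normalFormCoeff ζ θ := div_pos h0 hden
    have hsup := H.isSupercriticalPitchfork h0 hθ hr
    exact ⟨⟨fun _ => hX, fun _ => hsup⟩,
      ⟨fun h => absurd h hsup.not_isSubcriticalPitchfork, fun h => absurd h hX.not_gt⟩⟩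

end LorenzCM

theorem mainTheorem3 (ζ θ : ℝ) (hζ : -1 < ζ) (hθ : 0 < θ) (r : ℕ) (hr : 1 ≤ r) :
    (∃ (U : Set (ℝ × ℝ)) (h : ℝ × ℝ → ℝ × ℝ), LorenzCM.IsLocalCenterManifold ζ θ r U h) ∧
    ∀ (U : Set (ℝ × ℝ)) (h : ℝ × ℝ → ℝ × ℝ), LorenzCM.IsLocalCenterManifold ζ θ r U h →
      ((fun q : ℝ × ℝ => (h q).1 - (-(1 / (1 + ζ) ^ 2) * q.2 * q.1))
        =O[𝓝 (0, 0)] (fun q : ℝ × ℝ => ‖q‖ ^ 3)) ∧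
      ((fun q : ℝ × ℝ => (h q).2 - 1 / θ * q.1 ^ 2)
        =O[𝓝 (0, 0)] (fun q : ℝ × ℝ => ‖q‖ ^ 3)) ∧
      (∀ (ρ a b : ℝ) (u : ℝ → ℝ), (∀ t ∈ Icc a b, (u t, ρ) ∈ U) →
        (IsIntegralCurveOn
            (fun t => LorenzCM.ofEigen ζ (u t) (h (u t, ρ)).1 (h (u t, ρ)).2)
            (fun _ => LorenzCM.lorenzField ζ θ ρ) (Icc a b) ↔
          IsIntegralCurveOn u (fun _ => LorenzCM.reducedField ζ θ h ρ) (Icc a b))) ∧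
      ((fun q : ℝ × ℝ => LorenzCM.reducedField ζ θ h q.2 q.1 -
          (ζ / (1 + ζ) * q.2 * q.1 - LorenzCM.normalFormCoeff ζ θ * q.1 ^ 3
            - ζ ^ 2 / (1 + ζ) ^ 3 * q.2 ^ 2 * q.1))
        =O[𝓝 (0, 0)] (fun q : ℝ × ℝ => ‖q‖ ^ 4)) ∧
      (LorenzCM.IsSupercriticalPitchfork (LorenzCM.reducedField ζ θ h) ↔
        0 < LorenzCM.normalFormCoeff ζ θ) ∧
      (LorenzCM.IsSubcriticalPitchfork (LorenzCM.reducedField ζ θ h) ↔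
        LorenzCM.normalFormCoeff ζ θ < 0) := by 
  refine ⟨LorenzCM.exists_isLocalCenterManifold hζ hθ hr, fun U h H =>
    ⟨H.isBigO_fst hζ hθ hr, H.isBigO_snd hζ hθ hr, fun ρ a b u hq => H.isIntegralCurveOn_iff hζ hr hq,
      H.isBigO_reducedField hζ hθ hr, H.isPitchfork_iff hζ hθ hr⟩⟩
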